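/- **Conventions.** *Number field case.* An infinite number field is an infinite algebraic extension $\mathcal K$ of $\mathbb Q$. For a number field $K$ put $g_K=\tfrac12\log|D_K|$, where $D_K$ is the discriminant; let $\Phi_q(K)$ be the number of non-archimedean places of $K$ of norm $q$, and $\Phi_{\mathbb R}(K)$, $\Phi_{\mathbb C}(K)$ the numbers of real and complex places. *Function field case.* Let $\mathbb F_r$ be the finite field with $r$ elements. An infinite function field over $\mathbb F_r$ is an infinite separable algebraic extension $\mathcal K$ of $\mathbb F_r(t)$ in which every element algebraic over $\mathbb F_r$ lies in $\mathbb F_r$, and whose subfields finite over $\mathbb F_r(t)$ have unbounded genus. For a finite extension $K$ of $\mathbb F_r(t)$ with constant field $\mathbb F_r$, let $g_K$ be its genus and $\Phi_q(K)$ the number of its places of norm $q$ (i.e. with residue field of cardinality $q$). A tower representing $\mathcal K$ is a strictly increasing sequence $(K_i)_{i\in\mathbb N}$ of finite extensions of $\mathbb Q$ (resp. $\mathbb F_r(t)$) with $\bigcup_i K_i=\mathcal K$. Put $$\phi_\alpha(\mathcal K)=\lim_{i\to\infty}\frac{\Phi_\alpha(K_i)}{g_{K_i}},$$ with $\alpha$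 a prime power, $\mathbb R$ or $\mathbb C$ in the number field case, and $\alpha=r^m$ ($m\ge1$) in the function field case. With $\gamma$ the Euler–Mascheroni constant and $q$ running over the prime powers $>1$, define in the number field case $$\delta^{(1)}(\mathcal K)=1-\sum_q\frac{\phi_q(\mathcal K)\log q}{\sqrt q-1}-\Big(\log\sqrt{8\pi}+\frac\pi4+\frac\gamma2\Big)\phi_{\mathbb R}(\mathcal K)-(\log 8\pi+\gamma)\phi_{\mathbb C}(\mathcal K),$$ $$\delta^{(2)}(\mathcal K)=1-\sum_q\frac{\phi_q(\mathcal K)\log q}{q-1}-\Big(\log 2\sqrt\pi+\frac\gamma2\Big)\phi_{\mathbb R}(\mathcal K)-(\log 2\pi+\gamma)\phi_{\mathbb C}(\mathcal K),$$ and in the function field case $$\delta^{(3)}(\mathcal K)=1-\sum_{m\ge1}\frac{m\,\phi_{r^m}(\mathcal K)}{r^{m/2}-1}.$$ The series have non-negative terms and are summed in $[0,\infty]$, so the deficiencies $\delta^{(i)}$ take values in $[-\infty,1]$. **Theorem.** Every infinite number field (resp. infinite function field over $\mathbb F_r$) $\mathcal K$ is represented by a tower, and for every $\alpha$ as above the limit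 $\phi_\alpha(\mathcal K)$ exists in $\mathbb R$ along every tower representing $\mathcal K$ and does not depend on the tower. Moreover the deficiencies are increasing with respect to inclusion: if $\mathcal K\subseteq\mathcal L$ are infinite number fields, then $\delta^{(1)}(\mathcal K)\le\delta^{(1)}(\mathcal L)$ and $\delta^{(2)}(\mathcal K)\le\delta^{(2)}(\mathcal L)$; if $\mathcal K\subseteq\mathcal L$ are infinite function fields over $\mathbb F_r$ (extensions of the same $\mathbb F_r(t)$), then $\delta^{(3)}(\mathcal K)\le\delta^{(3)}(\mathcal L)$. -/

import Mathlib

open scoped ENNReal WithZero NumberField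

namespace InfiniteGlobalField

noncomputable section

/-! ### Towers and limits along towers -/

/-- A tower of finite extensions of `k` representing `𝒦`: a strictly increasing sequence of
subfields of `𝒦`, finite over `k`, whose union is `𝒦`. -/
structure Tower {k Ω : Type*} [Field k] [Field Ω] [Algebra k Ω] (𝒦 : IntermediateField k Ω) where
  field : ℕ → IntermediateField k Ω
  finite : ∀ i, FiniteDimensional k (field i)
  strictMono : StrictMono field
  union : ⋃ i, (field i : Set Ω) = (𝒦 : Set Ω)

attribute [instance] Tower.finite

/-- `x` is the limit of the quantity `f` along every tower representing `𝒦`. -/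
def HasTowerLimit {k Ω : Type*} [Field k] [Field Ω] [Algebra k Ω] (𝒦 : IntermediateField k Ω)
    (f : (K : IntermediateField k Ω) → [FiniteDimensional k K] → ℝ) (x : ℝ) : Prop :=
  ∀ T : Tower 𝒦, Filter.Tendsto (fun i => f (T.field i)) Filter.atTop (nhds x)

open Classical in
/-- The common limit of `f` along all towers representing `𝒦` (and `0` if there is none). -/
def towerLimit {k Ω : Type*} [Field k] [Field Ω] [Algebra k Ω] (𝒦 : IntermediateField k Ω)
    (f : (K : IntermediateField k Ω) → [FiniteDimensional k K] → ℝ) : ℝ :=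
  if h : ∃ x, HasTowerLimit 𝒦 f x then h.choose else 0

/-! ### Number fields -/

namespace NF

/-- The genus `½ log |D_K|` of a number field. -/
def genus (K : Type*) [Field K] [NumberField K] : ℝ :=
  Real.log |(NumberField.discr K : ℝ)| / 2

/-- `Φ_q(K)`: the number of non-archimedean places of norm `q` of a number field. -/
def numPlaces (K : Type*) [Field K] (q : ℕ) : ℕ :=
  Nat.card {v : IsDedekindDomain.HeightOneSpectrum (𝓞 K) // Nat.card (𝓞 K ⧸ v.asIdeal) = q}

theorem numberField {Ω : Type*} [Field Ω] [CharZero Ω] (K : IntermediateField ℚ Ω)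
    [h : FiniteDimensional ℚ K] : NumberField K where
  to_charZero := inferInstance
  to_finiteDimensional := h

variable {Ω : Type*} [Field Ω] [CharZero Ω]

/-- `Φ_q(K) / g_K` -/
def ratio (q : ℕ) (K : IntermediateField ℚ Ω) [FiniteDimensional ℚ K] : ℝ :=
  haveI := numberField K
  numPlaces K q / genus K

/-- `Φ_ℝ(K) / g_K` -/
def realRatio (K : IntermediateField ℚ Ω) [FiniteDimensional ℚ K] : ℝ :=
  haveI := numberField K
  NumberField.InfinitePlace.nrRealPlaces K / genus K

/-- `Φ_ℂ(K) / g_K` -/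
def complexRatio (K : IntermediateField ℚ Ω) [FiniteDimensional ℚ K] : ℝ :=
  haveI := numberField K
  NumberField.InfinitePlace.nrComplexPlaces K / genus K

/-- Infinite number fields: infinite algebraic extensions of `ℚ`. -/
structure IsInfinite (𝒦 : IntermediateField ℚ Ω) : Prop where
  algebraic : Algebra.IsAlgebraic ℚ 𝒦
  infinite : ¬ FiniteDimensional ℚ 𝒦

/-- `φ_q(𝒦)` -/
def phi (q : ℕ) (𝒦 : IntermediateField ℚ Ω) : ℝ := towerLimit 𝒦 (ratio q)

/-- `φ_ℝ(𝒦)` -/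
def phiReal (𝒦 : IntermediateField ℚ Ω) : ℝ := towerLimit 𝒦 realRatio

/-- `φ_ℂ(𝒦)` -/
def phiComplex (𝒦 : IntermediateField ℚ Ω) : ℝ := towerLimit 𝒦 complexRatio

/-- The deficiency `δ⁽¹⁾`. The series of non-negative terms is summed in `[0, ∞]`, so that the
deficiency is defined, with values in `[-∞, 1]`, whether or not the series converges. -/
def deficiency₁ (𝒦 : IntermediateField ℚ Ω) : EReal :=
  1 - ((∑' q : {q : ℕ // IsPrimePow q},
        ENNReal.ofReal (phi q 𝒦 * Real.log (q : ℕ) / (√(q : ℕ) - 1)) : ℝ≥0∞) : EReal)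
    - (((Real.log √(8 * Real.pi) + Real.pi / 4 + Real.eulerMascheroniConstant / 2) * phiReal 𝒦
        + (Real.log (8 * Real.pi) + Real.eulerMascheroniConstant) * phiComplex 𝒦 : ℝ) : EReal)

/-- The deficiency `δ⁽²⁾`, with values in `[-∞, 1]`. -/
def deficiency₂ (𝒦 : IntermediateField ℚ Ω) : EReal :=
  1 - ((∑' q : {q : ℕ // IsPrimePow q},
        ENNReal.ofReal (phi q 𝒦 * Real.log (q : ℕ) / ((q : ℕ) - 1)) : ℝ≥0∞) : EReal)
    - (((Real.log (2 * √Real.pi) + Real.eulerMascheroniConstant / 2) * phiReal 𝒦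
        + (Real.log (2 * Real.pi) + Real.eulerMascheroniConstant) * phiComplex 𝒦 : ℝ) : EReal)

end NF

/-! ### Function fields -/

namespace FF

/-- Places of a function field `K / F`, as normalized discrete valuations trivial on `F`. -/
structure Place (F K : Type*) [Field F] [Field K] [Algebra F K] where
  val : Valuation K ℤᵐ⁰
  surjective : Function.Surjective val
  trivialOn : val.IsTrivialOn F

attribute [instance] Place.trivialOn

variable {F K : Type*} [Field F] [Field K] [Algebra F K]

instance Place.algebra (P : Place F K) : Algebra F P.val.valuationSubring :=
  ((algebraMap F K).codRestrict P.val.valuationSubring.toSubring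
    (fun c => Valuation.IsTrivialOn.valuation_algebraMap_le_one P.val c)).toAlgebra

/-- The residue field of a place. -/
abbrev Place.residueField (P : Place F K) : Type _ :=
  IsLocalRing.ResidueField P.val.valuationSubring

/-- The norm of a place: the cardinality of its residue field. -/
def Place.norm (P : Place F K) : ℕ := Nat.card P.residueField

/-- The degree of a place: the dimension of its residue field over `F`. -/
def Place.degree (P : Place F K) : ℕ := Module.finrank F P.residueField

/-- The degree of a divisor `∑ D(P) P`. -/
def divisorDegree (D : Place F K →₀ ℤ) : ℤ := D.sum fun P n => n * P.degree

/-- The Riemann–Roch space `L(D)` of the `f` in `K` with `ord_P f ≥ -D(P)` for all `P`. -/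
def riemannRochSpace (D : Place F K →₀ ℤ) : Submodule F K where
  carrier := {f | ∀ P : Place F K, P.val f ≤ WithZero.exp (D P)}
  zero_mem' P := by simp
  add_mem' ha hb P := P.val.map_add_le (ha P) (hb P)
  smul_mem' c f hf P := by
    rw [Algebra.smul_def, map_mul]
    exact (mul_le_of_le_one_left' (Valuation.IsTrivialOn.valuation_algebraMap_le_one P.val c)).trans
      (hf P)

variable (F K) in
/-- The genus of a function field `K / F` (with full constant field `F`): the maximum over all
divisors `D` of `deg D + 1 - dim L(D)`. -/
def genus : ℤ :=
  ⨆ D : Place F K →₀ ℤ, (divisorDegree D + 1 - Module.finrank F (riemannRochSpace D))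

variable (F K) in
/-- `Φ_q(K)`: the number of places of norm `q` of a function field. -/
def numPlaces (q : ℕ) : ℕ := Nat.card {P : Place F K // P.norm = q}

variable (F) {Ω : Type*} [Field Ω] [Algebra F Ω] [Algebra (RatFunc F) Ω]
  [IsScalarTower F (RatFunc F) Ω]

/-- `Φ_q(K) / g_K` -/
def ratio (q : ℕ) (K : IntermediateField (RatFunc F) Ω) [FiniteDimensional (RatFunc F) K] : ℝ :=
  numPlaces F K q / genus F K

/-- Infinite function fields over the finite field `F`: infinite separable algebraic extensions of
`F(t)` with constant field `F`, containing finite extensions of `F(t)` of arbitrarily large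
genus. -/
structure IsInfinite (𝒦 : IntermediateField (RatFunc F) Ω) : Prop where
  separable : Algebra.IsSeparable (RatFunc F) 𝒦
  infinite : ¬ FiniteDimensional (RatFunc F) 𝒦
  constants : ∀ x ∈ 𝒦, IsAlgebraic F x → x ∈ (algebraMap F Ω).range
  genus_unbounded : ∀ n : ℤ, ∃ K : IntermediateField (RatFunc F) Ω,
    K ≤ 𝒦 ∧ FiniteDimensional (RatFunc F) K ∧ n ≤ genus F K

/-- `φ_q(𝒦)` -/
def phi (q : ℕ) (𝒦 : IntermediateField (RatFunc F) Ω) : ℝ := towerLimit 𝒦 (ratio F q)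

/-- The deficiency `δ⁽³⁾`, where `r` is the number of elements of `F`, with values in `[-∞, 1]`:
the series of non-negative terms is summed in `[0, ∞]`. -/
def deficiency₃ (𝒦 : IntermediateField (RatFunc F) Ω) : EReal :=
  1 - ((∑' m : ℕ+, ENNReal.ofReal
        ((m : ℕ) * phi F (Nat.card F ^ (m : ℕ)) 𝒦 / ((Nat.card F : ℝ) ^ ((m : ℕ) / 2 : ℝ) - 1)) :
        ℝ≥0∞) : EReal)

end FF

end

end InfiniteGlobalField

set_option linter.unusedSectionVars false


namespace InfiniteGlobalField

/-! ### Towers -/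

section Towers

variable {k Ω : Type*} [Field k] [Field Ω] [Algebra k Ω]

/-! In a finite extension L/K the genus grows at least as fast as the degree. For number fields
D_K^[L:K] divides D_L, so [L:K]·g_K ≤ g_L. For function fields Riemann–Hurwitz gives [L:K]·(g_K − 1)
≤ g_L − 1. If a count S satisfies S(L) ≤ [L:K]·S(K), then S/g (resp. S/(g − 1)) decreases as the
field grows. Every finite subfield of 𝒦 lies in some step of any tower, so the limit along a tower
is the infimum over all finite subfields of positive denominator (`hasTowerLimit_div`). This does
not depend on the tower, and it can only decrease when 𝒦 grows (`sInf_ratioSet_anti`).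

A single Φ_q is not such a count, since places of norm q may lie over places of smaller norm. But
the residue degrees above a prime add up to at most [L:K], so the partial sums ∑_{m ≤ f} m·Φ_{p^m}
are such counts (`weightedPrimeCount_le`). Their differences give the limits φ_q, and the sums ∑_{m
≤ f} m·φ_{p^m} decrease under inclusion. The weights log p/(√q − 1), log p/(q − 1) and 1/(r^(m/2) −
1) decrease in m, so Abel summation carries the inequality over to the series. At the infinite
places the two counts are r₁ + r₂ and r₁ + 2r₂. A combination a·φ_ℝ + b·φ_ℂ with a ≤ b ≤ 2a is a
nonnegative combination of their limits.

The main work is Riemann–Hurwitz for a genus defined as a supremum over divisors.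
`exists_isReducedBasis` finds a basis ω of K over F(t) that is integral over F[t] and such that the
t^(−m_i)·ω_i form an integral basis at infinity; in other words, it splits the direct image of the
structure sheaf on the projective line into line bundles. Riemann–Roch spaces of multiples of the
pole divisor of t can then be counted by degrees of polynomials, which gives g − 1 = ∑ m_i −
[K:F(t)] (`IsReducedBasis.genus_eq`). Comparing discriminants of K and L over F[t] and at infinity
gives [L:K]·∑ m_i ≤ ∑ μ_i (`IsReducedBasis.finrank_mul_sum_le`). -/

theorem Tower.field_le {𝒦 : IntermediateField k Ω} (T : Tower 𝒦) (i : ℕ) : T.field i ≤ 𝒦 := by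
  intro x hx
  have : x ∈ ⋃ i, (T.field i : Set Ω) := Set.mem_iUnion.2 ⟨i, hx⟩
  rw [T.union] at this
  exact this

/-- A finite basis of K is absorbed element by element by the increasing union. This is what makes
different towers comparable. -/
theorem Tower.exists_le {𝒦 : IntermediateField k Ω} (T : Tower 𝒦) (K : IntermediateField k Ω)
    [FiniteDimensional k K] (hK : K ≤ 𝒦) : ∃ i, K ≤ T.field i := by
  classical
  let b := Module.finBasis k K
  have key : ∀ t : Finset Ω, (t : Set Ω) ⊆ 𝒦 → ∃ i, (t : Set Ω) ⊆ T.field i := by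
    intro t
    induction t using Finset.induction_on with
    | empty => exact fun _ => ⟨0, by simp⟩
    | insert a t _ ih =>
      intro h
      rw [Finset.coe_insert, Set.insert_subset_iff] at h
      obtain ⟨i, hi⟩ := ih h.2
      have ha : a ∈ ⋃ i, (T.field i : Set Ω) := by rw [T.union]; exact h.1
      obtain ⟨j, hj⟩ := Set.mem_iUnion.1 ha
      refine ⟨max i j, ?_⟩
      rw [Finset.coe_insert, Set.insert_subset_iff]
      exact ⟨T.strictMono.monotone (le_max_right i j) hj,
        hi.trans (T.strictMono.monotone (le_max_left i j))⟩
  obtain ⟨i, hi⟩ := key (Finset.univ.image fun j => (b j : Ω)) (by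
    rintro x hx
    obtain ⟨j, -, rfl⟩ := Finset.mem_image.1 (Finset.mem_coe.1 hx)
    exact hK (b j).2)
  refine ⟨i, fun x hx => ?_⟩
  have hsum : x = ∑ j, b.repr ⟨x, hx⟩ j • (b j : Ω) := by
    have := congrArg (algebraMap K Ω) (b.sum_repr ⟨x, hx⟩)
    simpa [map_sum, Algebra.smul_def] using this.symm
  rw [hsum]
  exact sum_mem fun j _ => (T.field i).smul_mem
    (hi (Finset.mem_coe.2 (Finset.mem_image_of_mem _ (Finset.mem_univ j))))

/-- An infinite algebraic extension of a countable field is represented by a tower. -/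
theorem exists_tower [Countable k] (𝒦 : IntermediateField k Ω) [Algebra.IsAlgebraic k 𝒦]
    (h𝒦 : ¬ FiniteDimensional k 𝒦) : Nonempty (Tower 𝒦) := by
  -- An algebraic extension of a countable field is countable, so its elements can be adjoined one
  -- after another.
  have : Countable 𝒦 := by
    have h := Algebra.IsAlgebraic.lift_cardinalMk_le_max k 𝒦
    rw [max_eq_right (by simp)] at h
    exact Cardinal.mk_le_aleph0_iff.1 (by simpa using h)
  obtain ⟨e, he⟩ := exists_surjective_nat 𝒦
  have hinteg : ∀ x ∈ 𝒦, IsIntegral k x := fun x hx => by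
    have := (Algebra.IsAlgebraic.isAlgebraic (R := k) (⟨x, hx⟩ : 𝒦)).isIntegral
    exact this.map (IntermediateField.val 𝒦)
  let S := {K : IntermediateField k Ω // FiniteDimensional k K ∧ K ≤ 𝒦}
  have step : ∀ (i : ℕ) (K : S), ∃ L : S, K.1 < L.1 ∧ (e i : Ω) ∈ L.1 := by
    rintro i ⟨K, hK, hK𝒦⟩
    -- The i-th element of the enumeration may already lie in K, so an element outside K is adjoined
    -- too; this makes the tower strictly increasing.
    obtain ⟨y, hy𝒦, hyK⟩ : ∃ y ∈ 𝒦, y ∉ K := by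
      by_contra! hcon
      have : K = 𝒦 := le_antisymm hK𝒦 hcon
      exact h𝒦 (this ▸ hK)
    have h1 := IntermediateField.adjoin.finiteDimensional (hinteg _ (e i).2)
    have h2 := IntermediateField.adjoin.finiteDimensional (hinteg y hy𝒦)
    refine ⟨⟨K ⊔ (IntermediateField.adjoin k {(e i : Ω)} ⊔ IntermediateField.adjoin k {y}),
      inferInstance, sup_le hK𝒦 (sup_le ?_ ?_)⟩, ?_, ?_⟩
    · simp
    · simpa using hy𝒦
    · refine lt_of_le_of_ne le_sup_left fun h => hyK ?_
      rw [show K = _ from h]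
      exact (le_sup_right.trans le_sup_right :
        IntermediateField.adjoin k {y} ≤ _) (IntermediateField.mem_adjoin_simple_self k y)
    · exact (le_sup_left.trans le_sup_right :
        IntermediateField.adjoin k {(e i : Ω)} ≤ _) (IntermediateField.mem_adjoin_simple_self k _)
  choose next hnext hmem using step
  let K : ℕ → S := fun n => Nat.rec ⟨⊥, inferInstance, bot_le⟩ (fun i K => next i K) n
  refine ⟨⟨fun i => (K i).1, fun i => (K i).2.1, strictMono_nat_of_lt_succ fun i => hnext i _, ?_⟩⟩
  refine Set.Subset.antisymm (Set.iUnion_subset fun i => (K i).2.2) fun x hx => ?_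
  obtain ⟨i, hi⟩ := he ⟨x, hx⟩
  refine Set.mem_iUnion.2 ⟨i + 1, ?_⟩
  have := hmem i (K i)
  rw [hi] at this
  exact this

/-- Limits along towers are unique as soon as there is a tower. -/
theorem HasTowerLimit.unique {𝒦 : IntermediateField k Ω} (hT : Nonempty (Tower 𝒦))
    {f : (K : IntermediateField k Ω) → [FiniteDimensional k K] → ℝ} {x y : ℝ}
    (hx : HasTowerLimit 𝒦 f x) (hy : HasTowerLimit 𝒦 f y) : x = y :=
  hT.elim fun T => tendsto_nhds_unique (hx T) (hy T)

theorem HasTowerLimit.towerLimit_eq {𝒦 : IntermediateField k Ω} (hT : Nonempty (Tower 𝒦))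
    {f : (K : IntermediateField k Ω) → [FiniteDimensional k K] → ℝ} {x : ℝ}
    (hx : HasTowerLimit 𝒦 f x) : towerLimit 𝒦 f = x := by
  have h : ∃ x, HasTowerLimit 𝒦 f x := ⟨x, hx⟩
  rw [towerLimit, dif_pos h]
  exact h.choose_spec.unique hT hx

theorem HasTowerLimit.existsUnique {𝒦 : IntermediateField k Ω} (hT : Nonempty (Tower 𝒦))
    {f : (K : IntermediateField k Ω) → [FiniteDimensional k K] → ℝ} {x : ℝ}
    (hx : HasTowerLimit 𝒦 f x) : ∃! x, HasTowerLimit 𝒦 f x :=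
  ⟨x, hx, fun _ hy => hy.unique hT hx⟩

/-- The degrees of the fields of a tower tend to infinity. -/
theorem Tower.tendsto_finrank {𝒦 : IntermediateField k Ω} (T : Tower 𝒦) :
    Filter.Tendsto (fun i => (Module.finrank k (T.field i) : ℝ)) Filter.atTop Filter.atTop := by
  refine tendsto_natCast_atTop_atTop.comp (StrictMono.tendsto_atTop ?_)
  refine strictMono_nat_of_lt_succ fun i => ?_
  have h := T.strictMono (Nat.lt_succ_self i)
  by_contra! hle
  exact h.ne (IntermediateField.eq_of_le_of_finrank_le h.le hle)

/-- The set of the quotients `S K / G K`, for `K ⊆ 𝒦` finite over `k` with `G K > 0`. -/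
def ratioSet (S G : (K : IntermediateField k Ω) → [FiniteDimensional k K] → ℝ)
    (𝒦 : IntermediateField k Ω) : Set ℝ :=
  {x | ∃ (K : IntermediateField k Ω) (_ : FiniteDimensional k K), K ≤ 𝒦 ∧ 0 < G K ∧ x = S K / G K}

variable {S G : (K : IntermediateField k Ω) → [FiniteDimensional k K] → ℝ}
  {𝒦 : IntermediateField k Ω}

theorem ratioSet_bddBelow (hS : ∀ (K : IntermediateField k Ω) [FiniteDimensional k K], 0 ≤ S K) :
    BddBelow (ratioSet S G 𝒦) := by
  refine ⟨0, ?_⟩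
  rintro x ⟨K, hK, -, hG, rfl⟩
  exact div_nonneg (hS K) hG.le

/-- More subfields compete for the infimum in ℒ. The set for 𝒦 has to be nonempty because the
infimum of ∅ in ℝ is 0, and fields with G = 0 have to be excluded because S/0 = 0 would enter the
set. -/
theorem sInf_ratioSet_anti {ℒ : IntermediateField k Ω} (h : 𝒦 ≤ ℒ)
    (hS : ∀ (K : IntermediateField k Ω) [FiniteDimensional k K], 0 ≤ S K)
    (hG : ∃ (K : IntermediateField k Ω) (_ : FiniteDimensional k K), K ≤ 𝒦 ∧ 0 < G K) :
    sInf (ratioSet S G ℒ) ≤ sInf (ratioSet S G 𝒦) := by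
  obtain ⟨K, hK, hK𝒦, hGK⟩ := hG
  refine csInf_le_csInf (ratioSet_bddBelow hS) ⟨_, K, hK, hK𝒦, hGK, rfl⟩ ?_
  rintro x ⟨K, hK, hK𝒦, hG, rfl⟩
  exact ⟨K, hK, hK𝒦.trans h, hG, rfl⟩

theorem finrank_mul_finrank_field {k K L : Type*} [Field k] [Field K] [Field L] [Algebra k K]
    [Algebra k L] [Algebra K L] [IsScalarTower k K L] :
    Module.finrank k K * Module.finrank K L = Module.finrank k L :=
  Module.finrank_mul_finrank k K L

/-- If `S` grows at most, and `G` at least, as fast as the degree, then `S / (G + c)` has a limit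
along all towers. -/
theorem hasTowerLimit_div (c : ℝ)
    (hS : ∀ (K : IntermediateField k Ω) [FiniteDimensional k K], 0 ≤ S K)
    (hG : ∃ (K : IntermediateField k Ω) (_ : FiniteDimensional k K), K ≤ 𝒦 ∧ 0 < G K)
    (hSL : ∀ (K L : IntermediateField k Ω) [FiniteDimensional k K] [FiniteDimensional k L]
      [Algebra K L] [IsScalarTower k K L], L ≤ 𝒦 → S L ≤ S K * Module.finrank K L)
    (hGL : ∀ (K L : IntermediateField k Ω) [FiniteDimensional k K] [FiniteDimensional k L]
      [Algebra K L] [IsScalarTower k K L], L ≤ 𝒦 → G K * Module.finrank K L ≤ G L) :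
    HasTowerLimit 𝒦 (fun K _ => S K / (G K + c)) (sInf (ratioSet S G 𝒦)) := by
  intro T
  have hSanti : ∀ (K L : IntermediateField k Ω) [FiniteDimensional k K] [FiniteDimensional k L],
      K ≤ L → L ≤ 𝒦 → S L * Module.finrank k K ≤ S K * Module.finrank k L := by
    intro K L _ _ hKL hL
    let := (IntermediateField.inclusion hKL).toAlgebra
    have : IsScalarTower k K L := IsScalarTower.of_algebraMap_eq fun x => rfl
    rw [← finrank_mul_finrank_field (k := k) (K := K) (L := L), Nat.cast_mul, mul_left_comm,
      mul_comm]
    exact mul_le_mul_of_nonneg_left (hSL K L hL) (Nat.cast_nonneg _)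
  have hGmono : ∀ (K L : IntermediateField k Ω) [FiniteDimensional k K] [FiniteDimensional k L],
      K ≤ L → L ≤ 𝒦 → G K * Module.finrank k L ≤ G L * Module.finrank k K := by
    intro K L _ _ hKL hL
    let := (IntermediateField.inclusion hKL).toAlgebra
    have : IsScalarTower k K L := IsScalarTower.of_algebraMap_eq fun x => rfl
    rw [← finrank_mul_finrank_field (k := k) (K := K) (L := L), Nat.cast_mul, mul_left_comm,
      mul_comm (G L)]
    exact mul_le_mul_of_nonneg_left (hGL K L hL) (Nat.cast_nonneg _)
  have hpos : ∀ (K : IntermediateField k Ω) [FiniteDimensional k K],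
      (0 : ℝ) < Module.finrank k K := fun K _ => by exact_mod_cast Module.finrank_pos
  have hGpos : ∀ (K L : IntermediateField k Ω) [FiniteDimensional k K] [FiniteDimensional k L],
      K ≤ L → L ≤ 𝒦 → 0 < G K → 0 < G L := fun K L _ _ h h' h0 =>
    (pos_iff_pos_of_mul_pos ((mul_pos h0 (hpos L)).trans_le (hGmono K L h h'))).2 (hpos K)
  -- S/G decreases with the field: the two growth estimates, rewritten with degrees over k, are
  -- multiplied crosswise.
  have hle : ∀ (K L : IntermediateField k Ω) [FiniteDimensional k K] [FiniteDimensional k L],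
      K ≤ L → L ≤ 𝒦 → 0 < G K → S L / G L ≤ S K / G K := by
    intro K L _ _ h h' h0
    have hL := hGpos K L h h' h0
    rw [div_le_div_iff₀ hL h0]
    have h1 := mul_le_mul_of_nonneg_left (hGmono K L h h') (hS L)
    have h2 := mul_le_mul_of_nonneg_left (hSanti K L h h') hL.le
    have := mul_pos (hpos K) (hpos L)
    nlinarith [mul_le_mul_of_nonneg_right (hSanti K L h h') h0.le,
      mul_le_mul_of_nonneg_left (hGmono K L h h') (hS K), hpos K, hpos L]
  obtain ⟨K₀, hK₀, hK₀𝒦, hG₀⟩ := hG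
  obtain ⟨i₀, hi₀⟩ := T.exists_le K₀ hK₀𝒦
  have hTpos : ∀ i, i₀ ≤ i → 0 < G (T.field i) := fun i hi =>
    hGpos K₀ _ (hi₀.trans (T.strictMono.monotone hi)) (T.field_le i) hG₀
  -- G is eventually at least a positive multiple of the degree over k, hence unbounded; the shift
  -- by `c` is therefore invisible in the limit.
  have hGtop : Filter.Tendsto (fun i => G (T.field i)) Filter.atTop Filter.atTop := by
    have h1 : Filter.Tendsto (fun i => G K₀ / Module.finrank k K₀ *
        (Module.finrank k (T.field i) : ℝ)) Filter.atTop Filter.atTop :=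
      T.tendsto_finrank.const_mul_atTop (div_pos hG₀ (hpos K₀))
    refine Filter.tendsto_atTop_mono' _ ?_ h1
    filter_upwards [Filter.eventually_ge_atTop i₀] with i hi
    rw [div_mul_eq_mul_div, div_le_iff₀ (hpos K₀)]
    exact hGmono K₀ _ (hi₀.trans (T.strictMono.monotone hi)) (T.field_le i)
  -- From `i₀` on the quotients belong to the set, so they are at least its infimum. A quotient
  -- close to the infimum comes from a field that some step contains, and monotonicity keeps all
  -- later quotients at most as large.
  have hlim : Filter.Tendsto (fun i => S (T.field i) / G (T.field i)) Filter.atTop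
      (nhds (sInf (ratioSet S G 𝒦))) := by
    have hbdd := ratioSet_bddBelow (G := G) (𝒦 := 𝒦) hS
    rw [tendsto_order]
    constructor
    · intro a ha
      filter_upwards [Filter.eventually_ge_atTop i₀] with i hi
      exact ha.trans_le (csInf_le hbdd ⟨_, T.finite i, T.field_le i, hTpos i hi, rfl⟩)
    · intro a ha
      obtain ⟨x, ⟨K, hK, hK𝒦, hGK, rfl⟩, hx⟩ :=
        exists_lt_of_csInf_lt
        (show (ratioSet S G 𝒦).Nonempty from ⟨_, K₀, hK₀, hK₀𝒦, hG₀, rfl⟩) ha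
      obtain ⟨j, hj⟩ := T.exists_le K hK𝒦
      filter_upwards [Filter.eventually_ge_atTop j] with i hi
      exact (hle K _ (hj.trans (T.strictMono.monotone hi)) (T.field_le i) hGK).trans_lt hx
  have hquot : Filter.Tendsto (fun i => G (T.field i) / (G (T.field i) + c)) Filter.atTop
      (nhds 1) := by
    have h1 : Filter.Tendsto (fun i => 1 + c / G (T.field i)) Filter.atTop (nhds (1 + 0)) :=
      tendsto_const_nhds.add (hGtop.const_div_atTop c)
    have h2 := h1.inv₀ (by norm_num)
    rw [add_zero, inv_one] at h2
    refine h2.congr' ?_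
    filter_upwards [Filter.eventually_ge_atTop i₀] with i hi
    rw [one_add_div (hTpos i hi).ne', inv_div]
  have := hlim.mul hquot
  rw [mul_one] at this
  refine this.congr' ?_
  filter_upwards [Filter.eventually_ge_atTop i₀] with i hi
  have := (hTpos i hi).ne'
  field_simp

end Towers

/-! ### Abel summation -/

/-- Summation by parts for b − a, whose partial sums are nonnegative. The induction keeps the
boundary term, the whole partial sum times `c N`, and only at the end uses that it is nonnegative.
-/
theorem sum_mul_le_sum_mul_of_antitone {a b c : ℕ → ℝ} (hc : Antitone c) (hc0 : ∀ n, 0 ≤ c n)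
    (h : ∀ N, ∑ n ∈ Finset.range N, a n ≤ ∑ n ∈ Finset.range N, b n) (N : ℕ) :
    ∑ n ∈ Finset.range N, a n * c n ≤ ∑ n ∈ Finset.range N, b n * c n := by
  suffices H : ∀ N, (∑ n ∈ Finset.range N, (b n - a n)) * c N ≤
      ∑ n ∈ Finset.range N, (b n - a n) * c n by
    have h1 := H N
    have h2 : 0 ≤ (∑ n ∈ Finset.range N, (b n - a n)) * c N := by
      refine mul_nonneg ?_ (hc0 N)
      rw [Finset.sum_sub_distrib]
      exact sub_nonneg.2 (h N)
    have h3 := h2.trans h1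
    simp only [sub_mul, Finset.sum_sub_distrib] at h3
    linarith
  intro N
  induction N with
  | zero => simp
  | succ N ih =>
    have h1 : (∑ n ∈ Finset.range (N + 1), (b n - a n)) * c (N + 1) ≤
        (∑ n ∈ Finset.range (N + 1), (b n - a n)) * c N := by
      refine mul_le_mul_of_nonneg_left (hc (Nat.le_succ N)) ?_
      rw [Finset.sum_sub_distrib]
      exact sub_nonneg.2 (h _)
    refine h1.trans ?_
    rw [Finset.sum_range_succ, Finset.sum_range_succ, add_mul]
    exact add_le_add_left ih _

theorem tsum_ofReal_mul_le_of_antitone {a b c : ℕ → ℝ} (ha : ∀ n, 0 ≤ a n) (hb : ∀ n, 0 ≤ b n)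
    (hc : Antitone c) (hc0 : ∀ n, 0 ≤ c n)
    (h : ∀ N, ∑ n ∈ Finset.range N, a n ≤ ∑ n ∈ Finset.range N, b n) :
    ∑' n, ENNReal.ofReal (a n * c n) ≤ ∑' n, ENNReal.ofReal (b n * c n) := by
  refine ENNReal.tsum_le_of_sum_range_le fun N => ?_
  refine le_trans ?_ (ENNReal.sum_le_tsum (Finset.range N))
  rw [← ENNReal.ofReal_sum_of_nonneg fun n _ => mul_nonneg (ha n) (hc0 n),
    ← ENNReal.ofReal_sum_of_nonneg fun n _ => mul_nonneg (hb n) (hc0 n)]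
  exact ENNReal.ofReal_le_ofReal (sum_mul_le_sum_mul_of_antitone hc hc0 h N)

end InfiniteGlobalField

namespace InfiniteGlobalField

/-! ### Counting primes in extensions of Dedekind domains -/

section Counting

open IsDedekindDomain

/-- The number of nonzero primes of `B` of norm `q`. -/
noncomputable def primeCount (B : Type*) [CommRing B] (q : ℕ) : ℕ :=
  Nat.card {v : HeightOneSpectrum B // Nat.card (B ⧸ v.asIdeal) = q}

/-- The sum of the degrees, relative to `r`, of the primes of `B` of norm at most `r ^ f`. -/
noncomputable def weightedPrimeCount (B : Type*) [CommRing B] (r f : ℕ) : ℕ :=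
  ∑ m ∈ Finset.Icc 1 f, m * primeCount B (r ^ m)

/-- Only finitely many primes of `B` have a given finite norm. -/
def FinitelyManyPrimes (B : Type*) [CommRing B] : Prop :=
  ∀ q ≠ 0, {v : HeightOneSpectrum B | Nat.card (B ⧸ v.asIdeal) = q}.Finite

/-- The primes of `B` whose norm is a power of `r` with exponent between `1` and `f`. -/
def smallPrimes (B : Type*) [CommRing B] (r f : ℕ) : Set (HeightOneSpectrum B) :=
  {v | ∃ m ∈ Finset.Icc 1 f, Nat.card (B ⧸ v.asIdeal) = r ^ m}

theorem FinitelyManyPrimes.smallPrimes_finite {B : Type*} [CommRing B]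
    (hB : FinitelyManyPrimes B) {r : ℕ} (hr : 1 < r) (f : ℕ) : (smallPrimes B r f).Finite := by
  have : smallPrimes B r f =
      ⋃ m ∈ Finset.Icc 1 f, {v | Nat.card (B ⧸ v.asIdeal) = r ^ m} := by
    ext v; simp [smallPrimes]
  rw [this]
  exact Set.Finite.biUnion (Finset.finite_toSet _) fun m _ => hB _ (by positivity)

/-- Rewrites a sum over norms as a sum over primes, each weighted by its degree, so that primes can
be grouped by their contraction. Finiteness is essential since `Nat.card` of an infinite type is 0.
-/
theorem weightedPrimeCount_eq {B : Type*} [CommRing B] (hB : FinitelyManyPrimes B) {r : ℕ}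
    (hr : 1 < r) (f : ℕ) : weightedPrimeCount B r f =
      ∑ v ∈ (hB.smallPrimes_finite hr f).toFinset, Nat.log r (Nat.card (B ⧸ v.asIdeal)) := by
  classical
  rw [weightedPrimeCount, ← Finset.sum_fiberwise_of_maps_to
    (g := fun v : HeightOneSpectrum B => Nat.log r (Nat.card (B ⧸ v.asIdeal)))
    (t := Finset.Icc 1 f)]
  · refine Finset.sum_congr rfl fun m hm => ?_
    rw [Finset.sum_congr rfl (g := fun _ => m) fun v hv => (Finset.mem_filter.1 hv).2,
      Finset.sum_const, smul_eq_mul, mul_comm, primeCount]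
    congr 1
    refine Nat.subtype_card _ fun v => ?_
    rw [Finset.mem_filter, Set.Finite.mem_toFinset]
    constructor
    · rintro ⟨⟨m', hm', hv⟩, hlog⟩
      rw [hv, Nat.log_pow hr] at hlog
      rw [hv, hlog]
    · intro hv
      exact ⟨⟨m, hm, hv⟩, by rw [hv, Nat.log_pow hr]⟩
  · intro v hv
    obtain ⟨m, hm, hv⟩ := (Set.Finite.mem_toFinset _).1 hv
    rw [hv, Nat.log_pow hr]
    exact hm

variable {B C : Type*} [CommRing B] [CommRing C] [IsDedekindDomain B] [IsDedekindDomain C]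
  [Algebra B C] [Module.Finite B C] [Module.IsTorsionFree B C]

theorem card_quotient_under_pow (w : HeightOneSpectrum C) :
    Nat.card (B ⧸ (w.under B).asIdeal) ^ w.asIdeal.inertiaDeg B = Nat.card (C ⧸ w.asIdeal) := by
  have := w.isMaximal
  have := (w.under B).isMaximal
  have : w.asIdeal.LiesOver (w.under B).asIdeal := ⟨rfl⟩
  exact Ideal.cardQuot_pow_inertiaDeg (w.under B).asIdeal w.asIdeal

theorem inertiaDeg_pos (w : HeightOneSpectrum C) : 0 < w.asIdeal.inertiaDeg B :=
  have := w.isPrime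
  Ideal.inertiaDeg_pos _ _

theorem finite_setOf_under_eq (v : HeightOneSpectrum B) :
    {w : HeightOneSpectrum C | w.under B = v}.Finite := by
  have := v.isMaximal
  refine Set.Finite.of_finite_image (f := HeightOneSpectrum.asIdeal) ?_
    fun _ _ _ _ h => HeightOneSpectrum.ext h
  refine (IsDedekindDomain.primesOver_finite v.asIdeal C).subset ?_
  rintro _ ⟨w, rfl, rfl⟩
  exact ⟨w.isPrime, ⟨rfl⟩⟩

/-- Follows from ∑ e·f = [C:B], because every ramification index is at least 1. -/
theorem sum_inertiaDeg_le (v : HeightOneSpectrum B) (s : Finset (HeightOneSpectrum C))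
    (hs : ∀ w ∈ s, w.under B = v) :
    ∑ w ∈ s, w.asIdeal.inertiaDeg B ≤ Module.finrank B C := by
  classical
  have := v.isMaximal
  have hflat : Module.Flat B C := inferInstance
  rw [← Ideal.sum_ramification_inertia_eq_finrank v.asIdeal C,
    ← Finset.sum_attach]
  let g : {w // w ∈ s} → v.asIdeal.primesOver C := fun w =>
    ⟨w.1.asIdeal, w.1.isPrime, ⟨by rw [← hs w.1 w.2]; rfl⟩⟩
  have hg : Function.Injective g := fun w w' h =>
    Subtype.ext (HeightOneSpectrum.ext (congrArg Subtype.val h))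
  calc ∑ w ∈ s.attach, w.1.asIdeal.inertiaDeg B
      = ∑ q ∈ s.attach.map ⟨g, hg⟩, q.1.inertiaDeg B := by rw [Finset.sum_map]; rfl
    _ ≤ ∑ q : v.asIdeal.primesOver C, q.1.inertiaDeg B :=
        Finset.sum_le_sum_of_subset (Finset.subset_univ _)
    _ ≤ _ := Finset.sum_le_sum fun q _ =>
        Nat.le_mul_of_pos_left _ (Ideal.ramificationIdx_pos _ _)

-- A prime of norm q lies over a prime of norm between 1 and q, and each prime of B has finitely
-- many primes above it.
variable (C) in
theorem FinitelyManyPrimes.of_finite (hB : FinitelyManyPrimes B) : FinitelyManyPrimes C := by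
  intro q hq
  have hfin : (⋃ q' ∈ Finset.Icc 1 q, {v : HeightOneSpectrum B | Nat.card (B ⧸ v.asIdeal) = q'}).Finite :=
    Set.Finite.biUnion (Finset.finite_toSet _) fun m hm =>
      hB _ (Nat.one_le_iff_ne_zero.1 (Finset.mem_Icc.1 hm).1)
  refine (hfin.biUnion fun v _ => finite_setOf_under_eq (C := C) v).subset ?_
  intro w hw
  rw [Set.mem_ofPred] at hw
  have h := card_quotient_under_pow (B := B) w
  rw [hw] at h
  have h0 : Nat.card (B ⧸ (w.under B).asIdeal) ≠ 0 := fun h0 => by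
    rw [h0, zero_pow (inertiaDeg_pos w).ne'] at h
    exact hq h.symm
  refine Set.mem_biUnion (x := w.under B) (Set.mem_biUnion (x := Nat.card (B ⧸ (w.under B).asIdeal)) ?_ rfl) rfl
  refine Finset.mem_coe.2 (Finset.mem_Icc.2 ⟨Nat.one_le_iff_ne_zero.2 h0, ?_⟩)
  rw [← h]
  exact Nat.le_self_pow (inertiaDeg_pos w).ne' _

-- Grouping by the contraction v, the degree of w is deg v times its inertia degree, and the inertia
-- degrees above v sum to at most [C:B]. Since deg v ≤ deg w, the bound f on degrees is inherited by
-- v. `hpow` says that the norm of v is again a power of r, so that deg v makes sense.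
variable (B C) in
theorem weightedPrimeCount_le (hB : FinitelyManyPrimes B) {r : ℕ} (hr : 1 < r)
    (hpow : ∀ (v : HeightOneSpectrum B) (j m : ℕ), j ≠ 0 →
      Nat.card (B ⧸ v.asIdeal) ^ j = r ^ m → ∃ m', Nat.card (B ⧸ v.asIdeal) = r ^ m') (f : ℕ) :
    weightedPrimeCount C r f ≤ weightedPrimeCount B r f * Module.finrank B C := by
  classical
  rw [weightedPrimeCount_eq hB hr, weightedPrimeCount_eq (hB.of_finite C) hr, Finset.sum_mul]
  have hdeg : ∀ w ∈ smallPrimes C r f, w.under B ∈ smallPrimes B r f ∧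
      Nat.log r (Nat.card (C ⧸ w.asIdeal)) =
        Nat.log r (Nat.card (B ⧸ (w.under B).asIdeal)) * w.asIdeal.inertiaDeg B := by
    rintro w ⟨m, hm, hw⟩
    have h := card_quotient_under_pow (B := B) w
    have hpos := inertiaDeg_pos (B := B) w
    obtain ⟨m', hm'⟩ := hpow _ _ m hpos.ne' (h.trans hw)
    rw [← h, hm', ← pow_mul, Nat.log_pow hr, Nat.log_pow hr]
    rw [hw, hm', ← pow_mul] at h
    have hmm := Nat.pow_right_injective hr h
    rw [Finset.mem_Icc] at hm
    refine ⟨⟨m', Finset.mem_Icc.2 ⟨Nat.pos_of_ne_zero ?_, ?_⟩, hm'⟩, rfl⟩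
    -- Exponent 0 for v would force exponent 0 for w, which `Icc 1 f` excludes.
    · rintro rfl
      simp at hmm
      omega
    · exact (Nat.le_mul_of_pos_right _ hpos).trans (hmm.le.trans hm.2)
  rw [← Finset.sum_fiberwise_of_maps_to (g := fun w : HeightOneSpectrum C => w.under B)
    (t := (hB.smallPrimes_finite hr f).toFinset)]
  · refine Finset.sum_le_sum fun v _ => ?_
    calc _ = ∑ w ∈ ((hB.of_finite C).smallPrimes_finite hr f).toFinset with w.under B = v,
          Nat.log r (Nat.card (B ⧸ v.asIdeal)) * w.asIdeal.inertiaDeg B := by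
          refine Finset.sum_congr rfl fun w hw => ?_
          rw [Finset.mem_filter, Set.Finite.mem_toFinset] at hw
          rw [(hdeg w hw.1).2, hw.2]
      _ ≤ _ := by
          rw [← Finset.mul_sum]
          exact Nat.mul_le_mul_left _ (sum_inertiaDeg_le v _ fun w hw => (Finset.mem_filter.1 hw).2)
  · intro w hw
    rw [Set.Finite.mem_toFinset] at hw ⊢
    exact (hdeg w hw).1

end Counting
end InfiniteGlobalField

namespace InfiniteGlobalField

/-! ### Number fields -/

namespace NF

/-! ### Genus, primes and infinite places in an extension of number fields. -/

section Extension

open NumberField Module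

variable (K L : Type*) [Field K] [Field L] [NumberField K] [NumberField L] [Algebra K L]

theorem genus_nonneg : 0 ≤ genus K := by
  refine div_nonneg (Real.log_nonneg ?_) zero_le_two
  have := Int.one_le_abs (discr_ne_zero K)
  exact_mod_cast this

theorem genus_pos (h : 1 < finrank ℚ K) : 0 < genus K := by
  refine div_pos (Real.log_pos ?_) zero_lt_two
  have := abs_discr_gt_two h
  have h2 : (2 : ℝ) < |(discr K : ℝ)| := by exact_mod_cast this
  linarith

/-- |D_L| is |D_K|^[L:K] times the norm of the relative different; take logarithms. -/
theorem genus_mul_finrank_le : genus K * finrank K L ≤ genus L := by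
  have h := natAbs_discr_eq_absNorm_differentIdeal_mul_natAbs_discr_pow K (𝓞 K) L (𝓞 L)
  have hdvd : (discr K).natAbs ^ finrank K L ≤ (discr L).natAbs :=
    Nat.le_of_dvd (Int.natAbs_pos.2 (discr_ne_zero L)) (h ▸ dvd_mul_left _ _)
  have hle : |(discr K : ℝ)| ^ finrank K L ≤ |(discr L : ℝ)| := by
    rw [← Int.cast_abs, ← Int.cast_abs, ← Int.natCast_natAbs, ← Int.natCast_natAbs]
    exact_mod_cast hdvd
  have hpos : 0 < |(discr K : ℝ)| := abs_pos.2 (by exact_mod_cast discr_ne_zero K)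
  have := Real.log_le_log (pow_pos hpos _) hle
  rw [Real.log_pow] at this
  rw [genus, genus]
  linarith

theorem finitelyManyPrimes : FinitelyManyPrimes (𝓞 K) := by
  intro q hq
  refine Set.Finite.of_finite_image (f := IsDedekindDomain.HeightOneSpectrum.asIdeal) ?_
    fun _ _ _ _ h => IsDedekindDomain.HeightOneSpectrum.ext h
  refine (Ideal.finite_setOfPred_absNorm_eq (S := 𝓞 K) q).subset ?_
  rintro _ ⟨w, hw, rfl⟩
  exact hw

theorem weightedPrimeCount_le {p : ℕ} (hp : p.Prime) (f : ℕ) :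
    weightedPrimeCount (𝓞 L) p f ≤ weightedPrimeCount (𝓞 K) p f * finrank K L := by
  rw [IsFractionRing.finrank_eq (𝓞 K) K (𝓞 L) L]
  refine InfiniteGlobalField.weightedPrimeCount_le (𝓞 K) (𝓞 L) (finitelyManyPrimes K) hp.one_lt
    (fun v j m hj h => ?_) f
  obtain ⟨m', -, h⟩ := (Nat.dvd_prime_pow hp).1 ((dvd_pow_self _ hj).trans h.dvd)
  exact ⟨m', h⟩

/-- Embed K in ℂ by v. Every place of L over v comes from a K-embedding L → ℂ, and there are [L:K]
of these. -/
theorem card_infinitePlace_le :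
    Fintype.card (InfinitePlace L) ≤ Fintype.card (InfinitePlace K) * finrank K L := by
  classical
  rw [← Finset.card_univ, ← Finset.card_univ, mul_comm]
  refine Finset.card_le_mul_card_image_of_maps_to (f := fun w : InfinitePlace L =>
    w.comap (algebraMap K L)) (fun _ _ => Finset.mem_univ _) _ fun v _ => ?_
  let : Algebra K ℂ := v.embedding.toAlgebra
  have hex : ∀ w : InfinitePlace L, w.comap (algebraMap K L) = v →
      ∃ φ : L →ₐ[K] ℂ, InfinitePlace.mk φ.toRingHom = w := by
    intro w hw
    have h1 : InfinitePlace.mk (w.embedding.comp (algebraMap K L)) = InfinitePlace.mk v.embedding := by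
      rw [InfinitePlace.mk_embedding, ← hw, ← InfinitePlace.comap_mk, InfinitePlace.mk_embedding]
    rcases InfinitePlace.mk_eq_iff.1 h1 with h | h
    · exact ⟨{ w.embedding with commutes' := fun x => RingHom.congr_fun h x },
        InfinitePlace.mk_embedding w⟩
    -- The embedding of w may restrict to the conjugate of that of v. Its own conjugate then
    -- restricts correctly and defines the same place.
    · refine ⟨{ ComplexEmbedding.conjugate w.embedding with
        commutes' := fun x => RingHom.congr_fun h x }, ?_⟩
      exact (InfinitePlace.mk_conjugate_eq _).trans (InfinitePlace.mk_embedding w)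
  choose φ hφ using hex
  have hcard : Fintype.card (L →ₐ[K] ℂ) = finrank K L := AlgHom.card K L ℂ
  rw [← hcard, ← Fintype.card_coe]
  refine Fintype.card_le_of_injective (fun w => φ w.1 (Finset.mem_filter.1 w.2).2) fun w w' h => ?_
  refine Subtype.ext ?_
  rw [← hφ w.1 (Finset.mem_filter.1 w.2).2, ← hφ w'.1 (Finset.mem_filter.1 w'.2).2]
  exact congrArg (fun ψ : L →ₐ[K] ℂ => InfinitePlace.mk ψ.toRingHom) h

end Extension

/-! ### Limits and deficiencies of infinite number fields. -/

section Limits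

open Module

variable {Ω : Type*} [Field Ω] [CharZero Ω]

/-- The genus of a finite subextension. -/
noncomputable def fieldGenus (K : IntermediateField ℚ Ω) [FiniteDimensional ℚ K] : ℝ :=
  haveI := numberField K
  genus K

/-- The weighted number of primes above `p` of norm at most `p ^ f` of a finite subextension. -/
noncomputable def fieldPrimes (p f : ℕ) (K : IntermediateField ℚ Ω) [FiniteDimensional ℚ K] : ℝ :=
  weightedPrimeCount (𝓞 K) p f

/-- The number of infinite places of a finite subextension. -/
noncomputable def fieldPlaces (K : IntermediateField ℚ Ω) [FiniteDimensional ℚ K] : ℝ :=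
  haveI := numberField K
  Fintype.card (NumberField.InfinitePlace K)

/-- The degree of a finite subextension. -/
noncomputable def fieldDegree (K : IntermediateField ℚ Ω) [FiniteDimensional ℚ K] : ℝ :=
  finrank ℚ K

theorem exists_fieldGenus_pos {𝒦 : IntermediateField ℚ Ω} (hT : Nonempty (Tower 𝒦)) :
    ∃ (K : IntermediateField ℚ Ω) (_ : FiniteDimensional ℚ K), K ≤ 𝒦 ∧ 0 < fieldGenus K := by
  obtain ⟨T⟩ := hT
  have := (T.tendsto_finrank.eventually_gt_atTop 1).exists
  obtain ⟨i, hi⟩ := this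
  have := numberField (T.field i)
  exact ⟨T.field i, T.finite i, T.field_le i, genus_pos _ (by exact_mod_cast hi)⟩

theorem IsInfinite.nonempty_tower {𝒦 : IntermediateField ℚ Ω} (h : IsInfinite 𝒦) :
    Nonempty (Tower 𝒦) :=
  by
  refine @exists_tower ℚ Ω _ _ _ _ 𝒦 ?_ fun hfin => h.infinite ?_
  · convert h.algebraic
    · rfl
    · exact Subsingleton.elim _ _
  · convert hfin

/-- A quantity growing at most as fast as the degree has a limit relative to the genus. -/
theorem hasTowerLimit_div_genus {𝒦 : IntermediateField ℚ Ω} (h : IsInfinite 𝒦)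
    {S : (K : IntermediateField ℚ Ω) → [FiniteDimensional ℚ K] → ℝ}
    (hS : ∀ (K : IntermediateField ℚ Ω) [FiniteDimensional ℚ K], 0 ≤ S K)
    (hSL : ∀ (K L : IntermediateField ℚ Ω) [FiniteDimensional ℚ K] [FiniteDimensional ℚ L]
      [Algebra K L] [IsScalarTower ℚ K L], S L ≤ S K * finrank K L) :
    HasTowerLimit 𝒦 (fun K _ => S K / fieldGenus K) (sInf (ratioSet S fieldGenus 𝒦)) := by
  have := hasTowerLimit_div (S := S) (G := fieldGenus) (𝒦 := 𝒦) 0 hS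
    (exists_fieldGenus_pos h.nonempty_tower) (fun K L _ _ _ _ _ => hSL K L) ?_
  · simpa only [add_zero] using this
  · intro K L _ _ _ _ _
    have := numberField K
    have := numberField L
    exact genus_mul_finrank_le K L

theorem hasTowerLimit_fieldPrimes {𝒦 : IntermediateField ℚ Ω} (h : IsInfinite 𝒦) {p : ℕ}
    (hp : p.Prime) (f : ℕ) : HasTowerLimit 𝒦 (fun K _ => fieldPrimes p f K / fieldGenus K)
      (sInf (ratioSet (fieldPrimes p f) fieldGenus 𝒦)) := by
  refine hasTowerLimit_div_genus h (fun K _ => Nat.cast_nonneg _) fun K L _ _ _ _ => ?_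
  have := numberField K
  have := numberField L
  rw [fieldPrimes, fieldPrimes]
  exact_mod_cast weightedPrimeCount_le K L hp f

theorem hasTowerLimit_fieldPlaces {𝒦 : IntermediateField ℚ Ω} (h : IsInfinite 𝒦) :
    HasTowerLimit 𝒦 (fun K _ => fieldPlaces K / fieldGenus K)
      (sInf (ratioSet fieldPlaces fieldGenus 𝒦)) := by
  refine hasTowerLimit_div_genus h (fun K _ => Nat.cast_nonneg _) fun K L _ _ _ _ => ?_
  have := numberField K
  have := numberField L
  unfold fieldPlaces
  exact_mod_cast card_infinitePlace_le K L

theorem hasTowerLimit_fieldDegree {𝒦 : IntermediateField ℚ Ω} (h : IsInfinite 𝒦) :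
    HasTowerLimit 𝒦 (fun K _ => fieldDegree K / fieldGenus K)
      (sInf (ratioSet fieldDegree fieldGenus 𝒦)) := by
  refine hasTowerLimit_div_genus h (fun K _ => Nat.cast_nonneg _) fun K L _ _ _ _ => ?_
  rw [fieldDegree, ← finrank_mul_finrank ℚ K L, Nat.cast_mul]
  exact le_rfl

/-- Two successive weighted counts, both of which have limits, differ by (m + 1)·Φ_{p^(m+1)}. -/
theorem hasTowerLimit_ratio {𝒦 : IntermediateField ℚ Ω} (h : IsInfinite 𝒦) {p : ℕ}
    (hp : p.Prime) (m : ℕ) : HasTowerLimit 𝒦 (ratio (p ^ (m + 1)))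
      ((sInf (ratioSet (fieldPrimes p (m + 1)) fieldGenus 𝒦) -
        sInf (ratioSet (fieldPrimes p m) fieldGenus 𝒦)) / (m + 1 : ℝ)) := by
  intro T
  refine (((hasTowerLimit_fieldPrimes h hp (m + 1) T).sub
    (hasTowerLimit_fieldPrimes h hp m T)).div_const (m + 1 : ℝ)).congr fun i => ?_
  have h1 : fieldPrimes p (m + 1) (T.field i) = fieldPrimes p m (T.field i) +
      (m + 1 : ℝ) * numPlaces (T.field i) (p ^ (m + 1)) := by
    rw [fieldPrimes, fieldPrimes, weightedPrimeCount, Finset.sum_Icc_succ_top (by omega),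
      Nat.cast_add, Nat.cast_mul, Nat.cast_add_one]
    rfl
  have h2 : (m + 1 : ℝ) ≠ 0 := by positivity
  beta_reduce
  rw [h1, ← sub_div, add_sub_cancel_left, mul_div_assoc, mul_div_cancel_left₀ _ h2]
  rfl

/-- r₁ = 2(r₁ + r₂) − (r₁ + 2r₂), where r₁ + r₂ counts the infinite places and r₁ + 2r₂ is the
degree. -/
theorem hasTowerLimit_realRatio {𝒦 : IntermediateField ℚ Ω} (h : IsInfinite 𝒦) :
    HasTowerLimit 𝒦 realRatio (2 * sInf (ratioSet fieldPlaces fieldGenus 𝒦) -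
      sInf (ratioSet fieldDegree fieldGenus 𝒦)) := by
  intro T
  refine (((hasTowerLimit_fieldPlaces h T).const_mul 2).sub
    (hasTowerLimit_fieldDegree h T)).congr fun i => ?_
  have := numberField (T.field i)
  have h1 := NumberField.InfinitePlace.card_add_two_mul_card_eq_rank (T.field i)
  have h2 := NumberField.InfinitePlace.card_eq_nrRealPlaces_add_nrComplexPlaces (T.field i)
  unfold fieldPlaces fieldDegree realRatio
  beta_reduce
  rw [← h1, h2, ← mul_div_assoc, ← sub_div]
  push_cast
  unfold fieldGenus
  ring

theorem hasTowerLimit_complexRatio {𝒦 : IntermediateField ℚ Ω} (h : IsInfinite 𝒦) :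
    HasTowerLimit 𝒦 complexRatio (sInf (ratioSet fieldDegree fieldGenus 𝒦) -
      sInf (ratioSet fieldPlaces fieldGenus 𝒦)) := by
  intro T
  refine ((hasTowerLimit_fieldDegree h T).sub (hasTowerLimit_fieldPlaces h T)).congr fun i => ?_
  have := numberField (T.field i)
  have h1 := NumberField.InfinitePlace.card_add_two_mul_card_eq_rank (T.field i)
  have h2 := NumberField.InfinitePlace.card_eq_nrRealPlaces_add_nrComplexPlaces (T.field i)
  unfold fieldPlaces fieldDegree complexRatio
  beta_reduce
  rw [← h1, h2, ← sub_div]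
  push_cast
  unfold fieldGenus
  ring

theorem invariants_wellDefined {𝒦 : IntermediateField ℚ Ω} (h : IsInfinite 𝒦) :
    (∀ q : ℕ, IsPrimePow q → ∃! x, HasTowerLimit 𝒦 (ratio q) x) ∧
      (∃! x, HasTowerLimit 𝒦 realRatio x) ∧ (∃! x, HasTowerLimit 𝒦 complexRatio x) := by
  refine ⟨fun q hq => ?_, (hasTowerLimit_realRatio h).existsUnique h.nonempty_tower,
    (hasTowerLimit_complexRatio h).existsUnique h.nonempty_tower⟩
  obtain ⟨p, m, hp, hm, rfl⟩ := (isPrimePow_nat_iff q).1 hq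
  obtain ⟨m, rfl⟩ := Nat.exists_eq_succ_of_ne_zero hm.ne'
  exact (hasTowerLimit_ratio h hp m).existsUnique h.nonempty_tower

theorem phi_nonneg {𝒦 : IntermediateField ℚ Ω} (h : IsInfinite 𝒦) {p : ℕ}
    (hp : p.Prime) (m : ℕ) : 0 ≤ phi (p ^ (m + 1)) 𝒦 := by
  obtain ⟨T⟩ := h.nonempty_tower
  have := hasTowerLimit_ratio h hp m
  rw [phi, this.towerLimit_eq ⟨T⟩]
  refine ge_of_tendsto' (this T) fun i => ?_
  have := numberField (T.field i)
  exact div_nonneg (Nat.cast_nonneg _) (genus_nonneg _)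

/-- The limits are differences of consecutive infima, so the sum telescopes. The infimum at 0
vanishes because the weighted count is then an empty sum. -/
theorem sum_phi {𝒦 : IntermediateField ℚ Ω} (h : IsInfinite 𝒦) {p : ℕ} (hp : p.Prime) (N : ℕ) :
    ∑ m ∈ Finset.range N, (m + 1 : ℝ) * phi (p ^ (m + 1)) 𝒦 =
      sInf (ratioSet (fieldPrimes p N) fieldGenus 𝒦) -
        sInf (ratioSet (fieldPrimes p 0) fieldGenus 𝒦) := by
  rw [← Finset.sum_range_sub (fun m => sInf (ratioSet (fieldPrimes p m) fieldGenus 𝒦))]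
  refine Finset.sum_congr rfl fun m _ => ?_
  have h2 : (m + 1 : ℝ) ≠ 0 := by positivity
  rw [phi, (hasTowerLimit_ratio h hp m).towerLimit_eq h.nonempty_tower, mul_div_cancel₀ _ h2]

theorem sInf_ratioSet_fieldPrimes_zero {𝒦 : IntermediateField ℚ Ω} (h : IsInfinite 𝒦) (p : ℕ) :
    sInf (ratioSet (fieldPrimes p 0) fieldGenus 𝒦) = 0 := by
  obtain ⟨K, hK, hK𝒦, hG⟩ := exists_fieldGenus_pos h.nonempty_tower
  have : ratioSet (fieldPrimes p 0) fieldGenus 𝒦 = {0} := by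
    ext x
    constructor
    · rintro ⟨K, hK, -, -, rfl⟩
      simp [fieldPrimes, weightedPrimeCount]
    · rintro rfl
      exact ⟨K, hK, hK𝒦, hG, by simp [fieldPrimes, weightedPrimeCount]⟩
  rw [this, csInf_singleton]

theorem sum_phi_le {𝒦 ℒ : IntermediateField ℚ Ω} (h : IsInfinite 𝒦) (h' : IsInfinite ℒ)
    (hle : 𝒦 ≤ ℒ) {p : ℕ} (hp : p.Prime) (N : ℕ) :
    ∑ m ∈ Finset.range N, (m + 1 : ℝ) * phi (p ^ (m + 1)) ℒ ≤
      ∑ m ∈ Finset.range N, (m + 1 : ℝ) * phi (p ^ (m + 1)) 𝒦 := by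
  rw [sum_phi h hp, sum_phi h' hp, sInf_ratioSet_fieldPrimes_zero h,
    sInf_ratioSet_fieldPrimes_zero h', sub_zero, sub_zero]
  exact sInf_ratioSet_anti hle (fun K _ => Nat.cast_nonneg _)
    (exists_fieldGenus_pos h.nonempty_tower)

/-- Series over the prime powers with weights decreasing along the powers of each prime are
decreasing with respect to inclusion of fields. -/
theorem tsum_phi_anti {𝒦 ℒ : IntermediateField ℚ Ω} (h : IsInfinite 𝒦) (h' : IsInfinite ℒ)
    (hle : 𝒦 ≤ ℒ) {w : ℕ → ℝ} (hw : ∀ p m : ℕ, p.Prime → 0 < w (p ^ (m + 1)))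
    (hmono : ∀ p : ℕ, p.Prime → Monotone fun m => w (p ^ (m + 1))) :
    ∑' q : {q : ℕ // IsPrimePow q}, ENNReal.ofReal (phi q ℒ * Real.log (q : ℕ) / w q) ≤
      ∑' q : {q : ℕ // IsPrimePow q}, ENNReal.ofReal (phi q 𝒦 * Real.log (q : ℕ) / w q) := by
  have key : ∀ ℳ : IntermediateField ℚ Ω,
      ∑' q : {q : ℕ // IsPrimePow q}, ENNReal.ofReal (phi q ℳ * Real.log (q : ℕ) / w q) =
        ∑' (p : Nat.Primes) (m : ℕ), ENNReal.ofReal ((m + 1 : ℝ) * phi ((p : ℕ) ^ (m + 1)) ℳ *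
          (Real.log (p : ℕ) / w ((p : ℕ) ^ (m + 1)))) := by
    intro ℳ
    -- Prime powers are indexed by pairs (p, m) with q = p^(m+1). The identity log q = (m + 1)·log p
    -- supplies exactly the factor m + 1 occurring in `sum_phi_le`.
    rw [← Nat.Primes.prodNatEquiv.tsum_eq, ENNReal.tsum_prod']
    refine tsum_congr fun p => tsum_congr fun m => ?_
    rw [Nat.Primes.coe_prodNatEquiv_apply, Nat.cast_pow, Real.log_pow]
    congr 1
    push_cast
    ring
  rw [key, key]
  refine ENNReal.tsum_le_tsum fun p => ?_
  have hlog : 0 ≤ Real.log (p : ℕ) := Real.log_natCast_nonneg _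
  refine tsum_ofReal_mul_le_of_antitone
    (fun m => mul_nonneg (by positivity) (phi_nonneg h' p.2 m))
    (fun m => mul_nonneg (by positivity) (phi_nonneg h p.2 m)) ?_
    (fun m => div_nonneg hlog (hw p m p.2).le) (fun N => sum_phi_le h h' hle p.2 N)
  intro m n hmn
  exact div_le_div_of_nonneg_left hlog (hw p m p.2) (hmono p p.2 hmn)

/-- A combination `a Φ_ℝ + b Φ_ℂ` with `a ≤ b ≤ 2 a` is decreasing with respect to inclusion. -/
theorem phiReal_phiComplex_anti {𝒦 ℒ : IntermediateField ℚ Ω} (h : IsInfinite 𝒦)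
    (h' : IsInfinite ℒ) (hle : 𝒦 ≤ ℒ) {a b : ℝ} (hab : a ≤ b) (hba : b ≤ 2 * a) :
    a * phiReal ℒ + b * phiComplex ℒ ≤ a * phiReal 𝒦 + b * phiComplex 𝒦 := by
  have hG := exists_fieldGenus_pos h.nonempty_tower
  have h1 := sInf_ratioSet_anti (S := fieldPlaces) hle (fun K _ => Nat.cast_nonneg _) hG
  have h2 := sInf_ratioSet_anti (S := fieldDegree) hle (fun K _ => Nat.cast_nonneg _) hG
  unfold phiReal phiComplex
  rw [(hasTowerLimit_realRatio h).towerLimit_eq h.nonempty_tower,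
    (hasTowerLimit_realRatio h').towerLimit_eq h'.nonempty_tower,
    (hasTowerLimit_complexRatio h).towerLimit_eq h.nonempty_tower,
    (hasTowerLimit_complexRatio h').towerLimit_eq h'.nonempty_tower]
  -- a·r₁ + b·r₂ = (2a − b)(r₁ + r₂) + (b − a)(r₁ + 2r₂), with nonnegative coefficients.
  nlinarith [mul_le_mul_of_nonneg_left h1 (sub_nonneg.2 hba),
    mul_le_mul_of_nonneg_left h2 (sub_nonneg.2 hab)]

theorem deficiency₁_monotoneOn :
    MonotoneOn (deficiency₁ (Ω := Ω)) {𝒦 | IsInfinite 𝒦} := by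
  intro 𝒦 h ℒ h' hle
  refine EReal.sub_le_sub (EReal.sub_le_sub le_rfl (EReal.coe_ennreal_le_coe_ennreal_iff.2 ?_))
    (EReal.coe_le_coe_iff.2 ?_)
  · refine tsum_phi_anti (w := fun q => √(q : ℕ) - 1) h h' hle (fun p m hp => ?_) fun p hp m n hmn => ?_
    · rw [sub_pos, Real.lt_sqrt zero_le_one, one_pow]
      exact_mod_cast Nat.one_lt_pow (Nat.succ_ne_zero m) hp.one_lt
    · refine sub_le_sub_right (Real.sqrt_le_sqrt ?_) _
      exact_mod_cast Nat.pow_le_pow_right hp.pos (Nat.succ_le_succ hmn)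
  · have hπ := Real.pi_pos
    have hsq : Real.log √(8 * Real.pi) = Real.log (8 * Real.pi) / 2 := Real.log_sqrt (by positivity)
    have hγ := Real.one_half_lt_eulerMascheroniConstant
    -- Here 2a − b = π/2. The condition a ≤ b reads π/4 ≤ (log 8π + γ)/2 and follows from e² ≤ 8π, γ
    -- > 1/2 and π < 4.
    have hlog : 2 ≤ Real.log (8 * Real.pi) := by
      rw [Real.le_log_iff_exp_le (by positivity), show (2 : ℝ) = 1 + 1 by norm_num, Real.exp_add]
      nlinarith [Real.exp_one_lt_d9, Real.exp_pos 1, Real.pi_gt_three]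
    refine phiReal_phiComplex_anti h h' hle ?_ ?_ <;> rw [hsq] <;>
      linarith [Real.pi_lt_four]

theorem deficiency₂_monotoneOn :
    MonotoneOn (deficiency₂ (Ω := Ω)) {𝒦 | IsInfinite 𝒦} := by
  intro 𝒦 h ℒ h' hle
  refine EReal.sub_le_sub (EReal.sub_le_sub le_rfl (EReal.coe_ennreal_le_coe_ennreal_iff.2 ?_))
    (EReal.coe_le_coe_iff.2 ?_)
  · refine tsum_phi_anti (w := fun q => (q : ℝ) - 1) h h' hle (fun p m hp => ?_) fun p hp m n hmn => ?_
    · rw [sub_pos]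
      exact_mod_cast Nat.one_lt_pow (Nat.succ_ne_zero m) hp.one_lt
    · refine sub_le_sub_right ?_ _
      exact_mod_cast Nat.pow_le_pow_right hp.pos (Nat.succ_le_succ hmn)
  · have hπ := Real.pi_pos
    have hγ := Real.one_half_lt_eulerMascheroniConstant
    have hlog : 0 ≤ Real.log Real.pi := Real.log_nonneg (by linarith [Real.pi_gt_three])
    have h2 : 0 ≤ Real.log 2 := Real.log_nonneg one_le_two
    have e1 : Real.log (2 * √Real.pi) = Real.log 2 + Real.log Real.pi / 2 := by
      rw [Real.log_mul two_ne_zero (by positivity), Real.log_sqrt hπ.le]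
    have e2 : Real.log (2 * Real.pi) = Real.log 2 + Real.log Real.pi :=
      Real.log_mul two_ne_zero hπ.ne'
    -- Here b − a = (log π + γ)/2 and 2a − b = log 2.
    refine phiReal_phiComplex_anti h h' hle ?_ ?_ <;> rw [e1, e2] <;> linarith

end Limits

end NF

end InfiniteGlobalField

namespace InfiniteGlobalField

/-! ### Places of function fields and Dedekind domains -/

namespace FF

open IsDedekindDomain

section Dedekind

/-- A normalized discrete valuation that is integral on a Dedekind domain comes from a prime. -/
theorem exists_eq_valuation {R K : Type*} [CommRing R] [IsDedekindDomain R] [Field K] [Algebra R K]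
    [IsFractionRing R K] (w : Valuation K ℤᵐ⁰) (hw : Function.Surjective w)
    (h : ∀ r : R, w (algebraMap R K r) ≤ 1) : ∃ v : HeightOneSpectrum R, w = v.valuation K := by
  -- The centre of w on R, which will be the prime sought.
  let I : Ideal R :=
    { carrier := {r | w (algebraMap R K r) < 1}
      zero_mem' := by simp
      add_mem' := fun {a b} ha hb => by
        rw [Set.mem_ofPred, map_add]
        exact w.map_add_lt ha hb
      smul_mem' := fun c a ha => by
        rw [Set.mem_ofPred, smul_eq_mul, map_mul, map_mul]
        exact mul_comm (w (algebraMap R K a)) _ ▸ mul_lt_one_of_lt_of_le ha (h c) }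
  have hI : ∀ r, r ∈ I ↔ w (algebraMap R K r) < 1 := fun r => Iff.rfl
  have hprime : I.IsPrime := by
    refine ⟨fun htop => ?_, fun {a b} hab => ?_⟩
    · have : (1 : R) ∈ I := htop ▸ Submodule.mem_top
      simp [hI] at this
    · by_contra! hcon
      rw [hI, hI, not_lt, not_lt] at hcon
      rw [hI, map_mul, map_mul, (h a).antisymm hcon.1, (h b).antisymm hcon.2, one_mul] at hab
      exact hab.false
  -- With centre 0 the valuation would be trivial on the nonzero elements of R, hence on those of K,
  -- against surjectivity.
  have hbot : I ≠ ⊥ := by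
    intro hbot
    have h1 : ∀ r : R, r ≠ 0 → w (algebraMap R K r) = 1 := fun r hr => by
      refine (h r).antisymm (not_lt.1 fun hlt => hr ?_)
      have : r ∈ I := hlt
      rwa [hbot, Ideal.mem_bot] at this
    obtain ⟨x, hx⟩ := hw (WithZero.exp (-1))
    obtain ⟨a, b, hb, rfl⟩ := IsFractionRing.div_surjective (A := R) x
    have hb' := h1 b (nonZeroDivisors.ne_zero hb)
    rcases eq_or_ne a 0 with rfl | ha
    · rw [map_zero, zero_div, map_zero] at hx
      exact WithZero.exp_ne_zero hx.symm
    · rw [map_div₀, h1 a ha, hb', div_one, ← WithZero.exp_zero, WithZero.exp_inj] at hx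
      omega
  let v : HeightOneSpectrum R := ⟨I, hprime, hbot⟩
  have hs : ∀ s ∈ v.asIdeal.primeCompl, w (algebraMap R K s) = 1 := fun s hs =>
    (h s).antisymm (not_lt.1 hs)
  have hle : ∀ x, v.valuation K x ≤ 1 → w x ≤ 1 := by
    intro x hx
    obtain ⟨n, d, hnd⟩ := v.exists_primeCompl_mul_eq_of_integer x hx
    have := congrArg w hnd
    rw [map_mul, hs d d.2, mul_one] at this
    rw [this]
    exact h n
  have hlt : ∀ x, v.valuation K x < 1 → w x < 1 := by
    intro x hx
    obtain ⟨n, d, hnd⟩ := v.exists_primeCompl_mul_eq_of_integer x hx.le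
    have hn : v.valuation K (algebraMap R K n) < 1 := by
      rw [← hnd, map_mul]
      exact mul_lt_one_of_lt_of_le hx (v.valuation_le_one _)
    rw [HeightOneSpectrum.valuation_lt_one_iff_mem] at hn
    have := congrArg w hnd
    rw [map_mul, hs d d.2, mul_one] at this
    rw [this]
    exact hn
  have heq : ∀ x, v.valuation K x = 1 → w x = 1 := by
    intro x hx
    refine (hle x hx.le).antisymm ?_
    have := hle x⁻¹ (by rw [map_inv₀, hx, inv_one])
    rw [map_inv₀] at this
    exact (inv_le_one₀ (zero_lt_iff.2 ((Valuation.ne_zero_iff _).2 fun h0 => by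
      simp [h0] at hx))).1 this
  obtain ⟨ϖ, hϖ⟩ := v.valuation_exists_uniformizer K
  have hϖ0 : ϖ ≠ 0 := fun h0 => by
    rw [h0, map_zero] at hϖ
    exact WithZero.exp_ne_zero hϖ.symm
  -- Multiplying x by a suitable power of ϖ gives a unit for v, hence a unit for w; so w is
  -- determined by v and by w(ϖ).
  have hform : ∀ x ≠ 0, w x = w ϖ ^ (-(v.valuation K x).log) := by
    intro x hx
    have hvx : v.valuation K x ≠ 0 := (Valuation.ne_zero_iff _).2 hx
    have : w (x * ϖ ^ (v.valuation K x).log) = 1 := by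
      apply heq
      rw [map_mul, map_zpow₀, hϖ, ← WithZero.exp_zsmul, ← WithZero.exp_log hvx,
        ← WithZero.exp_add, WithZero.log_exp, ← WithZero.exp_zero, WithZero.exp_inj]
      simp
    rw [map_mul, map_zpow₀] at this
    rw [zpow_neg]
    exact eq_inv_of_mul_eq_one_left this
  -- Surjectivity of w forces the exponent of w(ϖ) to divide 1, and w(ϖ) < 1 fixes its sign.
  have hwϖ : w ϖ = WithZero.exp (-1) := by
    have h0 : w ϖ ≠ 0 := (Valuation.ne_zero_iff _).2 hϖ0
    have h1 : w ϖ < 1 := hlt ϖ (by rw [hϖ, ← WithZero.exp_zero, WithZero.exp_lt_exp]; norm_num)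
    rw [← WithZero.exp_log h0, ← WithZero.exp_zero, WithZero.exp_lt_exp] at h1
    obtain ⟨x, hx⟩ := hw (WithZero.exp (-1))
    have hx0 : x ≠ 0 := fun h0 => by
      rw [h0, map_zero] at hx
      exact WithZero.exp_ne_zero hx.symm
    rw [hform x hx0, ← WithZero.exp_log h0, ← WithZero.exp_zsmul, WithZero.exp_inj] at hx
    rw [← WithZero.exp_log h0, WithZero.exp_inj]
    have : (w ϖ).log ∣ 1 := ⟨(v.valuation K x).log, by
      rw [smul_eq_mul] at hx; linarith⟩
    rcases Int.isUnit_iff.1 (isUnit_of_dvd_one this) with h2 | h2 <;> omega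
  refine ⟨v, Valuation.ext fun x => ?_⟩
  rcases eq_or_ne x 0 with rfl | hx
  · simp
  · have hvx : v.valuation K x ≠ 0 := (Valuation.ne_zero_iff _).2 hx
    rw [hform x hx, hwϖ, ← WithZero.exp_zsmul, ← WithZero.exp_log hvx, WithZero.log_exp]
    simp

theorem valuation_injective {R : Type*} (K : Type*) [CommRing R] [IsDedekindDomain R] [Field K]
    [Algebra R K] [IsFractionRing R K] :
    Function.Injective fun v : HeightOneSpectrum R => v.valuation K := fun v w h => by
  refine HeightOneSpectrum.ext (Ideal.ext fun r => ?_)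
  rw [← HeightOneSpectrum.valuation_lt_one_iff_mem (K := K),
    ← HeightOneSpectrum.valuation_lt_one_iff_mem (K := K)]
  exact iff_of_eq (congrArg (fun u : Valuation K ℤᵐ⁰ => u (algebraMap R K r) < 1) h)

variable {F K : Type*} [Field F] [Field K] [Algebra F K]

theorem Place.ext {P Q : Place F K} (h : P.val = Q.val) : P = Q := by
  cases P; cases Q; cases h; rfl

variable {B : Type*} [CommRing B] [IsDedekindDomain B] [Algebra B K] [IsFractionRing B K]
  [Algebra F B] [IsScalarTower F B K]

/-- The place attached to a prime of a Dedekind domain with fraction field `K`. -/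
noncomputable def Place.ofPrime (F K : Type*) [Field F] [Field K] [Algebra F K]
    {B : Type*} [CommRing B] [IsDedekindDomain B] [Algebra B K] [IsFractionRing B K]
    [Algebra F B] [IsScalarTower F B K] (v : HeightOneSpectrum B) : Place F K where
  val := v.valuation K
  surjective := v.valuation_surjective K
  trivialOn := ⟨fun a ha => by
    rw [IsScalarTower.algebraMap_apply F B K, HeightOneSpectrum.valuation_eq_one_iff_notMem]
    intro hmem
    exact v.isPrime.ne_top (Ideal.eq_top_of_isUnit_mem _ hmem
      ((IsUnit.mk0 a ha).map (algebraMap F B)))⟩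

theorem Place.ofPrime_injective : Function.Injective (Place.ofPrime F K (B := B)) :=
  fun _ _ h => valuation_injective K (congrArg Place.val h)

theorem Place.exists_eq_ofPrime (P : Place F K) (h : ∀ b : B, P.val (algebraMap B K b) ≤ 1) :
    ∃ v : HeightOneSpectrum B, P = Place.ofPrime F K v := by
  obtain ⟨v, hv⟩ := exists_eq_valuation P.val P.surjective h
  exact ⟨v, Place.ext hv⟩

theorem Place.ofPrime_le_one (v : HeightOneSpectrum B) (b : B) :
    (Place.ofPrime F K v).val (algebraMap B K b) ≤ 1 := v.valuation_le_one b

/-- The residue field of the place attached to a prime. -/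
theorem Place.nonempty_residueField_equiv (v : HeightOneSpectrum B) :
    Nonempty ((B ⧸ v.asIdeal) ≃ₐ[F] (Place.ofPrime F K v).residueField) := by
  let P := Place.ofPrime F K v
  let φ : B →ₐ[F] P.residueField :=
    { (IsLocalRing.residue P.val.valuationSubring).comp
        ((algebraMap B K).codRestrict P.val.valuationSubring.toSubring
          (fun b => v.valuation_le_one b)) with
      commutes' := fun c => by
        change IsLocalRing.residue _ _ = IsLocalRing.residue _ _
        congr 1
        refine Subtype.ext ?_
        exact (IsScalarTower.algebraMap_apply F B K c).symm }
  have hmem : ∀ x : P.val.valuationSubring, IsLocalRing.residue _ x = 0 ↔ P.val (x : K) < 1 := by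
    intro x
    rw [IsLocalRing.residue_eq_zero_iff]
    exact Valuation.mem_maximalIdeal_iff ..
  have hker : RingHom.ker φ = v.asIdeal := by
    ext b
    rw [RingHom.mem_ker, ← HeightOneSpectrum.valuation_lt_one_iff_mem (K := K)]
    exact hmem _
  have hsurj : Function.Surjective φ := by
    intro y
    obtain ⟨⟨x, hx⟩, rfl⟩ := IsLocalRing.residue_surjective y
    obtain ⟨n, d, hnd⟩ := v.exists_primeCompl_mul_eq_of_integer x hx
    -- e inverts the denominator d modulo the prime, so n·e represents the residue class of x = n/d.
    obtain ⟨e, he⟩ : ∃ e, (d : B) * e - 1 ∈ v.asIdeal := by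
      have := v.isMaximal
      obtain ⟨e, he⟩ := Ideal.Quotient.exists_inv (I := v.asIdeal)
        (a := Ideal.Quotient.mk _ (d : B)) (by
          rw [Ne, Ideal.Quotient.eq_zero_iff_mem]; exact d.2)
      obtain ⟨e, rfl⟩ := Ideal.Quotient.mk_surjective e
      exact ⟨e, by rw [← map_mul, ← map_one (Ideal.Quotient.mk v.asIdeal),
        Ideal.Quotient.mk_eq_mk_iff_sub_mem] at he; exact he⟩
    refine ⟨n * e, ?_⟩
    rw [← sub_eq_zero]
    change IsLocalRing.residue _ _ - IsLocalRing.residue _ _ = 0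
    rw [← map_sub, hmem]
    change v.valuation K (algebraMap B K (n * e) - x) < 1
    have : algebraMap B K (n * e) - x = x * algebraMap B K (d * e - 1) := by
      rw [map_mul, ← hnd, map_sub, map_mul, map_one]; ring
    rw [this, map_mul, mul_comm]
    exact mul_lt_one_of_lt_of_le ((HeightOneSpectrum.valuation_lt_one_iff_mem v _).2 he) hx
  exact ⟨(Ideal.quotientEquivAlgOfEq F hker.symm).trans
    (Ideal.quotientKerAlgEquivOfSurjective hsurj)⟩

theorem Place.norm_ofPrime (v : HeightOneSpectrum B) :
    (Place.ofPrime F K v).norm = Nat.card (B ⧸ v.asIdeal) := by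
  obtain ⟨e⟩ := Place.nonempty_residueField_equiv (F := F) (K := K) v
  exact (Nat.card_congr e.toEquiv).symm

theorem Place.degree_ofPrime (v : HeightOneSpectrum B) :
    (Place.ofPrime F K v).degree = Module.finrank F (B ⧸ v.asIdeal) := by
  obtain ⟨e⟩ := Place.nonempty_residueField_equiv (F := F) (K := K) v
  exact e.toLinearEquiv.finrank_eq.symm

variable {A : Type*} [CommRing A] [IsDedekindDomain A] [Algebra A B] [Module.Finite A B]
  [Module.IsTorsionFree A B] [Algebra F A] [IsScalarTower F A B]

theorem finrank_quotient_eq_mul (w : HeightOneSpectrum B) :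
    Module.finrank F (B ⧸ w.asIdeal) =
      Module.finrank F (A ⧸ (w.under A).asIdeal) * w.asIdeal.inertiaDeg A := by
  have := w.isMaximal
  have := (w.under A).isMaximal
  have : w.asIdeal.LiesOver (w.under A).asIdeal := ⟨rfl⟩
  let := Ideal.Quotient.field (w.under A).asIdeal
  let := Ideal.Quotient.field w.asIdeal
  rw [Ideal.inertiaDeg_eq_of_isMaximal (w.under A).asIdeal w.asIdeal]
  have : IsScalarTower F (A ⧸ (w.under A).asIdeal) (B ⧸ w.asIdeal) :=
    IsScalarTower.of_algebraMap_eq fun x => by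
      change Ideal.Quotient.mk _ (algebraMap F B x) =
        Ideal.Quotient.mk _ (algebraMap A B (algebraMap F A x))
      rw [← IsScalarTower.algebraMap_apply F A B]
  exact (Module.finrank_mul_finrank F (A ⧸ (w.under A).asIdeal) (B ⧸ w.asIdeal)).symm

theorem finite_quotient_of_under (w : HeightOneSpectrum B)
    (h : Module.Finite F (A ⧸ (w.under A).asIdeal)) : Module.Finite F (B ⧸ w.asIdeal) := by
  have : w.asIdeal.LiesOver (w.under A).asIdeal := ⟨rfl⟩
  have : IsScalarTower F (A ⧸ (w.under A).asIdeal) (B ⧸ w.asIdeal) :=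
    IsScalarTower.of_algebraMap_eq fun x => by
      change Ideal.Quotient.mk _ (algebraMap F B x) =
        Ideal.Quotient.mk _ (algebraMap A B (algebraMap F A x))
      rw [← IsScalarTower.algebraMap_apply F A B]
  exact Module.Finite.trans (A ⧸ (w.under A).asIdeal) (B ⧸ w.asIdeal)

variable (F K B) in
/-- The divisor of the zeros, at the places over `A`, of a prime element `ϖ` of `A`. -/
theorem exists_zeroDivisor {ϖ : A} (hϖ : Prime ϖ) : ∃ D : Place F K →₀ ℤ,
    (∀ P : Place F K, (∀ b : B, P.val (algebraMap B K b) ≤ 1) →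
      D P = -(P.val (algebraMap B K (algebraMap A B ϖ))).log) ∧
    (∀ P : Place F K, ¬ (∀ b : B, P.val (algebraMap B K b) ≤ 1) → D P = 0) ∧
    divisorDegree D = Module.finrank A B * Module.finrank F (A ⧸ Ideal.span {ϖ}) := by
  classical
  let p := Ideal.span {ϖ}
  have hp0 : p ≠ ⊥ := by simpa [p] using hϖ.ne_zero
  have hpp : p.IsPrime := (Ideal.span_singleton_prime hϖ.ne_zero).2 hϖ
  have hpm : p.IsMaximal := hpp.isMaximal hp0
  let toPrime : p.primesOver B → HeightOneSpectrum B := fun Q =>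
    ⟨Q.1, Q.2.1, Ideal.ne_bot_of_mem_primesOver hp0 Q.2⟩
  have hunder : ∀ Q, ((toPrime Q).under A).asIdeal = p := fun Q => Q.2.2.over.symm
  let f : p.primesOver B ↪ Place F K := ⟨fun Q => Place.ofPrime F K (toPrime Q), fun Q Q' h =>
    Subtype.ext (congrArg HeightOneSpectrum.asIdeal (Place.ofPrime_injective h))⟩
  have hinj : Function.Injective (algebraMap A B) := FaithfulSMul.algebraMap_injective A B
  have hϖB : algebraMap A B ϖ ≠ 0 := (map_ne_zero_iff _ hinj).2 hϖ.ne_zero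
  have hmap : p.map (algebraMap A B) = Ideal.span {algebraMap A B ϖ} := by
    rw [Ideal.map_span, Set.image_singleton]
  have hmap0 : p.map (algebraMap A B) ≠ ⊥ := by
    rw [hmap, Ne, Ideal.span_singleton_eq_bot]; exact hϖB
  have hram : ∀ Q : p.primesOver B, ((f Q).val (algebraMap B K (algebraMap A B ϖ))).log =
      -(Q.1.ramificationIdx A : ℤ) := by
    intro Q
    change ((toPrime Q).valuation K _).log = _
    rw [HeightOneSpectrum.valuation_of_algebraMap,
      HeightOneSpectrum.intValuation_eq_exp_neg_multiplicity _ hϖB, WithZero.log_exp,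
      Ideal.IsDedekindDomain.ramificationIdx_eq_multiplicity p Q.1 hmap0, hmap]
  -- The divisor ∑ e(Q)·Q over the primes Q above ϖ; its degree will come from ∑ e·f = rank.
  let D : Place F K →₀ ℤ := Finsupp.embDomain f
    (Finsupp.equivFunOnFinite.symm fun Q => (Q.1.ramificationIdx A : ℤ))
  refine ⟨D, fun P hP => ?_, fun P hP => ?_, ?_⟩
  · by_cases hr : P ∈ Set.range f
    · obtain ⟨Q, rfl⟩ := hr
      rw [Finsupp.embDomain_apply_self, hram, neg_neg]
      rfl
    · rw [Finsupp.embDomain_of_notMem_range _ _ _ hr]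
      obtain ⟨v, rfl⟩ := P.exists_eq_ofPrime hP
      have hv : algebraMap A B ϖ ∉ v.asIdeal := fun hmem => hr ⟨⟨v.asIdeal, v.isPrime, ⟨?_⟩⟩, rfl⟩
      · change 0 = -((v.valuation K _).log)
        rw [v.valuation_eq_one_iff_notMem.2 hv, WithZero.log_one, neg_zero]
      · refine hpm.eq_of_le (v.under A).isPrime.ne_top ?_
        rw [Ideal.span_singleton_le_iff_mem]
        exact hmem
  · refine Finsupp.embDomain_of_notMem_range _ _ _ ?_
    rintro ⟨Q, rfl⟩
    exact hP fun b => Place.ofPrime_le_one _ b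
  · rw [divisorDegree, Finsupp.sum_embDomain, Finsupp.sum_fintype _ _ (by simp),
      ← Ideal.sum_ramification_inertia_eq_finrank p B, Nat.cast_sum, Finset.sum_mul]
    refine Finset.sum_congr rfl fun Q _ => ?_
    change (Q.1.ramificationIdx A : ℤ) * ((Place.ofPrime F K (toPrime Q)).degree : ℤ) = _
    rw [Place.degree_ofPrime, finrank_quotient_eq_mul (A := A), hunder Q]
    push_cast
    ring

end Dedekind

end FF

end InfiniteGlobalField

namespace InfiniteGlobalField

namespace FF

/-! ### Riemann–Roch spaces -/

section RiemannRoch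

variable {F K : Type*} [Field F] [Field K] [Algebra F K]

theorem mem_riemannRochSpace {D : Place F K →₀ ℤ} {f : K} :
    f ∈ riemannRochSpace D ↔ ∀ P : Place F K, P.val f ≤ WithZero.exp (D P) := Iff.rfl

theorem divisorDegree_add (D E : Place F K →₀ ℤ) :
    divisorDegree (D + E) = divisorDegree D + divisorDegree E :=
  Finsupp.sum_add_index' (by simp) (by intros; ring)

theorem divisorDegree_zero : divisorDegree (0 : Place F K →₀ ℤ) = 0 := Finsupp.sum_zero_index

theorem divisorDegree_nsmul (n : ℕ) (D : Place F K →₀ ℤ) :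
    divisorDegree (n • D) = n * divisorDegree D := by
  induction n with
  | zero => simp [divisorDegree_zero]
  | succ n ih => rw [succ_nsmul, divisorDegree_add, ih]; push_cast; ring

theorem divisorDegree_single (P : Place F K) (n : ℤ) :
    divisorDegree (Finsupp.single P n) = n * P.degree := Finsupp.sum_single_index (by simp)

theorem riemannRochSpace_mono {D E : Place F K →₀ ℤ} (h : D ≤ E) :
    riemannRochSpace D ≤ riemannRochSpace E := fun _ hf P =>
  (hf P).trans (WithZero.exp_le_exp.2 (h P))

theorem finite_riemannRochSpace_of_le {D E : Place F K →₀ ℤ} (h : D ≤ E)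
    [Module.Finite F (riemannRochSpace E)] : Module.Finite F (riemannRochSpace D) :=
  Module.Finite.of_injective _ (Submodule.inclusion_injective (riemannRochSpace_mono h))

/-- Take u of order D(P) + 1 at P. Multiplying by u and reducing modulo P maps L(D + P) to the
residue field, with kernel inside L(D). -/
theorem finrank_riemannRochSpace_add_single (D : Place F K →₀ ℤ) (P : Place F K)
    [Module.Finite F P.residueField]
    [Module.Finite F (riemannRochSpace (D + Finsupp.single P 1))] :
    Module.finrank F (riemannRochSpace (D + Finsupp.single P 1)) ≤
      Module.finrank F (riemannRochSpace D) + P.degree := by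
  classical
  have hle : D ≤ D + Finsupp.single P 1 :=
    le_add_of_nonneg_right (Finsupp.single_nonneg.2 zero_le_one)
  have : Module.Finite F (riemannRochSpace D) := finite_riemannRochSpace_of_le hle
  obtain ⟨u, hu⟩ := P.surjective (WithZero.exp (-(D P + 1)))
  have hinteg : ∀ f : riemannRochSpace (D + Finsupp.single P 1), P.val ((f : K) * u) ≤ 1 := by
    intro f
    have := f.2 P
    rw [Finsupp.add_apply, Finsupp.single_eq_same] at this
    rw [map_mul, hu, WithZero.exp_neg]
    exact mul_inv_le_one_of_le₀ this zero_le
  let φ : riemannRochSpace (D + Finsupp.single P 1) →ₗ[F] P.residueField :=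
    { toFun := fun f => IsLocalRing.residue P.val.valuationSubring ⟨(f : K) * u, hinteg f⟩
      map_add' := fun f g => by
        rw [← map_add]
        congr 1
        exact Subtype.ext (add_mul _ _ _)
      map_smul' := fun c f => by
        rw [RingHom.id_apply, Algebra.smul_def]
        change _ = IsLocalRing.residue _ _ * IsLocalRing.residue _ _
        rw [← map_mul]
        congr 1
        refine Subtype.ext ?_
        change (c • (f : K)) * u = algebraMap F K c * (f * u)
        rw [Algebra.smul_def, mul_assoc] }
  have hker : ∀ f, f ∈ LinearMap.ker φ → (f : K) ∈ riemannRochSpace D := by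
    intro f hf Q
    by_cases hQ : Q = P
    · subst hQ
      have h1 : Q.val ((f : K) * u) < 1 :=
        (Valuation.mem_maximalIdeal_iff ..).1 ((IsLocalRing.residue_eq_zero_iff _).1 hf)
      rw [map_mul, hu] at h1
      rcases eq_or_ne (f : K) 0 with h0 | h0
      · rw [h0, map_zero]; exact zero_le
      · have h2 : Q.val (f : K) ≠ 0 := (Valuation.ne_zero_iff _).2 h0
        rw [← WithZero.exp_log h2, ← WithZero.exp_add, ← WithZero.exp_zero,
          WithZero.exp_lt_exp] at h1
        rw [← WithZero.exp_log h2, WithZero.exp_le_exp]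
        omega
    · have := f.2 Q
      rwa [Finsupp.add_apply, Finsupp.single_eq_of_ne hQ, add_zero] at this
  have h1 := LinearMap.finrank_range_add_finrank_ker φ
  have h2 : Module.finrank F (LinearMap.range φ) ≤ P.degree := Submodule.finrank_le _
  let ψ : LinearMap.ker φ →ₗ[F] riemannRochSpace D :=
    ((Submodule.subtype _).comp (LinearMap.ker φ).subtype).codRestrict _ fun f => hker f.1 f.2
  have h3 : Module.finrank F (LinearMap.ker φ) ≤ Module.finrank F (riemannRochSpace D) :=
    LinearMap.finrank_le_finrank_of_injective (f := ψ) fun f g h =>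
      Subtype.ext (Subtype.ext (congrArg (fun x : riemannRochSpace D => (x : K)) h))
  omega

/-- Effective divisors are written with natural coefficients so that induction on finitely supported
functions stays among them and adds one place at a time. -/
theorem finrank_riemannRochSpace_add_le (hfin : ∀ P : Place F K, Module.Finite F P.residueField)
    (E : Place F K →₀ ℕ) : ∀ D : Place F K →₀ ℤ,
      Module.Finite F (riemannRochSpace (D + E.mapRange (Nat.cast : ℕ → ℤ) Nat.cast_zero)) →
      (Module.finrank F
        (riemannRochSpace (D + E.mapRange (Nat.cast : ℕ → ℤ) Nat.cast_zero)) : ℤ) ≤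
      Module.finrank F (riemannRochSpace D) +
        divisorDegree (E.mapRange (Nat.cast : ℕ → ℤ) Nat.cast_zero) := by
  classical
  have hstep : ∀ (E₁ E₂ : Place F K →₀ ℤ), 0 ≤ E₂ →
      (∀ D : Place F K →₀ ℤ, Module.Finite F (riemannRochSpace (D + E₁)) →
        (Module.finrank F (riemannRochSpace (D + E₁)) : ℤ) ≤
          Module.finrank F (riemannRochSpace D) + divisorDegree E₁) →
      (∀ D : Place F K →₀ ℤ, Module.Finite F (riemannRochSpace (D + E₂)) →
        (Module.finrank F (riemannRochSpace (D + E₂)) : ℤ) ≤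
          Module.finrank F (riemannRochSpace D) + divisorDegree E₂) →
      ∀ D : Place F K →₀ ℤ, Module.Finite F (riemannRochSpace (D + (E₁ + E₂))) →
        (Module.finrank F (riemannRochSpace (D + (E₁ + E₂))) : ℤ) ≤
          Module.finrank F (riemannRochSpace D) + divisorDegree (E₁ + E₂) := by
    intro E₁ E₂ hE₂ h₁ h₂ D hD
    rw [← add_assoc] at hD ⊢
    have h₃ := h₂ (D + E₁) hD
    have h₄ := h₁ D (finite_riemannRochSpace_of_le (le_add_of_nonneg_right hE₂))
    rw [divisorDegree_add]
    linarith
  have hnonneg : ∀ E : Place F K →₀ ℕ, 0 ≤ E.mapRange (Nat.cast : ℕ → ℤ) Nat.cast_zero :=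
    fun E P => by simp
  induction E using Finsupp.induction_linear with
  | zero =>
    intro D _
    rw [Finsupp.mapRange_zero, add_zero, divisorDegree_zero, add_zero]
  | add E₁ E₂ h₁ h₂ =>
    intro D hD
    rw [Finsupp.mapRange_add Nat.cast_add] at hD ⊢
    exact hstep _ _ (hnonneg _) h₁ h₂ D hD
  | single P n =>
    rw [Finsupp.mapRange_single]
    induction n with
    | zero =>
      intro D _
      rw [Nat.cast_zero, Finsupp.single_zero, add_zero, divisorDegree_zero, add_zero]
    | succ n ih =>
      rw [Nat.cast_succ, Finsupp.single_add]
      refine hstep _ _ (Finsupp.single_nonneg.2 zero_le_one) ih fun D hD => ?_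
      have := hfin P
      rw [divisorDegree_single, one_mul]
      exact_mod_cast finrank_riemannRochSpace_add_single D P

/-- Enlarging a divisor enlarges its Riemann–Roch space at most by the difference of degrees. -/
theorem degree_sub_finrank_mono (hfin : ∀ P : Place F K, Module.Finite F P.residueField)
    {D D' : Place F K →₀ ℤ} (h : D ≤ D') [Module.Finite F (riemannRochSpace D')] :
    divisorDegree D - Module.finrank F (riemannRochSpace D) ≤
      divisorDegree D' - Module.finrank F (riemannRochSpace D') := by
  let E : Place F K →₀ ℕ := (D' - D).mapRange Int.toNat Int.toNat_zero
  have hE : D' = D + E.mapRange (Nat.cast : ℕ → ℤ) Nat.cast_zero := by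
    ext P
    have := h P
    simp only [E, Finsupp.add_apply, Finsupp.mapRange_apply, Finsupp.sub_apply]
    omega
  have h1 := finrank_riemannRochSpace_add_le hfin E D (hE ▸ inferInstance)
  rw [← hE] at h1
  have h2 := divisorDegree_add D (E.mapRange (Nat.cast : ℕ → ℤ) Nat.cast_zero)
  rw [← hE] at h2
  linarith

/-- The Riemann–Roch spaces of linearly equivalent divisors are isomorphic. -/
theorem nonempty_riemannRochSpace_equiv {D D' : Place F K →₀ ℤ} {g : K} (hg : g ≠ 0)
    (h : ∀ P : Place F K, D' P = D P - (P.val g).log) :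
    Nonempty (riemannRochSpace D' ≃ₗ[F] riemannRochSpace D) := by
  have hmem : ∀ f : K, f ∈ riemannRochSpace D' ↔ g * f ∈ riemannRochSpace D := by
    intro f
    refine forall_congr' fun P => ?_
    have h0 : P.val g ≠ 0 := (Valuation.ne_zero_iff _).2 hg
    rw [h, map_mul, sub_eq_add_neg, WithZero.exp_add, WithZero.exp_neg, WithZero.exp_log h0,
      mul_comm (P.val g), ← div_eq_mul_inv, le_div_iff₀ (zero_lt_iff.2 h0)]
  exact ⟨
    { toFun := fun f => ⟨g * f, (hmem f).1 f.2⟩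
      map_add' := fun f f' => Subtype.ext (mul_add g (f : K) f')
      map_smul' := fun a f => Subtype.ext (mul_smul_comm a g (f : K))
      invFun := fun f => ⟨g⁻¹ * f, (hmem _).2 (by rw [mul_inv_cancel_left₀ hg]; exact f.2)⟩
      left_inv := fun f => Subtype.ext (inv_mul_cancel_left₀ hg (f : K))
      right_inv := fun f => Subtype.ext (mul_inv_cancel_left₀ hg (f : K)) }⟩

/-- A bound for `deg D - dim L(D)` on the multiples of a divisor holds for all divisors
if every place is in the support of an effective divisor that is linearly equivalent to such a
multiple. -/
theorem degree_sub_finrank_le (hfin : ∀ P : Place F K, Module.Finite F P.residueField)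
    (D₀ : Place F K →₀ ℤ) (c : ℤ)
    (hD₀ : ∀ N : ℕ, Module.Finite F (riemannRochSpace (N • D₀)) ∧
      divisorDegree (N • D₀) - Module.finrank F (riemannRochSpace (N • D₀)) ≤ c)
    (hcov : ∀ P : Place F K, ∃ D' : Place F K →₀ ℤ, 0 ≤ D' ∧ 1 ≤ D' P ∧ ∃ g : K, g ≠ 0 ∧
      ∃ N : ℕ, (∀ Q : Place F K, D' Q = (N • D₀) Q - (Q.val g).log) ∧
        divisorDegree D' = divisorDegree (N • D₀)) (D : Place F K →₀ ℤ) :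
    divisorDegree D - Module.finrank F (riemannRochSpace D) ≤ c := by
  classical
  -- The equality of degrees is part of the condition, which avoids showing that every principal
  -- divisor has degree 0.
  let Good : (Place F K →₀ ℤ) → Prop := fun D' => 0 ≤ D' ∧ ∃ g : K, g ≠ 0 ∧
      ∃ N : ℕ, (∀ Q : Place F K, D' Q = (N • D₀) Q - (Q.val g).log) ∧
        divisorDegree D' = divisorDegree (N • D₀)
  have hzero : Good 0 := ⟨le_rfl, 1, one_ne_zero, 0, by simp, by simp⟩
  have hadd : ∀ D₁ D₂, Good D₁ → Good D₂ → Good (D₁ + D₂) := by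
    rintro D₁ D₂ ⟨h₁, g₁, hg₁, N₁, he₁, hd₁⟩ ⟨h₂, g₂, hg₂, N₂, he₂, hd₂⟩
    refine ⟨add_nonneg h₁ h₂, g₁ * g₂, mul_ne_zero hg₁ hg₂, N₁ + N₂, fun Q => ?_, ?_⟩
    · rw [Finsupp.add_apply, he₁, he₂, add_nsmul, Finsupp.add_apply, map_mul,
        WithZero.log_mul ((Valuation.ne_zero_iff _).2 hg₁) ((Valuation.ne_zero_iff _).2 hg₂)]
      ring
    · rw [divisorDegree_add, hd₁, hd₂, add_nsmul, divisorDegree_add]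
  -- Every divisor lies below a good one. Since good divisors are closed under sums, multiples of a
  -- single place are enough, and these are bounded by multiples of the divisor from `hcov`.
  have hex : ∀ D : Place F K →₀ ℤ, ∃ D', Good D' ∧ D ≤ D' := by
    intro D
    induction D using Finsupp.induction_linear with
    | zero => exact ⟨0, hzero, le_rfl⟩
    | add D₁ D₂ h₁ h₂ =>
      obtain ⟨D₁', g₁, h₁⟩ := h₁
      obtain ⟨D₂', g₂, h₂⟩ := h₂
      exact ⟨D₁' + D₂', hadd _ _ g₁ g₂, add_le_add h₁ h₂⟩
    | single P n =>
      obtain ⟨D', hD', h1, hg⟩ := hcov P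
      have hgood : ∀ m : ℕ, Good (m • D') := by
        intro m
        induction m with
        | zero => simpa using hzero
        | succ m ih => rw [succ_nsmul]; exact hadd _ _ ih ⟨hD', hg⟩
      refine ⟨n.toNat • D', hgood _, fun Q => ?_⟩
      by_cases hQ : Q = P
      · subst hQ
        rw [Finsupp.single_eq_same, Finsupp.smul_apply, nsmul_eq_mul]
        have := Int.self_le_toNat n
        nlinarith [Int.natCast_nonneg n.toNat]
      · rw [Finsupp.single_eq_of_ne hQ, Finsupp.smul_apply, nsmul_eq_mul]
        exact mul_nonneg (Int.natCast_nonneg _) (hD' Q)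
  obtain ⟨D', ⟨-, g, hg, N, he, hd⟩, hle⟩ := hex D
  obtain ⟨e⟩ := nonempty_riemannRochSpace_equiv hg he
  obtain ⟨h1, h2⟩ := hD₀ N
  have : Module.Finite F (riemannRochSpace D') := Module.Finite.equiv e.symm
  have h3 := degree_sub_finrank_mono hfin hle
  rw [e.finrank_eq, hd] at h3
  exact h3.trans h2

/-- The genus, from the Riemann–Roch spaces of the multiples of a divisor. -/
theorem genus_eq (hfin : ∀ P : Place F K, Module.Finite F P.residueField)
    (D₀ : Place F K →₀ ℤ) (c : ℤ)
    (hD₀ : ∀ N : ℕ, Module.Finite F (riemannRochSpace (N • D₀)) ∧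
      divisorDegree (N • D₀) - Module.finrank F (riemannRochSpace (N • D₀)) ≤ c)
    (hD₀' : ∃ N : ℕ, divisorDegree (N • D₀) - Module.finrank F (riemannRochSpace (N • D₀)) = c)
    (hcov : ∀ P : Place F K, ∃ D' : Place F K →₀ ℤ, 0 ≤ D' ∧ 1 ≤ D' P ∧ ∃ g : K, g ≠ 0 ∧
      ∃ N : ℕ, (∀ Q : Place F K, D' Q = (N • D₀) Q - (Q.val g).log) ∧
        divisorDegree D' = divisorDegree (N • D₀)) : genus F K = c + 1 := by
  have hle : ∀ D : Place F K →₀ ℤ,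
      divisorDegree D + 1 - Module.finrank F (riemannRochSpace D) ≤ c + 1 := fun D => by
    have := degree_sub_finrank_le hfin D₀ c hD₀ hcov D
    linarith
  refine le_antisymm (ciSup_le hle) ?_
  obtain ⟨N, hN⟩ := hD₀'
  refine le_ciSup_of_le ⟨c + 1, ?_⟩ (N • D₀) (by linarith)
  rintro _ ⟨D, rfl⟩
  exact hle D

end RiemannRoch

end FF

end InfiniteGlobalField

namespace InfiniteGlobalField

/-! ### Integral bases and discriminants in towers -/

section IntegralBasis

open Module

/-- A basis `ω` of `K` over the fraction field `k` of `A` is integral if the elements of `K`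
that are integral over `A` are those with coordinates in `A`. -/
def IsIntegralBasis (A : Type*) {k K ι : Type*} [CommRing A] [Field k] [Field K] [Algebra A k]
    [Algebra k K] [Algebra A K] (ω : Basis ι k K) : Prop :=
  ∀ x : K, IsIntegral A x ↔ ∀ i, ω.repr x i ∈ (algebraMap A k).range

variable {A k K L : Type*} [CommRing A] [Field k] [Field K] [Field L] [Algebra A k]
  [Algebra k K] [Algebra k L] [Algebra K L] [IsScalarTower k K L] [Algebra A K] [Algebra A L]
  [IsScalarTower A k K] [IsScalarTower A k L] [IsScalarTower A K L]

theorem IsIntegralBasis.isIntegral {ι : Type*} {ω : Basis ι k K} (hω : IsIntegralBasis A ω)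
    (i : ι) : IsIntegral A (ω i) := by
  classical
  refine (hω _).2 fun j => ?_
  rw [Basis.repr_self, Finsupp.single_apply]
  split_ifs
  · exact one_mem _
  · exact zero_mem _

theorem isIntegral_smul_of_mem_range {a : k} {x : K} (ha : a ∈ (algebraMap A k).range)
    (hx : IsIntegral A x) : IsIntegral A (a • x) := by
  obtain ⟨a, rfl⟩ := ha
  rw [algebraMap_smul]
  exact hx.smul a

/-- Criterion for integral bases. -/
theorem isIntegralBasis_of {ι : Type*} [Fintype ι] {ω : Basis ι k K}
    (h1 : ∀ i, IsIntegral A (ω i))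
    (h2 : ∀ x, IsIntegral A x → ∀ i, ω.repr x i ∈ (algebraMap A k).range) :
    IsIntegralBasis A ω := fun x => ⟨h2 x, fun h => by
  rw [← ω.sum_repr x]
  exact IsIntegral.sum _ fun i _ => isIntegral_smul_of_mem_range (h i) (h1 i)⟩

-- Over a principal ideal domain the integral closure is free of rank [K:k], and a basis of it over
-- A is a basis of K over k.
variable (A k K) in
theorem exists_isIntegralBasis [IsFractionRing A k] [IsDomain A] [IsPrincipalIdealRing A]
    [FiniteDimensional k K] [Algebra.IsSeparable k K] :
    ∃ ω : Basis (Fin (finrank k K)) k K, IsIntegralBasis A ω := by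
  have htf : Module.IsTorsionFree A K := .trans_faithfulSMul A k K
  have hfree : Module.Free A (integralClosure A K) :=
    IsIntegralClosure.module_free A k K (integralClosure A K)
  have hfin : Module.Finite A (integralClosure A K) :=
    IsIntegralClosure.finite A k K (integralClosure A K)
  have hloc : IsLocalization (Algebra.algebraMapSubmonoid (integralClosure A K)
      (nonZeroDivisors A)) K := IsIntegralClosure.isLocalization A k K _
  have hrank : finrank A (integralClosure A K) = finrank k K :=
    IsIntegralClosure.rank A k K (integralClosure A K)
  let b := (Module.finBasis A (integralClosure A K)).reindex (finCongr hrank)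
  let ω := b.localizationLocalization k (nonZeroDivisors A) K
  refine ⟨ω, isIntegralBasis_of (fun i => ?_) fun x hx i => ?_⟩
  · rw [Basis.localizationLocalization_apply]
    exact (b i).2
  · have := Basis.localizationLocalization_repr_algebraMap k (nonZeroDivisors A) K b ⟨x, hx⟩ i
    exact ⟨_, this.symm⟩

theorem discr_smul {ι : Type*} [Fintype ι] [DecidableEq ι] (c : ι → k) (ω : ι → K) :
    Algebra.discr k (fun i => c i • ω i) = (∏ i, c i) ^ 2 * Algebra.discr k ω := by
  have h := Algebra.discr_of_matrix_vecMul ω (Matrix.diagonal c)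
  rw [Matrix.det_diagonal] at h
  rw [← h]
  congr 1
  ext i
  simp [Matrix.vecMul, dotProduct, Matrix.diagonal_apply, Matrix.map_apply, Algebra.smul_def,
    apply_ite (algebraMap k K), mul_comm]

/-- The integral closure of a discrete valuation ring is a principal ideal domain. -/
theorem isPrincipalIdealRing_integralClosure [IsFractionRing A k] [IsDomain A]
    [IsDiscreteValuationRing A] [FiniteDimensional k K] [Algebra.IsSeparable k K] :
    IsPrincipalIdealRing (integralClosure A K) := by
  have htf : Module.IsTorsionFree A K := .trans_faithfulSMul A k K
  have : IsDedekindDomain (integralClosure A K) := integralClosure.isDedekindDomain A k K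
  -- A Dedekind domain with finitely many maximal ideals is principal; here all of them lie over the
  -- maximal ideal of A.
  refine IsPrincipalIdealRing.of_finite_maximals ?_
  refine (IsDedekindDomain.primesOver_finite (IsLocalRing.maximalIdeal A)
    (integralClosure A K)).subset fun I hI => ?_
  have hI : I.IsMaximal := hI
  refine ⟨hI.isPrime, ⟨?_⟩⟩
  have := Ideal.isMaximal_comap_of_isIntegral_of_isMaximal (R := A) I
  exact (IsLocalRing.eq_maximalIdeal this).symm

/-- The discriminant in towers: `disc(L) ∈ A · disc(K) ^ [L : K]`. -/
theorem exists_discr_eq_mul_pow [IsFractionRing A k] [IsDomain A] [IsDiscreteValuationRing A]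
    [FiniteDimensional k K] [FiniteDimensional k L] [Algebra.IsSeparable k L]
    {ι κ : Type*} [Fintype ι] [DecidableEq ι] [Fintype κ] [DecidableEq κ]
    {ω : Basis ι k K} (hω : IsIntegralBasis A ω) {l : Basis κ k L} (hl : ∀ i, IsIntegral A (l i)) :
    ∃ a : A, Algebra.discr k l = algebraMap A k a * Algebra.discr k ω ^ finrank K L := by
  have : Algebra.IsSeparable k K := Algebra.isSeparable_tower_bot_of_isSeparable k K L
  have : Algebra.IsSeparable K L := Algebra.isSeparable_tower_top_of_isSeparable k K L
  have : FiniteDimensional K L := FiniteDimensional.right k K L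
  let B := integralClosure A K
  have : IsPrincipalIdealRing B := isPrincipalIdealRing_integralClosure (k := k)
  have : IsFractionRing B K := integralClosure.isFractionRing_of_finite_extension k K
  have : IsIntegrallyClosed A := inferInstance
  -- B is principal, so L has an integral basis over B. Its products with ω give a basis b of L over
  -- k in which elements integral over A have coordinates in A.
  obtain ⟨e, he⟩ := exists_isIntegralBasis B K L
  have hB : ∀ {x : L}, IsIntegral A x → IsIntegral B x := fun h => h.tower_top
  let b := ω.smulTower e
  have hcard : Fintype.card κ = Fintype.card (ι × Fin (finrank K L)) := by
    rw [← finrank_eq_card_basis l, ← finrank_eq_card_basis b]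
  let g : κ ≃ ι × Fin (finrank K L) := Fintype.equivOfCardEq hcard
  have hb : ∀ x : L, IsIntegral A x → ∀ i, b.repr x i ∈ (algebraMap A k).range := by
    rintro x hx ⟨i, j⟩
    rw [Basis.smulTower_repr]
    refine (hω _).1 ?_ i
    obtain ⟨y, hy⟩ := (he x).1 (hB hx) j
    rw [← hy]
    exact y.2
  have hKint : ∀ x : K, IsIntegral A x → ∀ i, ∃ a, algebraMap A k a = ω.repr x i := fun x hx i =>
    (hω x).1 hx i
  have htr : ∀ j j', IsIntegral A (Algebra.trace K L (e j * e j')) := by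
    intro j j'
    have : IsIntegral B (Algebra.trace K L (e j * e j')) :=
      Algebra.isIntegral_trace ((he.isIntegral j).mul (he.isIntegral j'))
    exact isIntegral_trans _ this
  have hinteg : ∀ (i' : ι) (j j' : Fin (finrank K L)) (i : ι), ∃ a,
      algebraMap A k a = ω.repr (ω i' * Algebra.trace K L (e j * e j')) i := fun i' j j' i =>
    hKint _ ((hω.isIntegral i').mul (htr j j')) i
  choose M hM using hinteg
  let MA : Matrix (ι × Fin (finrank K L)) (ι × Fin (finrank K L)) A :=
    Matrix.of fun x y => M y.1 x.2 y.2 x.1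
  -- Trace through K and expand ω_{i'}·Tr_{L/K}(e_j e_{j'}) in ω. The trace matrix of b becomes a
  -- Kronecker product, whose determinant is disc(ω)^[L:K], times a matrix over A.
  have hfac : Algebra.traceMatrix k b =
      Matrix.kroneckerMap (· * ·) (Algebra.traceMatrix k ω)
        (1 : Matrix (Fin (finrank K L)) (Fin (finrank K L)) k) *
        MA.map (algebraMap A k) := by
    ext ⟨i, j⟩ ⟨i', j'⟩
    rw [Algebra.traceMatrix_apply, Algebra.traceForm_apply, Basis.smulTower_apply,
      Basis.smulTower_apply, ← Algebra.trace_trace (S := K)]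
    have h1 : ω i • e j * ω i' • e j' = (ω i * ω i') • (e j * e j') := by
      rw [smul_mul_smul_comm]
    rw [h1, map_smul, smul_eq_mul, mul_assoc,
      ← ω.sum_repr (ω i' * Algebra.trace K L (e j * e j')), Finset.mul_sum, map_sum,
      Matrix.mul_apply, Fintype.sum_prod_type]
    refine Finset.sum_congr rfl fun l _ => ?_
    rw [Finset.sum_eq_single j]
    · rw [Matrix.kronecker_apply, Matrix.one_apply_eq, mul_one, Matrix.map_apply,
        mul_smul_comm, map_smul, smul_eq_mul, mul_comm, ← hM]
      rfl
    · intro j'' _ hj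
      rw [Matrix.kronecker_apply, Matrix.one_apply_ne hj.symm, mul_zero, zero_mul]
    · simp
  have hdiscb : Algebra.discr k b =
      algebraMap A k MA.det * Algebra.discr k ω ^ finrank K L := by
    rw [Algebra.discr_def, hfac, Matrix.det_mul, Matrix.det_kronecker, Matrix.det_one, one_pow,
      mul_one, Fintype.card_fin, ← Algebra.discr_def, mul_comm, ← RingHom.mapMatrix_apply,
      ← RingHom.map_det]
  have hinteg' : ∀ (i j : κ), ∃ a, algebraMap A k a = b.repr (l j) (g i) := fun i j =>
    hb _ (hl j) _
  choose N hN using hinteg'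
  let NA : Matrix κ κ A := Matrix.of N
  -- The basis l has coordinates in A with respect to b, so disc(l) is disc(b) times the square of
  -- an element of A.
  have hl' : (l : κ → L) = Matrix.vecMul (b.reindex g.symm : κ → L)
      ((NA.map (algebraMap A k)).map (algebraMap k L)) := by
    ext j
    rw [← (b.reindex g.symm).sum_repr (l j)]
    simp only [Matrix.vecMul, dotProduct, Matrix.map_apply, NA, Matrix.of_apply, hN,
      Algebra.smul_def]
    refine Finset.sum_congr rfl fun i _ => ?_
    rw [mul_comm]
    simp
  refine ⟨NA.det ^ 2 * MA.det, ?_⟩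
  rw [hl', Algebra.discr_of_matrix_vecMul, Basis.coe_reindex, Equiv.symm_symm,
    ← RingHom.mapMatrix_apply, ← RingHom.map_det]
  have := Algebra.discr_reindex k b g.symm
  rw [Equiv.symm_symm] at this
  rw [this, hdiscb, map_mul, map_pow]
  ring

end IntegralBasis

end InfiniteGlobalField

namespace InfiniteGlobalField

namespace FF

open Polynomial Module

/-! ### The place at infinity of the rational function field -/

section Infinity

variable {F : Type*} [Field F]

/-- The valuation ring of a place is a discrete valuation ring. -/
theorem Place.isDiscreteValuationRing {K : Type*} [Field K] [Algebra F K] (P : Place F K) :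
    IsDiscreteValuationRing P.val.valuationSubring := by
  have : P.val.IsNontrivial := by
    obtain ⟨x, hx⟩ := P.surjective (WithZero.exp 1)
    refine ⟨x, hx ▸ WithZero.exp_ne_zero, hx ▸ ?_⟩
    rw [← WithZero.exp_zero, Ne, WithZero.exp_inj]
    exact one_ne_zero
  exact Valuation.valuationSubring_isDiscreteValuationRing P.val

variable (F) in
open Classical in
/-- The place at infinity of `F(t)`. -/
noncomputable def inftyPlace : Place F (RatFunc F) where
  val := RatFunc.inftyValuation F
  surjective := fun x => by
    rcases eq_or_ne x 0 with rfl | hx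
    · exact ⟨0, map_zero _⟩
    · exact ⟨RatFunc.X ^ x.log, by rw [RatFunc.inftyValuation.X_zpow, WithZero.exp_log hx]⟩
  trivialOn := inferInstance

variable (F) in
/-- The valuation ring of the place at infinity of `F(t)`. -/
abbrev InftyRing : Type _ := (inftyPlace F).val.valuationSubring

instance : IsDiscreteValuationRing (InftyRing F) := (inftyPlace F).isDiscreteValuationRing

theorem inftyPlace_X_zpow (m : ℤ) :
    (inftyPlace F).val (RatFunc.X ^ m) = WithZero.exp m := by
  classical exact RatFunc.inftyValuation.X_zpow F m

theorem inftyPlace_algebraMap {p : F[X]} (hp : p ≠ 0) :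
    (inftyPlace F).val (algebraMap F[X] (RatFunc F) p) = WithZero.exp (p.natDegree : ℤ) := by
  classical exact RatFunc.inftyValuation.polynomial F hp

theorem mem_range_inftyRing {x : RatFunc F} :
    x ∈ (algebraMap (InftyRing F) (RatFunc F)).range ↔ (inftyPlace F).val x ≤ 1 :=
  ⟨fun ⟨y, hy⟩ => hy ▸ y.2, fun h => ⟨⟨x, h⟩, rfl⟩⟩

/-- The residue field at infinity of `F(t)` is `F`. -/
theorem exists_inftyPlace_sub_lt_one {x : RatFunc F} (hx : (inftyPlace F).val x ≤ 1) :
    ∃ c : F, (inftyPlace F).val (x - algebraMap F (RatFunc F) c) < 1 := by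
  rcases hx.lt_or_eq with h | h
  · exact ⟨0, by rwa [map_zero, sub_zero]⟩
  have hx0 : x ≠ 0 := fun h0 => by simp [h0] at h
  have hn : x.num ≠ 0 := RatFunc.num_ne_zero hx0
  have hd : x.denom ≠ 0 := x.denom_ne_zero
  have hx' : x = algebraMap F[X] (RatFunc F) x.num / algebraMap F[X] (RatFunc F) x.denom :=
    (RatFunc.num_div_denom x).symm
  have hdeg : x.num.natDegree = x.denom.natDegree := by
    rw [hx', map_div₀, inftyPlace_algebraMap hn, inftyPlace_algebraMap hd, ← WithZero.exp_sub,
      ← WithZero.exp_zero, WithZero.exp_inj] at h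
    omega
  -- Numerator and denominator have equal degree and the denominator is monic, so subtracting this
  -- constant cancels the leading terms.
  refine ⟨x.num.leadingCoeff, ?_⟩
  have hd' : algebraMap F[X] (RatFunc F) x.denom ≠ 0 := by simpa using hd
  have heq : x - algebraMap F (RatFunc F) x.num.leadingCoeff =
      algebraMap F[X] (RatFunc F) (x.num - C x.num.leadingCoeff * x.denom) /
        algebraMap F[X] (RatFunc F) x.denom := by
    rw [map_sub, map_mul, sub_div, mul_div_cancel_right₀ _ hd', ← hx', RatFunc.algebraMap_C]
    rfl
  rw [heq, map_div₀]
  rcases eq_or_ne (x.num - C x.num.leadingCoeff * x.denom) 0 with h0 | h0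
  · rw [h0, map_zero, map_zero, zero_div]; exact zero_lt_one
  · rw [inftyPlace_algebraMap h0, inftyPlace_algebraMap hd, ← WithZero.exp_sub,
      ← WithZero.exp_zero, WithZero.exp_lt_exp, sub_neg, Nat.cast_lt]
    have hlc : x.num.leadingCoeff ≠ 0 := leadingCoeff_ne_zero.2 hn
    have : (x.num - C x.num.leadingCoeff * x.denom).degree < x.num.degree := by
      refine degree_sub_lt_left ?_ hn ?_
      · rw [degree_C_mul hlc, degree_eq_natDegree hn, degree_eq_natDegree hd, hdeg]
      · rw [leadingCoeff_mul, leadingCoeff_C, (RatFunc.monic_denom x).leadingCoeff, mul_one]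
    rw [← hdeg]
    exact natDegree_lt_natDegree h0 this

end Infinity

/-! ### Reduced bases -/

section Reduced

/-- By Cramer's rule the determinant of the updated family is the j-th coordinate of y. The new
coordinates are made explicit so that they are visibly polynomial when that coordinate is a nonzero
constant. -/
theorem exists_basis_update {k K ι : Type*} [Field k] [AddCommGroup K] [Module k K] [Fintype ι]
    [DecidableEq ι] (ω : Basis ι k K) (j : ι) (y : K) (h : ω.repr y j ≠ 0) :
    ∃ ω' : Basis ι k K, (∀ i, ω' i = Function.update ω j y i) ∧ ∀ x i,
      ω'.repr x i = if i = j then ω.repr x j / ω.repr y j else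
        ω.repr x i - ω.repr y i * (ω.repr x j / ω.repr y j) := by
  have hdet : ω.det (Function.update ω j y) = ω.repr y j := by
    rw [Basis.det_apply, Basis.toMatrix_update, Basis.toMatrix_self, ← Matrix.cramer_apply,
      Matrix.cramer_one]
    rfl
  have hb : LinearIndependent k (Function.update ω j y) ∧
      Submodule.span k (Set.range (Function.update ω j y)) = ⊤ :=
    (Module.Basis.is_basis_iff_det ω).2 (hdet ▸ h.isUnit)
  let ω' := Basis.mk hb.1 hb.2.ge
  have hω' : ∀ i, ω' i = Function.update ω j y i := fun i => Basis.mk_apply _ _ i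
  refine ⟨ω', hω', fun x i => ?_⟩
  let c : ι → k := fun i => if i = j then ω.repr x j / ω.repr y j else
        ω.repr x i - ω.repr y i * (ω.repr x j / ω.repr y j)
  have hx : x = ∑ i, c i • ω' i := by
    apply ω.repr.injective
    ext l
    rw [map_sum, Finsupp.finsetSum_apply, ← Finset.add_sum_erase _ _ (Finset.mem_univ j)]
    have h1 : ∑ i ∈ Finset.univ.erase j, (ω.repr (c i • ω' i)) l =
        ∑ i ∈ Finset.univ.erase j, if i = l then c l else 0 := by
      refine Finset.sum_congr rfl fun i hi => ?_
      rw [hω', Function.update_of_ne (Finset.ne_of_mem_erase hi), map_smul, Basis.repr_self,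
        Finsupp.smul_apply, Finsupp.single_apply, smul_eq_mul, mul_ite, mul_one, mul_zero]
      split_ifs with hil
      · rw [hil]
      · rfl
    rw [h1, Finset.sum_ite_eq', hω', Function.update_self, map_smul, Finsupp.smul_apply,
      smul_eq_mul]
    by_cases hl : l = j
    · subst hl
      simp [c, div_mul_cancel₀ _ h]
    · simp only [Finset.mem_erase, ne_eq, hl, not_false_eq_true, Finset.mem_univ, and_self,
        if_true, if_false, c]
      ring
  have := congrArg (fun z => ω'.repr z i) hx
  beta_reduce at this
  rw [this, Basis.repr_sum_self]

variable {F : Type*} [Field F] {K : Type*} [Field K] [Algebra (RatFunc F) K]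

theorem isIntegral_inftyRing_smul {a : RatFunc F} {x : K} (ha : (inftyPlace F).val a ≤ 1)
    (hx : IsIntegral (InftyRing F) x) : IsIntegral (InftyRing F) (a • x) :=
  isIntegral_smul_of_mem_range (mem_range_inftyRing.2 ha) hx

variable [Algebra F[X] K] [IsScalarTower F[X] (RatFunc F) K]

/-- A basis of `K` over `F(t)`, integral over `F[t]`, that becomes an integral basis at infinity
after division by powers of `t`. -/
structure IsReducedBasis {ι : Type*} (ω : Basis ι (RatFunc F) K) (m : ι → ℤ) : Prop where
  finite : IsIntegralBasis F[X] ω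
  infinite : ∀ x : K, IsIntegral (InftyRing F) x ↔
    ∀ i, (inftyPlace F).val (ω.repr x i) ≤ WithZero.exp (-m i)

/-- A basis of `K` over `F(t)`, integral over `F[t]`, that becomes integral at infinity
after division by powers of `t`. -/
structure IsPrereducedBasis {ι : Type*} (ω : Basis ι (RatFunc F) K) (m : ι → ℤ) : Prop where
  finite : IsIntegralBasis F[X] ω
  infinite : ∀ i, IsIntegral (InftyRing F) ((RatFunc.X : RatFunc F) ^ (-m i) • ω i)

theorem one_le_inftyPlace_of_isIntegral {x : RatFunc F} (hx : x ≠ 0) (h : IsIntegral F[X] x) :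
    1 ≤ (inftyPlace F).val x := by
  obtain ⟨p, rfl⟩ := IsIntegrallyClosed.isIntegral_iff.1 h
  have hp : p ≠ 0 := by rintro rfl; simp at hx
  rw [inftyPlace_algebraMap hp, ← WithZero.exp_zero, WithZero.exp_le_exp]
  positivity

theorem prod_X_zpow {ι : Type*} [Fintype ι] (m : ι → ℤ) :
    ∏ i, (RatFunc.X : RatFunc F) ^ (-m i) = RatFunc.X ^ (-∑ i, m i) := by
  classical
  rw [← Finset.sum_neg_distrib]
  induction (Finset.univ : Finset ι) using Finset.induction_on with
  | empty => simp
  | insert a s ha ih =>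
    rw [Finset.prod_insert ha, Finset.sum_insert ha, zpow_add₀ RatFunc.X_ne_zero, ih]

/-- disc(ω) is a nonzero polynomial, of value at least 1 at infinity, whereas t^(−2∑m)·disc(ω) is
the discriminant of a family integral at infinity and has value at most 1. This bounds the descent
in `exists_isReducedBasis`. -/
theorem IsPrereducedBasis.sum_nonneg [FiniteDimensional (RatFunc F) K]
    [Algebra.IsSeparable (RatFunc F) K] {ι : Type*} [Fintype ι]
    {ω : Basis ι (RatFunc F) K} {m : ι → ℤ} (h : IsPrereducedBasis ω m) : 0 ≤ ∑ i, m i := by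
  classical
  have h1 : IsIntegral F[X] (Algebra.discr (RatFunc F) ω) :=
    Algebra.discr_isIntegral (RatFunc F) fun i => h.finite.isIntegral i
  have h2 : IsIntegral (InftyRing F)
      (Algebra.discr (RatFunc F) fun i => (RatFunc.X : RatFunc F) ^ (-m i) • ω i) :=
    Algebra.discr_isIntegral (RatFunc F) h.infinite
  have h3 := one_le_inftyPlace_of_isIntegral (Algebra.discr_not_zero_of_basis _ ω) h1
  rw [discr_smul, prod_X_zpow] at h2
  have h4 := mem_range_inftyRing.1 (IsIntegrallyClosed.isIntegral_iff.1 h2)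
  rw [map_mul, map_pow, inftyPlace_X_zpow, ← WithZero.exp_nsmul] at h4
  have h5 := (le_mul_of_one_le_right' h3).trans h4
  rw [← WithZero.exp_zero, WithZero.exp_le_exp] at h5
  rw [nsmul_eq_mul] at h5
  push_cast at h5
  linarith

variable (F K) in
theorem exists_isPrereducedBasis [FiniteDimensional (RatFunc F) K]
    [Algebra.IsSeparable (RatFunc F) K] :
    ∃ (ω : Basis (Fin (finrank (RatFunc F) K)) (RatFunc F) K) (m : _ → ℤ),
      IsPrereducedBasis ω m := by
  obtain ⟨ω, hω⟩ := exists_isIntegralBasis F[X] (RatFunc F) K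
  have hm : ∀ i, ∃ m : ℤ, IsIntegral (InftyRing F) ((RatFunc.X : RatFunc F) ^ (-m) • ω i) := by
    intro i
    obtain ⟨y, hy, hinteg⟩ := exists_integral_multiples (InftyRing F) (RatFunc F) (L := K) {ω i}
    have hy0 : (y : RatFunc F) ≠ 0 := fun h => hy (Subtype.ext h)
    have hv : (inftyPlace F).val (y : RatFunc F) ≠ 0 := (Valuation.ne_zero_iff _).2 hy0
    refine ⟨-((inftyPlace F).val (y : RatFunc F)).log, ?_⟩
    have : (RatFunc.X : RatFunc F) ^ (- -((inftyPlace F).val (y : RatFunc F)).log) • ω i =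
        (RatFunc.X ^ ((inftyPlace F).val (y : RatFunc F)).log * (y : RatFunc F)⁻¹) • (y • ω i) := by
      rw [neg_neg, mul_smul, ← algebraMap_smul (RatFunc F) y (ω i)]
      congr 1
      exact (inv_smul_smul₀ hy0 _).symm
    rw [this]
    refine isIntegral_inftyRing_smul ?_ (hinteg _ (Finset.mem_singleton_self _))
    rw [map_mul, inftyPlace_X_zpow, map_inv₀, WithZero.exp_log hv, mul_inv_cancel₀ hv]
  choose m hm using hm
  exact ⟨ω, m, hω, hm⟩

/-- A prereduced basis that is not reduced can be improved. -/
theorem IsPrereducedBasis.exists_sum_lt {ι : Type*} [Fintype ι]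
    {ω : Basis ι (RatFunc F) K} {m : ι → ℤ} (h : IsPrereducedBasis ω m)
    (hred : ¬ IsReducedBasis ω m) :
    ∃ (ω' : Basis ι (RatFunc F) K) (m' : ι → ℤ), IsPrereducedBasis ω' m' ∧
      ∑ i, m' i < ∑ i, m i := by
  classical
  let v := (inftyPlace F).val
  let t : RatFunc F := RatFunc.X
  have ht : t ≠ 0 := RatFunc.X_ne_zero
  have hvt : ∀ n : ℤ, v (t ^ n) = WithZero.exp n := inftyPlace_X_zpow
  let η : ι → K := fun i => t ^ (-m i) • ω i
  have hω : ∀ i, ω i = t ^ (m i) • η i := fun i => by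
    rw [smul_smul, ← zpow_add₀ ht, add_neg_cancel, zpow_zero, one_smul]
  -- an integral element at infinity with a large coordinate
  obtain ⟨x, hx, i₂, hi₂⟩ : ∃ x : K, IsIntegral (InftyRing F) x ∧
      ∃ i, 1 < v (t ^ m i * ω.repr x i) := by
    by_contra! hcon
    refine hred ⟨h.finite, fun x => ⟨fun hx i => ?_, fun hx => ?_⟩⟩
    · have := hcon x hx i
      rw [map_mul, hvt] at this
      rwa [WithZero.exp_neg, ← one_div, le_div_iff₀ (WithZero.exp_pos), mul_comm]
    · rw [← ω.sum_repr x]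
      refine IsIntegral.sum _ fun i _ => ?_
      rw [hω i, smul_smul]
      refine isIntegral_inftyRing_smul ?_ (h.infinite i)
      have := hx i
      change v _ ≤ _
      rw [map_mul, hvt]
      rwa [WithZero.exp_neg, ← one_div, le_div_iff₀ (WithZero.exp_pos)] at this
  obtain ⟨i₁, -, hi₁⟩ := Finset.exists_max_image Finset.univ (fun i => v (t ^ m i * ω.repr x i))
    ⟨i₂, Finset.mem_univ _⟩
  -- Scaling by the inverse of the largest coordinate of x in the basis η makes all coordinates
  -- integral at infinity, with residues c_i in F that do not all vanish. As that coordinate has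
  -- value > 1, t·s is still integral.
  let s := (t ^ m i₁ * ω.repr x i₁)⁻¹
  have hγ : 1 < v (t ^ m i₁ * ω.repr x i₁) := hi₂.trans_le (hi₁ i₂ (Finset.mem_univ _))
  have hγ0 : v (t ^ m i₁ * ω.repr x i₁) ≠ 0 := (zero_lt_one.trans hγ).ne'
  have hne : t ^ m i₁ * ω.repr x i₁ ≠ 0 := (Valuation.ne_zero_iff _).1 hγ0
  have hs : v (t * s) ≤ 1 := by
    have h1 : v t = WithZero.exp 1 := by rw [← hvt, zpow_one]
    rw [map_mul, h1, map_inv₀, ← WithZero.exp_log hγ0, ← WithZero.exp_neg, ← WithZero.exp_add,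
      ← WithZero.exp_zero, WithZero.exp_le_exp]
    rw [← WithZero.exp_log hγ0, ← WithZero.exp_zero, WithZero.exp_lt_exp] at hγ
    omega
  have hsi : ∀ i, v (s * (t ^ m i * ω.repr x i)) ≤ 1 := by
    intro i
    rw [map_mul, map_inv₀, mul_comm, ← div_eq_mul_inv, div_le_one₀ (zero_lt_iff.2 hγ0)]
    exact hi₁ i (Finset.mem_univ _)
  choose c hc using fun i => exists_inftyPlace_sub_lt_one (hsi i)
  have hc₁ : c i₁ ≠ 0 := by
    intro h0
    have := hc i₁
    rw [h0, map_zero, sub_zero, inv_mul_cancel₀ hne, map_one] at this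
    exact this.false
  -- the leading coefficients give an integral combination
  have hinteg : IsIntegral (InftyRing F) (t • ∑ i, algebraMap F (RatFunc F) (c i) • η i) := by
    -- Replacing the scaled coordinates by their residues changes them by elements of value < 1,
    -- which remain integral after multiplication by t.
    have heq : t • ∑ i, algebraMap F (RatFunc F) (c i) • η i = (t * s) • x -
        ∑ i, (t * (s * (t ^ m i * ω.repr x i) - algebraMap F (RatFunc F) (c i))) • η i := by
      have hx' : (t * s) • x = ∑ i, (t * (s * (t ^ m i * ω.repr x i))) • η i := by
        conv_lhs => rw [← ω.sum_repr x]
        rw [Finset.smul_sum]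
        refine Finset.sum_congr rfl fun i _ => ?_
        rw [hω i, smul_smul, smul_smul]
        congr 1
        ring
      rw [hx', ← Finset.sum_sub_distrib, Finset.smul_sum]
      refine Finset.sum_congr rfl fun i _ => ?_
      rw [smul_smul, ← sub_smul]
      congr 1
      ring
    rw [heq]
    refine (isIntegral_inftyRing_smul hs hx).sub (IsIntegral.sum _ fun i _ =>
      isIntegral_inftyRing_smul ?_ (h.infinite i))
    have h1 : v t = WithZero.exp 1 := by rw [← hvt, zpow_one]
    have h2 := hc i
    change v _ ≤ 1
    rw [map_mul, h1]
    rcases eq_or_ne (v (s * (t ^ m i * ω.repr x i) - algebraMap F (RatFunc F) (c i))) 0 with h0 | h0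
    · rw [h0, mul_zero]; exact zero_le
    · change v _ < 1 at h2
      rw [← WithZero.exp_log h0, ← WithZero.exp_zero, WithZero.exp_lt_exp] at h2
      rw [← WithZero.exp_log h0, ← WithZero.exp_add, ← WithZero.exp_zero, WithZero.exp_le_exp]
      omega
  -- Because m_j is maximal among the i with c_i ≠ 0, y = t^(m_j)·∑ c_i η_i has polynomial
  -- coordinates in ω, the j-th being the nonzero constant c_j. Exchanging ω_j for y therefore
  -- preserves integrality over F[t].
  obtain ⟨j, hj, hjmax⟩ := Finset.exists_max_image (Finset.univ.filter fun i => c i ≠ 0) m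
    ⟨i₁, by simp [hc₁]⟩
  have hcj : c j ≠ 0 := (Finset.mem_filter.1 hj).2
  let y : K := t ^ m j • ∑ i, algebraMap F (RatFunc F) (c i) • η i
  have hy : y = ∑ i, (algebraMap F (RatFunc F) (c i) * t ^ (m j - m i)) • ω i := by
    change t ^ m j • _ = _
    rw [Finset.smul_sum]
    refine Finset.sum_congr rfl fun i _ => ?_
    rw [smul_smul, smul_smul, sub_eq_add_neg, zpow_add₀ ht]
    congr 1
    ring
  have hrepr : ∀ i, ω.repr y i = algebraMap F (RatFunc F) (c i) * t ^ (m j - m i) := fun i => by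
    rw [hy, Basis.repr_sum_self]
  have hreprj : ω.repr y j = algebraMap F (RatFunc F) (c j) := by
    rw [hrepr, sub_self, zpow_zero, mul_one]
  have hC : ∀ a : F, algebraMap F (RatFunc F) a ∈ (algebraMap F[X] (RatFunc F)).range := fun a =>
    ⟨C a, RatFunc.algebraMap_C a⟩
  have hpoly : ∀ i, ω.repr y i ∈ (algebraMap F[X] (RatFunc F)).range := by
    intro i
    rw [hrepr]
    by_cases hci : c i = 0
    · rw [hci, map_zero, zero_mul]; exact zero_mem _
    · have hle : m i ≤ m j := hjmax i (by simp [hci])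
      obtain ⟨n, hn⟩ := Int.eq_ofNat_of_zero_le (sub_nonneg.2 hle)
      rw [hn]
      refine mul_mem (hC _) ⟨X ^ n, ?_⟩
      rw [map_pow, RatFunc.algebraMap_X]
      exact (zpow_natCast _ _).symm
  have hne' : ω.repr y j ≠ 0 := by
    rw [hreprj]; simpa using hcj
  obtain ⟨ω', hω', hω'repr⟩ := exists_basis_update ω j y hne'
  refine ⟨ω', Function.update m j (m j - 1), ⟨isIntegralBasis_of (fun i => ?_) fun x hx i => ?_,
    fun i => ?_⟩, ?_⟩
  · rw [hω']
    by_cases hij : i = j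
    · rw [hij, Function.update_self]
      exact (h.finite y).2 hpoly
    · rw [Function.update_of_ne hij]
      exact h.finite.isIntegral i
  · have hx' := (h.finite x).1 hx
    have hdiv : ω.repr x j / ω.repr y j ∈ (algebraMap F[X] (RatFunc F)).range := by
      rw [hreprj, div_eq_mul_inv, ← map_inv₀]
      exact mul_mem (hx' j) (hC _)
    rw [hω'repr]
    split_ifs
    · exact hdiv
    · exact sub_mem (hx' i) (mul_mem (hpoly i) hdiv)
  · rw [hω']
    by_cases hij : i = j
    · subst hij
      rw [Function.update_self, Function.update_self, smul_smul]
      -- Dividing y by t^(m_j − 1) leaves t·∑ c_i η_i, already known to be integral at infinity: the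
      -- exponent at j drops by one.
      change IsIntegral (InftyRing F) ((t ^ (-(m i - 1)) * t ^ m i) • _)
      rw [← zpow_add₀ ht, show -(m i - 1) + m i = 1 by ring, zpow_one]
      exact hinteg
    · rw [Function.update_of_ne hij, Function.update_of_ne hij]
      exact h.infinite i
  · rw [Finset.sum_update_of_mem (Finset.mem_univ j),
      ← Finset.add_sum_erase _ _ (Finset.mem_univ j), Finset.sdiff_singleton_eq_erase]
    linarith

-- Descent on ∑ m_i, which stays nonnegative for prereduced bases.
variable (F K) in
theorem exists_isReducedBasis [FiniteDimensional (RatFunc F) K]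
    [Algebra.IsSeparable (RatFunc F) K] :
    ∃ (ω : Basis (Fin (finrank (RatFunc F) K)) (RatFunc F) K) (m : _ → ℤ),
      IsReducedBasis ω m := by
  have key : ∀ (n : ℕ) (ω : Basis (Fin (finrank (RatFunc F) K)) (RatFunc F) K) (m : _ → ℤ),
      IsPrereducedBasis ω m → (∑ i, m i).toNat = n →
      ∃ (ω : Basis (Fin (finrank (RatFunc F) K)) (RatFunc F) K) (m : _ → ℤ),
        IsReducedBasis ω m := by
    intro n
    induction n using Nat.strong_induction_on with
    | _ n ih =>
      intro ω m h hn
      by_cases hred : IsReducedBasis ω m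
      · exact ⟨ω, m, hred⟩
      · obtain ⟨ω', m', h', hlt⟩ := h.exists_sum_lt hred
        have := h'.sum_nonneg
        exact ih _ (by omega) ω' m' h' rfl
  obtain ⟨ω, m, h⟩ := exists_isPrereducedBasis F K
  exact key _ ω m h rfl

end Reduced

end FF

end InfiniteGlobalField

namespace InfiniteGlobalField

open Module IsDedekindDomain

/-! ### Integral bases under localization -/

theorem IsIntegralBasis.of_isLocalization {A A' k K ι : Type*} [CommRing A] [CommRing A'] [Field k]
    [Field K] [Algebra A A'] [Algebra A k] [Algebra A' k] [IsScalarTower A A' k] [Algebra k K]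
    [Algebra A K] [Algebra A' K] [IsScalarTower A k K] [IsScalarTower A' k K]
    [IsScalarTower A A' K] [Fintype ι] {ω : Basis ι k K} (hω : IsIntegralBasis A ω)
    (M : Submonoid A) [IsLocalization M A'] : IsIntegralBasis A' ω := by
  refine isIntegralBasis_of (fun i => (hω.isIntegral i).tower_top) fun x hx i => ?_
  obtain ⟨s, hs⟩ := IsIntegral.exists_multiple_integral_of_isLocalization (R := A) M x hx
  obtain ⟨a, ha⟩ := (hω _).1 hs i
  refine ⟨IsLocalization.mk' A' a s, ?_⟩
  have hsu : IsUnit (algebraMap A k s) := by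
    rw [IsScalarTower.algebraMap_apply A A' k]
    exact (IsLocalization.map_units A' s).map _
  have h1 : algebraMap A k a = algebraMap A k s * ω.repr x i := by
    rw [ha, Submonoid.smul_def, ← algebraMap_smul k (s : A) x, map_smul, Finsupp.smul_apply,
      smul_eq_mul]
  apply hsu.mul_left_cancel
  rw [← h1, IsScalarTower.algebraMap_apply A A' k, IsScalarTower.algebraMap_apply A A' k,
    ← map_mul, IsLocalization.mk'_spec'_mk]

/-- The discriminant of an integral basis of `L` is divisible by the power of the discriminant
of an integral basis of `K`. -/
theorem exists_discr_eq_mul_pow_of_isDedekindDomain {A k K L : Type*} [CommRing A]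
    [IsDedekindDomain A] [Field k] [Field K] [Field L] [Algebra A k] [IsFractionRing A k]
    [Algebra k K] [Algebra k L] [Algebra K L] [IsScalarTower k K L] [Algebra A K] [Algebra A L]
    [IsScalarTower A k K] [IsScalarTower A k L]
    [FiniteDimensional k K] [FiniteDimensional k L] [Algebra.IsSeparable k L]
    {ι κ : Type*} [Fintype ι] [DecidableEq ι] [Fintype κ] [DecidableEq κ]
    {ω : Basis ι k K} (hω : IsIntegralBasis A ω) {l : Basis κ k L} (hl : ∀ i, IsIntegral A (l i)) :
    ∃ a : A, Algebra.discr k l = algebraMap A k a * Algebra.discr k ω ^ finrank K L := by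
  have : Algebra.IsSeparable k K := Algebra.isSeparable_tower_bot_of_isSeparable k K L
  have h0 : Algebra.discr k ω ^ finrank K L ≠ 0 :=
    pow_ne_zero _ (Algebra.discr_not_zero_of_basis _ ω)
  suffices h : Algebra.discr k l / Algebra.discr k ω ^ finrank K L ∈ (algebraMap A k).range by
    obtain ⟨a, ha⟩ := h
    exact ⟨a, by rw [ha, div_mul_cancel₀ _ h0]⟩
  -- Membership in A is tested at each prime, where localizing reduces the claim to a discrete
  -- valuation ring.
  refine HeightOneSpectrum.mem_integers_of_valuation_le_one k _ fun v => ?_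
  have hmem : ∀ x : HeightOneSpectrum.valuationSubringAtPrime k v, v.valuation k (x : k) ≤ 1 :=
    fun x => HeightOneSpectrum.valuationSubringAtPrime_le_valuation (K := k) v x.2
  have := IsLocalization.AtPrime.isDiscreteValuationRing_of_dedekind_domain A v.ne_bot
    (HeightOneSpectrum.valuationSubringAtPrime k v)
  have t1 : IsScalarTower A (HeightOneSpectrum.valuationSubringAtPrime k v) K :=
    .of_algebraMap_eq fun x => IsScalarTower.algebraMap_apply A k K x
  have t2 : IsScalarTower A (HeightOneSpectrum.valuationSubringAtPrime k v) L :=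
    .of_algebraMap_eq fun x => IsScalarTower.algebraMap_apply A k L x
  have t3 : IsScalarTower (HeightOneSpectrum.valuationSubringAtPrime k v) K L :=
    .of_algebraMap_eq fun x => IsScalarTower.algebraMap_apply k K L x
  obtain ⟨a, ha⟩ := exists_discr_eq_mul_pow (A := HeightOneSpectrum.valuationSubringAtPrime k v)
    (L := L) (hω.of_isLocalization v.asIdeal.primeCompl) (fun i => (hl i).tower_top)
  rw [ha, mul_div_cancel_right₀ _ h0]
  exact hmem a

namespace FF

open Polynomial

/-! ### Exponents of reduced bases in an extension. -/

section SumLe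

variable {F K : Type*} [Field F] [Field K] [Algebra (RatFunc F) K] [Algebra F[X] K]
  [IsScalarTower F[X] (RatFunc F) K]

theorem IsReducedBasis.exists_inftyBasis {ι : Type*} [Fintype ι] {ω : Basis ι (RatFunc F) K}
    {m : ι → ℤ} (h : IsReducedBasis ω m) : ∃ η : Basis ι (RatFunc F) K,
      (∀ i, η i = (RatFunc.X : RatFunc F) ^ (-m i) • ω i) ∧ IsIntegralBasis (InftyRing F) η := by
  have hX : ∀ i, IsUnit ((RatFunc.X : RatFunc F) ^ (-m i)) := fun i =>
    (zpow_ne_zero _ RatFunc.X_ne_zero).isUnit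
  refine ⟨ω.isUnitSMul hX, fun i => ω.isUnitSMul_apply hX i, fun x => ?_⟩
  rw [h.infinite]
  refine forall_congr' fun i => ?_
  have h1 : ω.repr x i = RatFunc.X ^ (-m i) * (ω.isUnitSMul hX).repr x i := by
    conv_lhs => rw [← (ω.isUnitSMul hX).sum_repr x]
    classical
    simp only [Basis.isUnitSMul_apply, map_sum, map_smul, Finsupp.finsetSum_apply,
      Finsupp.smul_apply, Basis.repr_self, Finsupp.single_apply, smul_eq_mul]
    simp [mul_comm]
  rw [mem_range_inftyRing, h1, map_mul, inftyPlace_X_zpow]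
  exact mul_le_iff_le_one_right WithZero.exp_pos

/-- With d = [L:K], disc(l) = a·disc(ω)^d for a nonzero polynomial a, and the discriminants at
infinity satisfy the same relation with a factor b of value ≤ 1. They differ from the finite ones by
t^(−2∑μ) and t^(−2∑m), so comparing values gives deg a − 2∑μ ≤ −2d∑m, and deg a ≥ 0. -/
theorem IsReducedBasis.finrank_mul_sum_le {L : Type*} [Field L] [Algebra (RatFunc F) L]
    [Algebra F[X] L] [IsScalarTower F[X] (RatFunc F) L] [Algebra K L]
    [IsScalarTower (RatFunc F) K L] [FiniteDimensional (RatFunc F) K]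
    [FiniteDimensional (RatFunc F) L] [Algebra.IsSeparable (RatFunc F) L]
    {ι κ : Type*} [Fintype ι] [Fintype κ] {ω : Basis ι (RatFunc F) K} {m : ι → ℤ}
    {l : Basis κ (RatFunc F) L} {μ : κ → ℤ} (h : IsReducedBasis ω m) (h' : IsReducedBasis l μ) :
    finrank K L * ∑ i, m i ≤ ∑ i, μ i := by
  classical
  have : Algebra.IsSeparable (RatFunc F) K :=
    Algebra.isSeparable_tower_bot_of_isSeparable (RatFunc F) K L
  have t3 : IsScalarTower (InftyRing F) K L :=
    .of_algebraMap_eq fun x => IsScalarTower.algebraMap_apply (RatFunc F) K L x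
  obtain ⟨η, hη, hη'⟩ := h.exists_inftyBasis
  obtain ⟨θ, hθ, hθ'⟩ := h'.exists_inftyBasis
  obtain ⟨a, ha⟩ := exists_discr_eq_mul_pow_of_isDedekindDomain (L := L) h.finite h'.finite.isIntegral
  obtain ⟨b, hb⟩ := exists_discr_eq_mul_pow (L := L) hη' hθ'.isIntegral
  have hdη : Algebra.discr (RatFunc F) η =
      (RatFunc.X ^ (-∑ i, m i)) ^ 2 * Algebra.discr (RatFunc F) ω := by
    rw [← prod_X_zpow, ← discr_smul]
    exact congrArg _ (funext hη)
  have hdθ : Algebra.discr (RatFunc F) θ =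
      (RatFunc.X ^ (-∑ i, μ i)) ^ 2 * Algebra.discr (RatFunc F) l := by
    rw [← prod_X_zpow, ← discr_smul]
    exact congrArg _ (funext hθ)
  have h0 : Algebra.discr (RatFunc F) ω ≠ 0 := Algebra.discr_not_zero_of_basis _ ω
  have h0' : Algebra.discr (RatFunc F) l ≠ 0 := Algebra.discr_not_zero_of_basis _ l
  have ha0 : a ≠ 0 := by
    rintro rfl
    rw [map_zero, zero_mul] at ha
    exact h0' ha
  rw [hdη, hdθ, ha, mul_pow, ← mul_assoc, ← mul_assoc] at hb
  have hb' := congrArg (inftyPlace F).val (mul_right_cancel₀ (pow_ne_zero _ h0) hb)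
  have hb1 : (inftyPlace F).val (algebraMap (InftyRing F) (RatFunc F) b) ≤ 1 := b.2
  rw [map_mul, map_mul, map_pow, map_pow, map_pow, inftyPlace_X_zpow, inftyPlace_X_zpow,
    inftyPlace_algebraMap ha0, ← WithZero.exp_nsmul, ← WithZero.exp_nsmul, ← WithZero.exp_nsmul,
    ← WithZero.exp_add] at hb'
  have hle := hb'.trans_le (mul_le_of_le_one_left' hb1)
  rw [WithZero.exp_le_exp] at hle
  simp only [nsmul_eq_mul] at hle
  push_cast at hle
  have : (0 : ℤ) ≤ a.natDegree := by positivity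
  nlinarith

end SumLe

end FF

end InfiniteGlobalField

namespace InfiniteGlobalField

namespace FF

open Polynomial Module IsDedekindDomain

/-! ### Places over the two charts of the projective line -/

/-- The valuation ring of P is integrally closed. -/
theorem Place.le_one_of_isIntegral {F K A : Type*} [Field F] [Field K] [Algebra F K] [CommRing A]
    [Algebra A K] (P : Place F K) (h : ∀ a : A, P.val (algebraMap A K a) ≤ 1) {x : K}
    (hx : IsIntegral A x) : P.val x ≤ 1 := by
  let : Algebra A P.val.valuationSubring :=
    ((algebraMap A K).codRestrict P.val.valuationSubring.toSubring h).toAlgebra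
  have : IsScalarTower A P.val.valuationSubring K := .of_algebraMap_eq fun _ => rfl
  obtain ⟨y, rfl⟩ := IsIntegrallyClosed.isIntegral_iff.1
    (hx.tower_top (A := P.val.valuationSubring))
  exact y.2

section InftyRing

variable (F : Type*) [Field F]

/-- The uniformizer `1 / t` at infinity. -/
noncomputable def invX : InftyRing F := ⟨RatFunc.X ^ (-1 : ℤ), by
  change (inftyPlace F).val _ ≤ 1
  rw [inftyPlace_X_zpow, ← WithZero.exp_zero, WithZero.exp_le_exp]
  norm_num⟩

theorem invX_dvd_iff {x : InftyRing F} : invX F ∣ x ↔ (inftyPlace F).val (x : RatFunc F) < 1 := by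
  constructor
  · rintro ⟨y, rfl⟩
    have hy : (inftyPlace F).val (y : RatFunc F) ≤ 1 := y.2
    change (inftyPlace F).val (RatFunc.X ^ (-1 : ℤ) * (y : RatFunc F)) < 1
    rw [map_mul, inftyPlace_X_zpow]
    refine (mul_le_of_le_one_right' hy).trans_lt ?_
    rw [← WithZero.exp_zero, WithZero.exp_lt_exp]
    norm_num
  · intro hx
    have hy : (inftyPlace F).val (RatFunc.X ^ (1 : ℤ) * (x : RatFunc F)) ≤ 1 := by
      rw [map_mul, inftyPlace_X_zpow]
      rcases eq_or_ne ((inftyPlace F).val (x : RatFunc F)) 0 with h0 | h0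
      · rw [h0, mul_zero]; exact zero_le
      · rw [← WithZero.exp_log h0, ← WithZero.exp_zero, WithZero.exp_lt_exp] at hx
        rw [← WithZero.exp_log h0, ← WithZero.exp_add, ← WithZero.exp_zero, WithZero.exp_le_exp]
        omega
    refine ⟨⟨_, hy⟩, Subtype.ext ?_⟩
    change (x : RatFunc F) = RatFunc.X ^ (-1 : ℤ) * (RatFunc.X ^ (1 : ℤ) * (x : RatFunc F))
    rw [← mul_assoc, ← zpow_add₀ RatFunc.X_ne_zero]
    simp

theorem prime_invX : Prime (invX F) := by
  refine ⟨fun h => ?_, fun h => ?_, fun a b h => ?_⟩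
  · exact zpow_ne_zero _ RatFunc.X_ne_zero (congrArg Subtype.val h)
  · have := (invX_dvd_iff F).1 (h.dvd (a := 1))
    change (inftyPlace F).val (1 : RatFunc F) < 1 at this
    rw [map_one] at this
    exact this.false
  · rw [invX_dvd_iff] at *
    rw [invX_dvd_iff]
    by_contra! hab
    change (inftyPlace F).val ((a : RatFunc F) * b) < 1 at h
    rw [map_mul] at h
    exact (one_le_mul hab.1 hab.2).not_gt h

theorem bijective_algebraMap_quotient_invX :
    Function.Bijective (algebraMap F (InftyRing F ⧸ Ideal.span {invX F})) := by
  have : (Ideal.span {invX F}).IsPrime :=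
    (Ideal.span_singleton_prime (prime_invX F).ne_zero).2 (prime_invX F)
  refine ⟨(algebraMap F _).injective, fun y => ?_⟩
  obtain ⟨x, rfl⟩ := Ideal.Quotient.mk_surjective y
  obtain ⟨c, hc⟩ := exists_inftyPlace_sub_lt_one x.2
  refine ⟨c, ?_⟩
  rw [eq_comm, IsScalarTower.algebraMap_apply F (InftyRing F)]
  refine Ideal.Quotient.eq.2 (Ideal.mem_span_singleton.2 ((invX_dvd_iff F).2 ?_))
  exact hc

theorem finrank_quotient_invX : finrank F (InftyRing F ⧸ Ideal.span {invX F}) = 1 := by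
  rw [← (AlgEquiv.ofBijective (Algebra.ofId F (InftyRing F ⧸ Ideal.span {invX F}))
    (bijective_algebraMap_quotient_invX F)).toLinearEquiv.finrank_eq, finrank_self]

theorem asIdeal_eq_span_invX (v : HeightOneSpectrum (InftyRing F)) :
    v.asIdeal = Ideal.span {invX F} := by
  have hp : (Ideal.span {invX F}).IsPrime :=
    (Ideal.span_singleton_prime (prime_invX F).ne_zero).2 (prime_invX F)
  have hm : (Ideal.span {invX F}).IsMaximal :=
    hp.isMaximal (by simpa using (prime_invX F).ne_zero)
  rw [IsLocalRing.eq_maximalIdeal hm, IsLocalRing.eq_maximalIdeal v.isMaximal]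

theorem finite_quotient_inftyRing (v : HeightOneSpectrum (InftyRing F)) :
    Module.Finite F (InftyRing F ⧸ v.asIdeal) := by
  rw [asIdeal_eq_span_invX]
  exact finite_of_finrank_pos (by rw [finrank_quotient_invX]; exact one_pos)

theorem exists_irreducible_asIdeal_eq (v : HeightOneSpectrum F[X]) :
    ∃ p : F[X], Irreducible p ∧ v.asIdeal = Ideal.span {p} := by
  have hp := v.isPrime
  obtain ⟨p, hpv⟩ := (IsPrincipalIdealRing.principal v.asIdeal).principal
  change v.asIdeal = Ideal.span {p} at hpv
  have hp0 : p ≠ 0 := by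
    rintro rfl
    exact v.ne_bot (by simpa using hpv)
  refine ⟨p, ((Ideal.span_singleton_prime hp0).1 (hpv ▸ hp)).irreducible, hpv⟩

theorem finite_quotient_polynomial (v : HeightOneSpectrum F[X]) :
    Module.Finite F (F[X] ⧸ v.asIdeal) := by
  obtain ⟨p, hp, hpv⟩ := exists_irreducible_asIdeal_eq F v
  rw [hpv]
  refine finite_of_finrank_pos ?_
  rw [finrank_quotient_span_eq_natDegree]
  exact hp.natDegree_pos

end InftyRing

section Charts

variable {F K : Type*} [Field F] [Field K] [Algebra F K] [Algebra (RatFunc F) K] [Algebra F[X] K]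
  [IsScalarTower F (RatFunc F) K] [IsScalarTower F[X] (RatFunc F) K]

/-- The value of a place at the variable `t`. -/
noncomputable def Place.valX (P : Place F K) : ℤᵐ⁰ :=
  P.val (algebraMap (RatFunc F) K RatFunc.X)

theorem Place.valX_ne_zero (P : Place F K) : P.valX ≠ 0 := by
  rw [Place.valX, Valuation.ne_zero_iff]
  simpa using RatFunc.X_ne_zero

instance : IsScalarTower F F[X] K := .of_algebraMap_eq fun x => by
  rw [IsScalarTower.algebraMap_apply F (RatFunc F) K, IsScalarTower.algebraMap_apply F[X] (RatFunc F) K,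
    ← IsScalarTower.algebraMap_apply F F[X] (RatFunc F)]

instance : IsScalarTower F (InftyRing F) K := .of_algebraMap_eq fun x => by
  rw [IsScalarTower.algebraMap_apply F (RatFunc F) K]
  rfl

theorem algebraMap_X : algebraMap F[X] K X = algebraMap (RatFunc F) K RatFunc.X := by
  rw [IsScalarTower.algebraMap_apply F[X] (RatFunc F) K, RatFunc.algebraMap_X]

theorem Place.le_one_of_polynomial (P : Place F K) (h : P.valX ≤ 1) (p : F[X]) :
    P.val (algebraMap F[X] K p) ≤ 1 := by
  induction p using Polynomial.induction_on' with
  | add p q hp hq => rw [map_add]; exact P.val.map_add_le hp hq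
  | monomial n a =>
    rw [← C_mul_X_pow_eq_monomial, map_mul, map_pow, map_mul, map_pow, algebraMap_X]
    refine mul_le_one' ?_ (pow_le_one' h n)
    have : algebraMap F[X] K (C a) = algebraMap F K a :=
      (IsScalarTower.algebraMap_apply F F[X] K a).symm
    rw [this]
    exact Valuation.IsTrivialOn.valuation_algebraMap_le_one P.val a

/-- Where t has a pole, the leading term strictly dominates all others. -/
theorem Place.eq_pow_of_polynomial (P : Place F K) (h : 1 < P.valX) {p : F[X]} (hp : p ≠ 0) :
    P.val (algebraMap F[X] K p) = P.valX ^ p.natDegree := by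
  have hC : ∀ a : F, algebraMap F[X] K (C a) = algebraMap F K a := fun a =>
    (IsScalarTower.algebraMap_apply F F[X] K a).symm
  have hle : ∀ (n : ℕ) (q : F[X]), q.natDegree ≤ n →
      P.val (algebraMap F[X] K q) ≤ P.valX ^ n := by
    intro n q hq
    rw [q.as_sum_range_C_mul_X_pow, map_sum]
    refine P.val.map_sum_le fun i hi => ?_
    rw [map_mul, map_pow, map_mul, map_pow, algebraMap_X, hC]
    refine (mul_le_of_le_one_left'
      (Valuation.IsTrivialOn.valuation_algebraMap_le_one P.val _)).trans ?_
    exact pow_le_pow_right₀ h.le (by have := Finset.mem_range.1 hi; omega)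
  have hlead : P.val (algebraMap F[X] K (C p.leadingCoeff * X ^ p.natDegree)) =
      P.valX ^ p.natDegree := by
    rw [map_mul, map_pow, map_mul, map_pow, algebraMap_X, hC,
      Valuation.IsTrivialOn.eq_one (v := P.val) _ (leadingCoeff_ne_zero.2 hp), one_mul]
    rfl
  have hsplit : p = C p.leadingCoeff * X ^ p.natDegree + p.eraseLead := by
    rw [add_comm]
    exact (eraseLead_add_C_mul_X_pow p).symm
  rw [← hlead]
  conv_lhs => rw [hsplit, map_add]
  refine Valuation.map_add_eq_of_lt_left _ ?_
  rw [hlead]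
  rcases eq_or_ne p.eraseLead 0 with h0 | h0
  · rw [h0, map_zero, map_zero]
    exact pow_pos (zero_lt_one.trans h) _
  · have hlt : p.eraseLead.natDegree < p.natDegree := by
      have h2 : 2 ≤ p.support.card := by
        by_contra! hcon
        exact h0 (card_support_eq_zero.1 (by have := eraseLead_support_card_lt hp; omega))
      exact eraseLead_natDegree_lt h2
    exact (hle _ _ le_rfl).trans_lt (pow_lt_pow_right₀ h hlt)

theorem Place.le_one_of_inftyRing (P : Place F K) (h : 1 < P.valX) (x : InftyRing F) :
    P.val (algebraMap (InftyRing F) K x) ≤ 1 := by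
  have hx : (inftyPlace F).val (x : RatFunc F) ≤ 1 := x.2
  change P.val (algebraMap (RatFunc F) K (x : RatFunc F)) ≤ 1
  generalize (x : RatFunc F) = y at hx
  rcases eq_or_ne y 0 with rfl | hy
  · simp
  have hn := RatFunc.num_ne_zero hy
  have hd := y.denom_ne_zero
  rw [← RatFunc.num_div_denom y, map_div₀, inftyPlace_algebraMap hn, inftyPlace_algebraMap hd,
    ← WithZero.exp_sub, ← WithZero.exp_zero, WithZero.exp_le_exp] at hx
  rw [← RatFunc.num_div_denom y, map_div₀, ← IsScalarTower.algebraMap_apply,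
    ← IsScalarTower.algebraMap_apply, map_div₀, P.eq_pow_of_polynomial h hn,
    P.eq_pow_of_polynomial h hd]
  exact div_le_one_of_le₀ (pow_le_pow_right₀ h.le (by omega)) zero_le

variable [FiniteDimensional (RatFunc F) K]

theorem Place.forall_polynomial_iff (P : Place F K) :
    (∀ b : integralClosure F[X] K, P.val (algebraMap _ K b) ≤ 1) ↔ P.valX ≤ 1 := by
  refine ⟨fun h => ?_, fun h b => P.le_one_of_isIntegral (P.le_one_of_polynomial h) b.2⟩
  have := h (algebraMap F[X] _ X)
  rwa [← IsScalarTower.algebraMap_apply F[X] (integralClosure F[X] K) K, algebraMap_X] at this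

/-- If P is integral on the ring at infinity and |t| ≤ 1, then |t| = 1 because 1/t is integral.
Every rational function is a power of t times an element of that ring, so P would be bounded by 1 on
F(t), hence on the algebraic extension K, against surjectivity. -/
theorem Place.forall_inftyRing_iff (P : Place F K) :
    (∀ b : integralClosure (InftyRing F) K, P.val (algebraMap _ K b) ≤ 1) ↔ 1 < P.valX := by
  refine ⟨fun h => ?_, fun h b => P.le_one_of_isIntegral (P.le_one_of_inftyRing h) b.2⟩
  by_contra! hle
  have h1 : ∀ a : InftyRing F, P.val (algebraMap (RatFunc F) K (a : RatFunc F)) ≤ 1 := fun a => h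
    (algebraMap (InftyRing F) (integralClosure (InftyRing F) K) a)
  have hX : P.valX = 1 := by
    refine hle.antisymm ?_
    have := h1 (invX F)
    change P.val (algebraMap (RatFunc F) K (RatFunc.X ^ (-1 : ℤ))) ≤ 1 at this
    rw [zpow_neg_one, map_inv₀, map_inv₀] at this
    exact (inv_le_one₀ (zero_lt_iff.2 P.valX_ne_zero)).1 this
  have h2 : ∀ y : RatFunc F, P.val (algebraMap (RatFunc F) K y) ≤ 1 := by
    intro y
    rcases eq_or_ne y 0 with rfl | hy
    · simp
    have hv : (inftyPlace F).val y ≠ 0 := (Valuation.ne_zero_iff _).2 hy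
    have hz : (inftyPlace F).val (RatFunc.X ^ (-((inftyPlace F).val y).log) * y) ≤ 1 := by
      rw [map_mul, inftyPlace_X_zpow, WithZero.exp_neg, WithZero.exp_log hv, inv_mul_cancel₀ hv]
    have := h1 ⟨_, hz⟩
    rw [map_mul, map_zpow₀, map_mul, map_zpow₀] at this
    change P.valX ^ _ * _ ≤ 1 at this
    rwa [hX, one_zpow, one_mul] at this
  obtain ⟨x, hx⟩ := P.surjective (WithZero.exp 1)
  have := P.le_one_of_isIntegral h2 (Algebra.IsIntegral.isIntegral (R := RatFunc F) x)
  rw [hx, ← WithZero.exp_zero, WithZero.exp_le_exp] at this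
  norm_num at this

end Charts

end FF

end InfiniteGlobalField

namespace InfiniteGlobalField

namespace FF

open Polynomial Module IsDedekindDomain

/-! ### The genus in terms of a reduced basis -/

section Genus

variable {F K : Type*} [Field F] [Field K] [Algebra F K] [Algebra (RatFunc F) K] [Algebra F[X] K]
  [IsScalarTower F (RatFunc F) K] [IsScalarTower F[X] (RatFunc F) K]
  [FiniteDimensional (RatFunc F) K] [Algebra.IsSeparable (RatFunc F) K]

instance isDedekindDomain_polynomialClosure : IsDedekindDomain (integralClosure F[X] K) :=
  integralClosure.isDedekindDomain F[X] (RatFunc F) K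

instance isDedekindDomain_inftyClosure : IsDedekindDomain (integralClosure (InftyRing F) K) :=
  integralClosure.isDedekindDomain (InftyRing F) (RatFunc F) K

instance isFractionRing_polynomialClosure : IsFractionRing (integralClosure F[X] K) K :=
  integralClosure.isFractionRing_of_finite_extension (RatFunc F) K

instance isFractionRing_inftyClosure : IsFractionRing (integralClosure (InftyRing F) K) K :=
  integralClosure.isFractionRing_of_finite_extension (RatFunc F) K

instance finite_polynomialClosure : Module.Finite F[X] (integralClosure F[X] K) :=
  IsIntegralClosure.finite F[X] (RatFunc F) K _

instance finite_inftyClosure : Module.Finite (InftyRing F) (integralClosure (InftyRing F) K) :=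
  IsIntegralClosure.finite (InftyRing F) (RatFunc F) K _

instance isTorsionFree_polynomialClosure : Module.IsTorsionFree F[X] (integralClosure F[X] K) := by
  have : Module.IsTorsionFree F[X] K := .trans_faithfulSMul F[X] (RatFunc F) K
  infer_instance

instance isTorsionFree_inftyClosure :
    Module.IsTorsionFree (InftyRing F) (integralClosure (InftyRing F) K) := by
  have : Module.IsTorsionFree (InftyRing F) K := .trans_faithfulSMul (InftyRing F) (RatFunc F) K
  infer_instance

theorem finrank_polynomialClosure :
    finrank F[X] (integralClosure F[X] K) = finrank (RatFunc F) K := by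
  have : Module.IsTorsionFree F[X] K := .trans_faithfulSMul F[X] (RatFunc F) K
  exact IsIntegralClosure.rank F[X] (RatFunc F) K _

theorem finrank_inftyClosure :
    finrank (InftyRing F) (integralClosure (InftyRing F) K) = finrank (RatFunc F) K := by
  have : Module.IsTorsionFree (InftyRing F) K := .trans_faithfulSMul (InftyRing F) (RatFunc F) K
  exact IsIntegralClosure.rank (InftyRing F) (RatFunc F) K _

theorem Place.valX_ofPrime_le_one (v : HeightOneSpectrum (integralClosure F[X] K)) :
    (Place.ofPrime F K v).valX ≤ 1 :=
  (Place.forall_polynomial_iff _).1 (Place.ofPrime_le_one v)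

theorem Place.one_lt_valX_ofPrime (v : HeightOneSpectrum (integralClosure (InftyRing F) K)) :
    1 < (Place.ofPrime F K v).valX :=
  (Place.forall_inftyRing_iff _).1 (Place.ofPrime_le_one v)

theorem Place.finite_residueField (P : Place F K) : Module.Finite F P.residueField := by
  rcases le_or_gt P.valX 1 with h | h
  · obtain ⟨v, rfl⟩ := P.exists_eq_ofPrime (P.forall_polynomial_iff.2 h)
    obtain ⟨e⟩ := Place.nonempty_residueField_equiv (F := F) (K := K) v
    have := finite_quotient_of_under (F := F) v (finite_quotient_polynomial F (v.under F[X]))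
    exact Module.Finite.equiv e.toLinearEquiv
  · obtain ⟨v, rfl⟩ := P.exists_eq_ofPrime (P.forall_inftyRing_iff.2 h)
    obtain ⟨e⟩ := Place.nonempty_residueField_equiv (F := F) (K := K) v
    have := finite_quotient_of_under (F := F) v (finite_quotient_inftyRing F (v.under (InftyRing F)))
    exact Module.Finite.equiv e.toLinearEquiv

variable (F K) in
/-- The divisor of the poles of `t`. -/
theorem exists_poleDivisor : ∃ D : Place F K →₀ ℤ, (∀ P, 1 < P.valX → D P = P.valX.log) ∧
    (∀ P, P.valX ≤ 1 → D P = 0) ∧ divisorDegree D = finrank (RatFunc F) K := by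
  obtain ⟨D, h1, h2, h3⟩ :=
    exists_zeroDivisor F K (integralClosure (InftyRing F) K) (prime_invX F)
  refine ⟨D, fun P hP => ?_, fun P hP => h2 P fun h => ?_, ?_⟩
  · rw [h1 P (P.forall_inftyRing_iff.2 hP)]
    change -(P.val (algebraMap (RatFunc F) K (RatFunc.X ^ (-1 : ℤ)))).log = _
    rw [zpow_neg_one, map_inv₀, map_inv₀, WithZero.log_inv, neg_neg]
    rfl
  · exact (P.forall_inftyRing_iff.1 h).not_ge hP
  · rw [h3, finrank_quotient_invX, finrank_inftyClosure, Nat.cast_one, mul_one]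

variable (K) in
/-- The divisor of the zeros of an irreducible polynomial. -/
theorem exists_polynomialDivisor {p : F[X]} (hp : Irreducible p) : ∃ D : Place F K →₀ ℤ,
    (∀ P, P.valX ≤ 1 → D P = -(P.val (algebraMap F[X] K p)).log) ∧
    (∀ P, 1 < P.valX → D P = 0) ∧
    divisorDegree D = p.natDegree * finrank (RatFunc F) K := by
  obtain ⟨D, h1, h2, h3⟩ :=
    exists_zeroDivisor F K (integralClosure F[X] K) hp.prime
  refine ⟨D, fun P hP => ?_, fun P hP => h2 P fun h => ?_, ?_⟩
  · rw [h1 P (P.forall_polynomial_iff.2 hP)]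
    rfl
  · exact (P.forall_polynomial_iff.1 h).not_gt hP
  · rw [h3, finrank_quotient_span_eq_natDegree, finrank_polynomialClosure, mul_comm]

theorem Place.exists_irreducible_lt_one (P : Place F K) (h : P.valX ≤ 1) :
    ∃ p : F[X], Irreducible p ∧ P.val (algebraMap F[X] K p) < 1 := by
  obtain ⟨v, rfl⟩ := P.exists_eq_ofPrime (P.forall_polynomial_iff.2 h)
  obtain ⟨p, hp, hpv⟩ := exists_irreducible_asIdeal_eq F (v.under F[X])
  refine ⟨p, hp, ?_⟩
  have hmem : algebraMap F[X] (integralClosure F[X] K) p ∈ v.asIdeal := by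
    have : p ∈ (v.under F[X]).asIdeal := hpv ▸ Ideal.mem_span_singleton_self p
    exact this
  exact (v.valuation_lt_one_iff_mem (K := K) _).2 hmem

theorem isIntegral_polynomial_iff (x : K) :
    IsIntegral F[X] x ↔ ∀ P : Place F K, P.valX ≤ 1 → P.val x ≤ 1 := by
  refine ⟨fun h P hP => P.forall_polynomial_iff.2 hP ⟨x, h⟩, fun h => ?_⟩
  obtain ⟨y, rfl⟩ := HeightOneSpectrum.mem_integers_of_valuation_le_one
    (R := integralClosure F[X] K) K x fun v =>
      h (Place.ofPrime F K v) (Place.valX_ofPrime_le_one v)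
  exact y.2

theorem isIntegral_inftyRing_iff (x : K) :
    IsIntegral (InftyRing F) x ↔ ∀ P : Place F K, 1 < P.valX → P.val x ≤ 1 := by
  refine ⟨fun h P hP => P.forall_inftyRing_iff.2 hP ⟨x, h⟩, fun h => ?_⟩
  obtain ⟨y, rfl⟩ := HeightOneSpectrum.mem_integers_of_valuation_le_one
    (R := integralClosure (InftyRing F) K) K x fun v =>
      h (Place.ofPrime F K v) (Place.one_lt_valX_ofPrime v)
  exact y.2

/-- The condition splits over the two charts: no poles where t is finite, and poles at most those of
t^N where t is infinite. -/
theorem mem_riemannRochSpace_poleDivisor {D : Place F K →₀ ℤ}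
    (h1 : ∀ P, 1 < P.valX → D P = P.valX.log) (h2 : ∀ P, P.valX ≤ 1 → D P = 0) (N : ℕ) (x : K) :
    x ∈ riemannRochSpace (N • D) ↔ IsIntegral F[X] x ∧
      IsIntegral (InftyRing F) ((RatFunc.X : RatFunc F) ^ (-N : ℤ) • x) := by
  rw [mem_riemannRochSpace, isIntegral_polynomial_iff, isIntegral_inftyRing_iff, ← forall_and]
  refine forall_congr' fun P => ?_
  rw [Finsupp.smul_apply]
  rcases le_or_gt P.valX 1 with h | h
  · rw [h2 P h, smul_zero, WithZero.exp_zero]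
    exact ⟨fun hx => ⟨fun _ => hx, fun h' => absurd h h'.not_ge⟩, fun hx => hx.1 h⟩
  · have : P.val ((RatFunc.X : RatFunc F) ^ (-N : ℤ) • x) ≤ 1 ↔
        P.val x ≤ WithZero.exp (N • D P) := by
      rw [Algebra.smul_def, map_mul, map_zpow₀, map_zpow₀]
      change P.valX ^ (-N : ℤ) * _ ≤ 1 ↔ _
      rw [h1 P h, WithZero.exp_nsmul, WithZero.exp_log P.valX_ne_zero, zpow_neg, zpow_natCast,
        inv_mul_le_one₀ (pow_pos (zero_lt_iff.2 P.valX_ne_zero) N)]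
    rw [this]
    exact ⟨fun hx => ⟨fun h' => absurd h h'.not_gt, fun _ => hx⟩, fun hx => hx.2 h⟩

/-- The finite condition makes the coordinates polynomials, and the one at infinity bounds the i-th
degree by N − m_i. For N < m_i, `toNat` correctly leaves only the zero polynomial. -/
theorem IsReducedBasis.mem_iff {ι : Type*} {ω : Basis ι (RatFunc F) K} {m : ι → ℤ}
    (h : IsReducedBasis ω m) (N : ℕ) (x : K) :
    (IsIntegral F[X] x ∧ IsIntegral (InftyRing F) ((RatFunc.X : RatFunc F) ^ (-N : ℤ) • x)) ↔
      ∀ i, ∃ p ∈ degreeLT F (N - m i + 1).toNat, algebraMap F[X] (RatFunc F) p = ω.repr x i := by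
  rw [h.finite x, h.infinite, ← forall_and]
  refine forall_congr' fun i => ?_
  rw [map_smul, Finsupp.smul_apply, smul_eq_mul, map_mul, inftyPlace_X_zpow]
  have key : ∀ p : F[X], p ∈ degreeLT F (N - m i + 1).toNat ↔ WithZero.exp (-(N : ℤ)) *
      (inftyPlace F).val (algebraMap F[X] (RatFunc F) p) ≤ WithZero.exp (-m i) := by
    intro p
    rcases eq_or_ne p 0 with rfl | hp
    · simp
    rw [mem_degreeLT, inftyPlace_algebraMap hp, ← WithZero.exp_add, WithZero.exp_le_exp,
      degree_eq_natDegree hp, Nat.cast_lt]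
    omega
  constructor
  · rintro ⟨⟨p, hp⟩, hle⟩
    exact ⟨p, (key p).2 (hp ▸ hle), hp⟩
  · rintro ⟨p, hp, hx⟩
    exact ⟨⟨p, hx⟩, hx ▸ (key p).1 hp⟩

theorem IsReducedBasis.finrank_riemannRochSpace {ι : Type*} [Fintype ι]
    {ω : Basis ι (RatFunc F) K} {m : ι → ℤ} (h : IsReducedBasis ω m) {D : Place F K →₀ ℤ}
    (h1 : ∀ P, 1 < P.valX → D P = P.valX.log) (h2 : ∀ P, P.valX ≤ 1 → D P = 0) (N : ℕ) :
    Module.Finite F (riemannRochSpace (N • D)) ∧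
      finrank F (riemannRochSpace (N • D)) = ∑ i, (N - m i + 1).toNat := by
  let Φ : (∀ i, degreeLT F (N - m i + 1).toNat) →ₗ[F] K :=
    { toFun := fun f => ∑ i, (f i : F[X]) • ω i
      map_add' := fun f g => by
        simp only [Pi.add_apply, Submodule.coe_add, add_smul, Finset.sum_add_distrib]
      map_smul' := fun c f => by
        simp only [Pi.smul_apply, Submodule.coe_smul, RingHom.id_apply, Finset.smul_sum,
          smul_assoc] }
  have hrepr : ∀ f i, ω.repr (Φ f) i = algebraMap F[X] (RatFunc F) (f i) := by
    intro f i
    have : Φ f = ∑ i, algebraMap F[X] (RatFunc F) (f i) • ω i :=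
      Finset.sum_congr rfl fun i _ => (algebraMap_smul (RatFunc F) _ _).symm
    rw [this, Basis.repr_sum_self]
  have hinj : Function.Injective Φ := by
    intro f g hfg
    funext i
    have := congrArg (fun x => ω.repr x i) hfg
    simp only [hrepr] at this
    exact Subtype.ext (RatFunc.algebraMap_injective F this)
  have hrange : LinearMap.range Φ = riemannRochSpace (N • D) := by
    ext x
    rw [mem_riemannRochSpace_poleDivisor h1 h2, h.mem_iff]
    constructor
    · rintro ⟨f, rfl⟩ i
      exact ⟨f i, (f i).2, (hrepr f i).symm⟩
    · intro hx
      choose p hp hpx using hx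
      refine ⟨fun i => ⟨p i, hp i⟩, ω.repr.injective (Finsupp.ext fun i => ?_)⟩
      rw [hrepr, hpx]
  have hfin : ∀ n, Module.Finite F (degreeLT F n) := fun n =>
    Module.Finite.equiv (degreeLTEquiv F n).symm
  rw [← hrange]
  refine ⟨Module.Finite.equiv (LinearEquiv.ofInjective Φ hinj), ?_⟩
  rw [← (LinearEquiv.ofInjective Φ hinj).finrank_eq, finrank_pi_fintype]
  refine Finset.sum_congr rfl fun i _ => ?_
  rw [(degreeLTEquiv F _).finrank_eq, finrank_fin_fun]

/-- For the pole divisor D of t, deg(N·D) − dim L(N·D) is at most ∑ (m_i − 1), with equality for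
large N. Every place is a pole of t or a zero of an irreducible polynomial p, and the zero divisor
of p is equivalent to deg p times D; so the bound extends to all divisors. -/
theorem IsReducedBasis.genus_eq {ι : Type*} [Fintype ι] {ω : Basis ι (RatFunc F) K} {m : ι → ℤ}
    (h : IsReducedBasis ω m) : genus F K = ∑ i, m i - finrank (RatFunc F) K + 1 := by
  obtain ⟨D, h1, h2, hdeg⟩ := exists_poleDivisor F K
  have hcard : (finrank (RatFunc F) K : ℤ) = ∑ _i : ι, (1 : ℤ) := by
    rw [finrank_eq_card_basis ω]; simp
  have hD : ∀ N : ℕ, divisorDegree (N • D) - finrank F (riemannRochSpace (N • D)) =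
      ∑ i, ((N : ℤ) - (N - m i + 1).toNat) := by
    intro N
    rw [divisorDegree_nsmul, hdeg, (h.finrank_riemannRochSpace h1 h2 N).2, hcard, Finset.mul_sum,
      Nat.cast_sum, ← Finset.sum_sub_distrib]
    simp
  have hc : ∑ i, m i - (finrank (RatFunc F) K : ℤ) = ∑ i, (m i - 1) := by
    rw [hcard, Finset.sum_sub_distrib]
  refine FF.genus_eq Place.finite_residueField D _ (fun N =>
    ⟨(h.finrank_riemannRochSpace h1 h2 N).1, ?_⟩) ⟨∑ i, (m i).toNat, ?_⟩ fun P => ?_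
  · rw [hD, hc]
    refine Finset.sum_le_sum fun i _ => ?_
    have := Int.self_le_toNat (N - m i + 1)
    linarith
  · rw [hD, hc]
    refine Finset.sum_congr rfl fun i _ => ?_
    -- The chosen N = ∑ (m_i)⁺ is at least every m_i, so nothing is truncated and equality holds.
    have : (m i).toNat ≤ ∑ i, (m i).toNat :=
      Finset.single_le_sum (f := fun i => (m i).toNat) (fun _ _ => Nat.zero_le _)
        (Finset.mem_univ i)
    omega
  · have hDnn : ∀ Q, 1 < Q.valX → 1 ≤ D Q := fun Q hQ => by
      rw [h1 Q hQ]
      rw [← WithZero.exp_log Q.valX_ne_zero, ← WithZero.exp_zero, WithZero.exp_lt_exp] at hQ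
      exact hQ
    rcases le_or_gt P.valX 1 with hP | hP
    · obtain ⟨p, hp, hpP⟩ := P.exists_irreducible_lt_one hP
      have hp0 : algebraMap F[X] K p ≠ 0 := by
        rw [IsScalarTower.algebraMap_apply F[X] (RatFunc F) K]
        simpa using hp.ne_zero
      obtain ⟨E, e1, e2, e3⟩ := exists_polynomialDivisor K hp
      refine ⟨E, fun Q => ?_, ?_, algebraMap F[X] K p, hp0, p.natDegree, fun Q => ?_, ?_⟩
      · rcases le_or_gt Q.valX 1 with hQ | hQ
        · rw [e1 Q hQ]
          have := Q.le_one_of_polynomial hQ p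
          rw [← WithZero.exp_log ((Valuation.ne_zero_iff Q.val).2 hp0), ← WithZero.exp_zero,
            WithZero.exp_le_exp] at this
          simpa using this
        · rw [e2 Q hQ]; rfl
      · rw [e1 P hP]
        rw [← WithZero.exp_log ((Valuation.ne_zero_iff P.val).2 hp0), ← WithZero.exp_zero,
          WithZero.exp_lt_exp] at hpP
        omega
      · rw [Finsupp.smul_apply]
        rcases le_or_gt Q.valX 1 with hQ | hQ
        · rw [e1 Q hQ, h2 Q hQ, smul_zero, zero_sub]
        · rw [e2 Q hQ, h1 Q hQ, Q.eq_pow_of_polynomial hQ hp.ne_zero, WithZero.log_pow, sub_self]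
      · rw [e3, divisorDegree_nsmul, hdeg]
    · refine ⟨D, fun Q => ?_, hDnn P hP, 1, one_ne_zero, 1, fun Q => ?_, by rw [one_smul]⟩
      · rcases le_or_gt Q.valX 1 with hQ | hQ
        · rw [h2 Q hQ]; rfl
        · exact zero_le_one.trans (hDnn Q hQ)
      · rw [map_one, WithZero.log_one, sub_zero, one_smul]

end Genus

/-! ### The Riemann–Hurwitz inequality. -/

section GenusMul

variable {F K L : Type*} [Field F] [Field K] [Field L] [Algebra F K] [Algebra F L]
  [Algebra (RatFunc F) K] [Algebra (RatFunc F) L] [IsScalarTower F (RatFunc F) K]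
  [IsScalarTower F (RatFunc F) L] [Algebra K L] [IsScalarTower (RatFunc F) K L]
  [FiniteDimensional (RatFunc F) K] [FiniteDimensional (RatFunc F) L]
  [Algebra.IsSeparable (RatFunc F) L]

/-- A consequence of the Riemann–Hurwitz formula. -/
theorem genus_sub_one_mul_finrank_le :
    (genus F K - 1) * finrank K L ≤ genus F L - 1 := by
  let : Algebra F[X] K := ((algebraMap (RatFunc F) K).comp (algebraMap F[X] (RatFunc F))).toAlgebra
  let : Algebra F[X] L := ((algebraMap (RatFunc F) L).comp (algebraMap F[X] (RatFunc F))).toAlgebra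
  have : IsScalarTower F[X] (RatFunc F) K := .of_algebraMap_eq fun _ => rfl
  have : IsScalarTower F[X] (RatFunc F) L := .of_algebraMap_eq fun _ => rfl
  have : Algebra.IsSeparable (RatFunc F) K :=
    Algebra.isSeparable_tower_bot_of_isSeparable (RatFunc F) K L
  obtain ⟨ω, m, h⟩ := exists_isReducedBasis F K
  obtain ⟨l, μ, h'⟩ := exists_isReducedBasis F L
  have hle := h.finrank_mul_sum_le h'
  have hmul : (finrank (RatFunc F) K : ℤ) * finrank K L = finrank (RatFunc F) L := by
    rw [← finrank_mul_finrank (RatFunc F) K L, Nat.cast_mul]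
  rw [h.genus_eq, h'.genus_eq]
  linarith

end GenusMul

end FF

end InfiniteGlobalField

namespace InfiniteGlobalField

open Module IsDedekindDomain

/-! ### Counting places of function fields -/

theorem weightedPrimeCount_integralClosure_le {A k K L : Type*} [CommRing A] [IsDedekindDomain A]
    [Field k] [Field K] [Field L] [Algebra A k] [IsFractionRing A k]
    [Algebra k K] [Algebra k L] [Algebra K L] [IsScalarTower k K L] [Algebra A K] [Algebra A L]
    [IsScalarTower A k K] [IsScalarTower A k L]
    [FiniteDimensional k K] [FiniteDimensional k L] [Algebra.IsSeparable k L]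
    (hA : FinitelyManyPrimes A) {r : ℕ} (hr : 1 < r)
    (hpow : ∀ (v : HeightOneSpectrum (integralClosure A K)) (j m : ℕ), j ≠ 0 →
      Nat.card (integralClosure A K ⧸ v.asIdeal) ^ j = r ^ m →
        ∃ m', Nat.card (integralClosure A K ⧸ v.asIdeal) = r ^ m') (f : ℕ) :
    weightedPrimeCount (integralClosure A L) r f ≤
      weightedPrimeCount (integralClosure A K) r f * finrank K L := by
  have : Algebra.IsSeparable k K := Algebra.isSeparable_tower_bot_of_isSeparable k K L
  have : FiniteDimensional K L := FiniteDimensional.right k K L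
  have : IsScalarTower A K L := .of_algebraMap_eq fun x => by
    rw [IsScalarTower.algebraMap_apply A k K, IsScalarTower.algebraMap_apply A k L,
      ← IsScalarTower.algebraMap_apply k K L]
  have : Module.IsTorsionFree A K := .trans_faithfulSMul A k K
  have : IsDedekindDomain (integralClosure A K) := integralClosure.isDedekindDomain A k K
  have : IsDedekindDomain (integralClosure A L) := integralClosure.isDedekindDomain A k L
  have : IsFractionRing (integralClosure A K) K :=
    integralClosure.isFractionRing_of_finite_extension k K
  have : IsFractionRing (integralClosure A L) L :=
    integralClosure.isFractionRing_of_finite_extension k L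
  have : Module.Finite A (integralClosure A K) := IsIntegralClosure.finite A k K _
  have : Module.Finite A (integralClosure A L) := IsIntegralClosure.finite A k L _
  let φ : integralClosure A K →ₐ[A] integralClosure A L :=
    (IsScalarTower.toAlgHom A K L).mapIntegralClosure
  let : Algebra (integralClosure A K) (integralClosure A L) := φ.toRingHom.toAlgebra
  have t1 : IsScalarTower A (integralClosure A K) (integralClosure A L) :=
    .of_algebraMap_eq fun x => (φ.commutes x).symm
  have t2 : IsScalarTower (integralClosure A K) (integralClosure A L) L :=
    .of_algebraMap_eq fun x => rfl
  have : Module.Finite (integralClosure A K) (integralClosure A L) :=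
    Module.Finite.of_restrictScalars_finite A _ _
  have : Module.IsTorsionFree (integralClosure A K) (integralClosure A L) := by
    refine isTorsionFree_iff_algebraMap_injective.2 fun x y hxy => Subtype.ext ?_
    exact (algebraMap K L).injective (congrArg Subtype.val hxy)
  rw [IsFractionRing.finrank_eq (integralClosure A K) K (integralClosure A L) L]
  exact weightedPrimeCount_le _ _ (hA.of_finite (integralClosure A K)) hr hpow f

namespace FF

open Polynomial

/-- The quotient is an F-vector space, and it is finite because `Nat.card` would otherwise be 0. -/
theorem exists_card_eq_pow {F B : Type*} [Field F] [CommRing B] [Algebra F B] (I : Ideal B)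
    {j m : ℕ} (hj : j ≠ 0) [Finite F] (h : Nat.card (B ⧸ I) ^ j = Nat.card F ^ m) :
    ∃ m', Nat.card (B ⧸ I) = Nat.card F ^ m' := by
  have h0 : Nat.card (B ⧸ I) ≠ 0 := fun h0 => by
    rw [h0, zero_pow hj] at h
    exact pow_ne_zero _ Nat.card_pos.ne' h.symm
  have : Finite (B ⧸ I) := Nat.finite_of_card_ne_zero h0
  exact ⟨_, Module.natCard_eq_pow_finrank (K := F)⟩

theorem finitelyManyPrimes_inftyRing (F : Type*) [Field F] :
    FinitelyManyPrimes (InftyRing F) := fun _ _ =>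
  Set.Subsingleton.finite fun v _ w _ => HeightOneSpectrum.ext <| by
    rw [asIdeal_eq_span_invX, asIdeal_eq_span_invX]

theorem finitelyManyPrimes_polynomial (F : Type*) [Field F] [Finite F] :
    FinitelyManyPrimes F[X] := by
  intro q hq
  have hfin : ((degreeLT F (q + 1) : Submodule F F[X]) : Set F[X]).Finite := by
    have : Module.Finite F (degreeLT F (q + 1)) :=
      Module.Finite.equiv (degreeLTEquiv F (q + 1)).symm
    have : Finite (degreeLT F (q + 1)) := Module.finite_of_finite F
    exact Set.toFinite _
  refine Set.Finite.of_finite_image (f := HeightOneSpectrum.asIdeal) ?_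
    fun _ _ _ _ h => HeightOneSpectrum.ext h
  refine (hfin.image fun p => Ideal.span {p}).subset ?_
  rintro _ ⟨v, hv, rfl⟩
  obtain ⟨p, hp, hpv⟩ := exists_irreducible_asIdeal_eq F v
  refine ⟨p, mem_degreeLT.2 ?_, hpv.symm⟩
  have := finite_quotient_polynomial F v
  -- The norm |F|^(deg p) exceeds deg p, so a prime of norm q is generated by a polynomial of degree
  -- at most q.
  have hcard : q = Nat.card F ^ p.natDegree := by
    rw [← hv, Module.natCard_eq_pow_finrank (K := F), hpv, finrank_quotient_span_eq_natDegree]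
  rw [degree_eq_natDegree hp.ne_zero, Nat.cast_lt, Nat.lt_succ_iff, hcard]
  exact (Nat.lt_pow_self Finite.one_lt_card).le

section Count

variable {F K : Type*} [Field F] [Finite F] [Field K] [Algebra F K] [Algebra (RatFunc F) K]
  [Algebra F[X] K] [IsScalarTower F (RatFunc F) K] [IsScalarTower F[X] (RatFunc F) K]
  [FiniteDimensional (RatFunc F) K] [Algebra.IsSeparable (RatFunc F) K]

-- Every place is centred on exactly one of the two charts, according to whether t is finite or has
-- a pole there.
variable (F K) in
theorem numPlaces_eq {q : ℕ} (hq : q ≠ 0) : numPlaces F K q =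
    primeCount (integralClosure F[X] K) q + primeCount (integralClosure (InftyRing F) K) q := by
  have h1 : Finite {v : HeightOneSpectrum (integralClosure F[X] K) //
      Nat.card (integralClosure F[X] K ⧸ v.asIdeal) = q} :=
    (finitelyManyPrimes_polynomial F).of_finite (integralClosure F[X] K) q hq
  have h2 : Finite {v : HeightOneSpectrum (integralClosure (InftyRing F) K) //
      Nat.card (integralClosure (InftyRing F) K ⧸ v.asIdeal) = q} :=
    (finitelyManyPrimes_inftyRing F).of_finite (integralClosure (InftyRing F) K) q hq
  rw [primeCount, primeCount, ← Nat.card_sum, numPlaces]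
  refine (Nat.card_congr (Equiv.ofBijective (Sum.elim
    (fun v => ⟨Place.ofPrime F K v.1, (Place.norm_ofPrime v.1).trans v.2⟩)
    (fun v => ⟨Place.ofPrime F K v.1, (Place.norm_ofPrime v.1).trans v.2⟩)) ⟨?_, ?_⟩)).symm
  · refine Function.Injective.sumElim ?_ ?_ ?_
    · exact fun v w h => Subtype.ext (Place.ofPrime_injective (congrArg Subtype.val h))
    · exact fun v w h => Subtype.ext (Place.ofPrime_injective (congrArg Subtype.val h))
    · intro v w h
      have := congrArg Subtype.val h
      dsimp only at this
      exact (Place.valX_ofPrime_le_one v.1).not_gt (this ▸ Place.one_lt_valX_ofPrime w.1)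
  · rintro ⟨P, hP⟩
    rcases le_or_gt P.valX 1 with h | h
    · obtain ⟨v, rfl⟩ := P.exists_eq_ofPrime (P.forall_polynomial_iff.2 h)
      exact ⟨Sum.inl ⟨v, (Place.norm_ofPrime v).symm.trans hP⟩, rfl⟩
    · obtain ⟨v, rfl⟩ := P.exists_eq_ofPrime (P.forall_inftyRing_iff.2 h)
      exact ⟨Sum.inr ⟨v, (Place.norm_ofPrime v).symm.trans hP⟩, rfl⟩

variable (F K) in
theorem sum_numPlaces_eq (f : ℕ) :
    ∑ m ∈ Finset.Icc 1 f, m * numPlaces F K (Nat.card F ^ m) =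
      weightedPrimeCount (integralClosure F[X] K) (Nat.card F) f +
        weightedPrimeCount (integralClosure (InftyRing F) K) (Nat.card F) f := by
  rw [weightedPrimeCount, weightedPrimeCount, ← Finset.sum_add_distrib]
  refine Finset.sum_congr rfl fun m _ => ?_
  rw [numPlaces_eq F K (pow_ne_zero _ Nat.card_pos.ne'), mul_add]

end Count

section CountMul

variable (F K L : Type*) [Field F] [Finite F] [Field K] [Field L] [Algebra F K] [Algebra F L]
  [Algebra (RatFunc F) K] [Algebra (RatFunc F) L] [IsScalarTower F (RatFunc F) K]
  [IsScalarTower F (RatFunc F) L] [Algebra K L] [IsScalarTower (RatFunc F) K L]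
  [FiniteDimensional (RatFunc F) K] [FiniteDimensional (RatFunc F) L]
  [Algebra.IsSeparable (RatFunc F) L]

theorem sum_numPlaces_le (f : ℕ) :
    ∑ m ∈ Finset.Icc 1 f, m * numPlaces F L (Nat.card F ^ m) ≤
      (∑ m ∈ Finset.Icc 1 f, m * numPlaces F K (Nat.card F ^ m)) * finrank K L := by
  let : Algebra F[X] K := ((algebraMap (RatFunc F) K).comp (algebraMap F[X] (RatFunc F))).toAlgebra
  let : Algebra F[X] L := ((algebraMap (RatFunc F) L).comp (algebraMap F[X] (RatFunc F))).toAlgebra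
  have : IsScalarTower F[X] (RatFunc F) K := .of_algebraMap_eq fun _ => rfl
  have : IsScalarTower F[X] (RatFunc F) L := .of_algebraMap_eq fun _ => rfl
  have : Algebra.IsSeparable (RatFunc F) K :=
    Algebra.isSeparable_tower_bot_of_isSeparable (RatFunc F) K L
  rw [sum_numPlaces_eq, sum_numPlaces_eq, add_mul]
  exact add_le_add
    (weightedPrimeCount_integralClosure_le (k := RatFunc F) (finitelyManyPrimes_polynomial F)
      Finite.one_lt_card (fun v _ _ hj h => exists_card_eq_pow v.asIdeal hj h) f)
    (weightedPrimeCount_integralClosure_le (k := RatFunc F) (finitelyManyPrimes_inftyRing F)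
      Finite.one_lt_card (fun v _ _ hj h => exists_card_eq_pow v.asIdeal hj h) f)

end CountMul

/-! ### Limits and deficiencies of infinite function fields -/

section Limits

variable {F : Type*} [Field F] {Ω : Type*} [Field Ω] [Algebra F Ω] [Algebra (RatFunc F) Ω]
  [IsScalarTower F (RatFunc F) Ω]

theorem IsInfinite.isSeparable {𝒦 K : IntermediateField (RatFunc F) Ω} (h : IsInfinite F 𝒦)
    (hK : K ≤ 𝒦) : Algebra.IsSeparable (RatFunc F) K :=
  have := h.separable
  Algebra.IsSeparable.of_algHom (RatFunc F) 𝒦 (IntermediateField.inclusion hK)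

variable (F) in
/-- `g_K - 1` as a real number. -/
noncomputable def fieldGenus (K : IntermediateField (RatFunc F) Ω) [FiniteDimensional (RatFunc F) K] : ℝ :=
  genus F K - 1

variable (F) in
/-- The sum of the degrees of the places of `K` of degree at most `f`. -/
noncomputable def fieldPlaces (f : ℕ) (K : IntermediateField (RatFunc F) Ω)
    [FiniteDimensional (RatFunc F) K] : ℝ :=
  (∑ m ∈ Finset.Icc 1 f, m * numPlaces F K (Nat.card F ^ m) : ℕ)

theorem IsInfinite.exists_fieldGenus_pos {𝒦 : IntermediateField (RatFunc F) Ω}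
    (h : IsInfinite F 𝒦) : ∃ (K : IntermediateField (RatFunc F) Ω)
      (_ : FiniteDimensional (RatFunc F) K), K ≤ 𝒦 ∧ 0 < fieldGenus F K := by
  obtain ⟨K, hK, hfin, hg⟩ := h.genus_unbounded 2
  refine ⟨K, hfin, hK, ?_⟩
  have : (2 : ℝ) ≤ genus F K := by exact_mod_cast hg
  rw [fieldGenus]
  linarith

variable [Finite F]

variable (F) in
theorem countable_ratFunc : Countable (RatFunc F) := by
  have : Countable F[X] := Cardinal.mk_le_aleph0_iff.1 <|
    Polynomial.cardinalMk_le_max.trans (max_le Cardinal.mk_le_aleph0 le_rfl)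
  refine Function.Injective.countable (f := fun x : RatFunc F => (x.num, x.denom)) ?_
  intro x y hxy
  obtain ⟨h1, h2⟩ := Prod.mk.inj hxy
  rw [← RatFunc.num_div_denom x, h1, h2, RatFunc.num_div_denom]

theorem IsInfinite.nonempty_tower {𝒦 : IntermediateField (RatFunc F) Ω} (h : IsInfinite F 𝒦) :
    Nonempty (Tower 𝒦) :=
  have := countable_ratFunc F
  have := h.separable
  exists_tower 𝒦 h.infinite

theorem hasTowerLimit_fieldPlaces {𝒦 : IntermediateField (RatFunc F) Ω} (h : IsInfinite F 𝒦)
    (f : ℕ) : HasTowerLimit 𝒦 (fun K _ => fieldPlaces F f K / genus F K)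
      (sInf (ratioSet (fieldPlaces F f) (fieldGenus F) 𝒦)) := by
  -- Riemann–Hurwitz makes g − 1 supermultiplicative, not g; the shift c = 1 restores the
  -- denominator g.
  have := hasTowerLimit_div (S := fieldPlaces F f) (G := fieldGenus F) (𝒦 := 𝒦) 1
    (fun K _ => Nat.cast_nonneg _) h.exists_fieldGenus_pos (fun K L _ _ _ _ hL => ?_)
    fun K L _ _ _ _ hL => ?_
  · simpa only [fieldGenus, sub_add_cancel] using this
  · have := h.isSeparable hL
    rw [fieldPlaces, fieldPlaces]
    exact_mod_cast sum_numPlaces_le F K L f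
  · have := h.isSeparable hL
    rw [fieldGenus, fieldGenus]
    exact_mod_cast genus_sub_one_mul_finrank_le (F := F) (K := K) (L := L)

theorem hasTowerLimit_ratio {𝒦 : IntermediateField (RatFunc F) Ω} (h : IsInfinite F 𝒦) (m : ℕ) :
    HasTowerLimit 𝒦 (ratio F (Nat.card F ^ (m + 1)))
      ((sInf (ratioSet (fieldPlaces F (m + 1)) (fieldGenus F) 𝒦) -
        sInf (ratioSet (fieldPlaces F m) (fieldGenus F) 𝒦)) / (m + 1 : ℝ)) := by
  intro T
  refine (((hasTowerLimit_fieldPlaces h (m + 1) T).sub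
    (hasTowerLimit_fieldPlaces h m T)).div_const (m + 1 : ℝ)).congr fun i => ?_
  have h1 : fieldPlaces F (m + 1) (T.field i) = fieldPlaces F m (T.field i) +
      (m + 1 : ℝ) * numPlaces F (T.field i) (Nat.card F ^ (m + 1)) := by
    rw [fieldPlaces, fieldPlaces, Finset.sum_Icc_succ_top (by omega),
      Nat.cast_add, Nat.cast_mul, Nat.cast_add_one]
  have h2 : (m + 1 : ℝ) ≠ 0 := by positivity
  beta_reduce
  rw [h1, ← sub_div, add_sub_cancel_left, mul_div_assoc, mul_div_cancel_left₀ _ h2]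
  rfl

theorem existsUnique_hasTowerLimit_ratio {𝒦 : IntermediateField (RatFunc F) Ω}
    (h : IsInfinite F 𝒦) {m : ℕ} (hm : 1 ≤ m) :
    ∃! x, HasTowerLimit 𝒦 (ratio F (Nat.card F ^ m)) x := by
  obtain ⟨m, rfl⟩ := Nat.exists_eq_succ_of_ne_zero (Nat.one_le_iff_ne_zero.1 hm)
  exact (hasTowerLimit_ratio h m).existsUnique h.nonempty_tower

/-- Above a field of genus at least 2, Riemann–Hurwitz keeps the genus at least 1. This is enough to
get the sign of a limit. -/
theorem IsInfinite.eventually_genus_pos {𝒦 : IntermediateField (RatFunc F) Ω} (h : IsInfinite F 𝒦)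
    (T : Tower 𝒦) : ∀ᶠ i in Filter.atTop, 0 < genus F (T.field i) := by
  obtain ⟨K, hfin, hK, hg⟩ := h.exists_fieldGenus_pos
  obtain ⟨i₀, hi₀⟩ := T.exists_le K hK
  filter_upwards [Filter.eventually_ge_atTop i₀] with i hi
  let := (IntermediateField.inclusion (hi₀.trans (T.strictMono.monotone hi))).toAlgebra
  have : IsScalarTower (RatFunc F) K (T.field i) := IsScalarTower.of_algebraMap_eq fun x => rfl
  have := h.isSeparable (T.field_le i)
  have hle := genus_sub_one_mul_finrank_le (F := F) (K := K) (L := T.field i)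
  have hg' : 0 < genus F K - 1 := by rw [fieldGenus] at hg; exact_mod_cast hg
  have := (mul_nonneg hg'.le (Nat.cast_nonneg _)).trans hle
  linarith

theorem phi_nonneg {𝒦 : IntermediateField (RatFunc F) Ω} (h : IsInfinite F 𝒦) (m : ℕ) :
    0 ≤ phi F (Nat.card F ^ (m + 1)) 𝒦 := by
  obtain ⟨T⟩ := h.nonempty_tower
  have := hasTowerLimit_ratio h m
  rw [phi, this.towerLimit_eq ⟨T⟩]
  refine ge_of_tendsto (this T) ?_
  filter_upwards [h.eventually_genus_pos T] with i hi
  exact div_nonneg (Nat.cast_nonneg _) (Int.cast_nonneg hi.le)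

theorem sum_phi {𝒦 : IntermediateField (RatFunc F) Ω} (h : IsInfinite F 𝒦) (N : ℕ) :
    ∑ m ∈ Finset.range N, (m + 1 : ℝ) * phi F (Nat.card F ^ (m + 1)) 𝒦 =
      sInf (ratioSet (fieldPlaces F N) (fieldGenus F) 𝒦) -
        sInf (ratioSet (fieldPlaces F 0) (fieldGenus F) 𝒦) := by
  rw [← Finset.sum_range_sub (fun m => sInf (ratioSet (fieldPlaces F m) (fieldGenus F) 𝒦))]
  refine Finset.sum_congr rfl fun m _ => ?_
  have h2 : (m + 1 : ℝ) ≠ 0 := by positivity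
  rw [phi, (hasTowerLimit_ratio h m).towerLimit_eq h.nonempty_tower, mul_div_cancel₀ _ h2]

theorem sInf_ratioSet_fieldPlaces_zero {𝒦 : IntermediateField (RatFunc F) Ω}
    (h : IsInfinite F 𝒦) : sInf (ratioSet (fieldPlaces F 0) (fieldGenus F) 𝒦) = 0 := by
  obtain ⟨K, hK, hK𝒦, hG⟩ := h.exists_fieldGenus_pos
  have : ratioSet (fieldPlaces F 0) (fieldGenus F) 𝒦 = {0} := by
    ext x
    constructor
    · rintro ⟨K, hK, -, -, rfl⟩
      simp [fieldPlaces]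
    · rintro rfl
      exact ⟨K, hK, hK𝒦, hG, by simp [fieldPlaces]⟩
  rw [this, csInf_singleton]

theorem sum_phi_le {𝒦 ℒ : IntermediateField (RatFunc F) Ω} (h : IsInfinite F 𝒦)
    (h' : IsInfinite F ℒ) (hle : 𝒦 ≤ ℒ) (N : ℕ) :
    ∑ m ∈ Finset.range N, (m + 1 : ℝ) * phi F (Nat.card F ^ (m + 1)) ℒ ≤
      ∑ m ∈ Finset.range N, (m + 1 : ℝ) * phi F (Nat.card F ^ (m + 1)) 𝒦 := by
  rw [sum_phi h, sum_phi h', sInf_ratioSet_fieldPlaces_zero h,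
    sInf_ratioSet_fieldPlaces_zero h', sub_zero, sub_zero]
  exact sInf_ratioSet_anti hle (fun K _ => Nat.cast_nonneg _) h.exists_fieldGenus_pos

theorem deficiency₃_monotoneOn :
    MonotoneOn (deficiency₃ F (Ω := Ω)) {𝒦 | IsInfinite F 𝒦} := by
  intro 𝒦 h ℒ h' hle
  refine EReal.sub_le_sub le_rfl (EReal.coe_ennreal_le_coe_ennreal_iff.2 ?_)
  have hr : (1 : ℝ) < Nat.card F := by exact_mod_cast Finite.one_lt_card (α := F)
  have key : ∀ ℳ : IntermediateField (RatFunc F) Ω,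
      ∑' m : ℕ+, ENNReal.ofReal ((m : ℕ) * phi F (Nat.card F ^ (m : ℕ)) ℳ /
        ((Nat.card F : ℝ) ^ ((m : ℕ) / 2 : ℝ) - 1)) =
      ∑' m : ℕ, ENNReal.ofReal ((m + 1 : ℝ) * phi F (Nat.card F ^ (m + 1)) ℳ *
        (1 / ((Nat.card F : ℝ) ^ ((m + 1) / 2 : ℝ) - 1))) := by
    intro ℳ
    rw [← Equiv.pnatEquivNat.symm.tsum_eq]
    refine tsum_congr fun m => ?_
    simp only [Equiv.pnatEquivNat_symm_apply, Nat.succPNat_coe, Nat.succ_eq_add_one, Nat.cast_add,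
      Nat.cast_one, mul_one_div]
  have hw : ∀ m : ℕ, 0 < (Nat.card F : ℝ) ^ ((m + 1) / 2 : ℝ) - 1 := fun m =>
    sub_pos.2 (Real.one_lt_rpow hr (by positivity))
  rw [key, key]
  refine tsum_ofReal_mul_le_of_antitone
    (fun m => mul_nonneg (by positivity) (phi_nonneg h' m))
    (fun m => mul_nonneg (by positivity) (phi_nonneg h m)) ?_
    (fun m => (one_div_pos.2 (hw m)).le) (fun N => sum_phi_le h h' hle N)
  intro m n hmn
  refine one_div_le_one_div_of_le (hw m) (sub_le_sub_right ?_ _)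
  refine Real.rpow_le_rpow_of_exponent_le hr.le ?_
  have : (m : ℝ) ≤ n := by exact_mod_cast hmn
  linarith

end Limits

end FF

end InfiniteGlobalField
theorem theoremC
    {Ω : Type*} [Field Ω] [CharZero Ω]
    {F : Type*} [Field F] [Finite F]
    {E : Type*} [Field E] [Algebra F E] [Algebra (RatFunc F) E] [IsScalarTower F (RatFunc F) E] :
    -- the invariants are well defined
    (∀ 𝒦 : IntermediateField ℚ Ω, InfiniteGlobalField.NF.IsInfinite 𝒦 →
      (∀ q : ℕ, IsPrimePow q →
        ∃! x, InfiniteGlobalField.HasTowerLimit 𝒦 (InfiniteGlobalField.NF.ratio q) x) ∧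
      (∃! x, InfiniteGlobalField.HasTowerLimit 𝒦 InfiniteGlobalField.NF.realRatio x) ∧
      (∃! x, InfiniteGlobalField.HasTowerLimit 𝒦 InfiniteGlobalField.NF.complexRatio x)) ∧
    (∀ 𝒦 : IntermediateField (RatFunc F) E, InfiniteGlobalField.FF.IsInfinite F 𝒦 →
      ∀ m : ℕ, 1 ≤ m → ∃! x, InfiniteGlobalField.HasTowerLimit 𝒦
        (InfiniteGlobalField.FF.ratio F (Nat.card F ^ m)) x) ∧
    -- the deficiencies are increasing
    MonotoneOn (InfiniteGlobalField.NF.deficiency₁ (Ω := Ω))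
      {𝒦 | InfiniteGlobalField.NF.IsInfinite 𝒦} ∧
    MonotoneOn (InfiniteGlobalField.NF.deficiency₂ (Ω := Ω))
      {𝒦 | InfiniteGlobalField.NF.IsInfinite 𝒦} ∧
    MonotoneOn (InfiniteGlobalField.FF.deficiency₃ F (Ω := E))
      {𝒦 | InfiniteGlobalField.FF.IsInfinite F 𝒦} := by
  exact ⟨fun 𝒦 h => InfiniteGlobalField.NF.invariants_wellDefined h,
    fun 𝒦 h m hm => InfiniteGlobalField.FF.existsUnique_hasTowerLimit_ratio h hm,
    InfiniteGlobalField.NF.deficiency₁_monotoneOn, InfiniteGlobalField.NF.deficiency₂_monotoneOn,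
    InfiniteGlobalField.FF.deficiency₃_monotoneOn⟩
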